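/- Let $R$ be a nonzero commutative ring and let $\beta,\alpha_1,\alpha_2,\alpha_3,\gamma_{12},\gamma_3,\delta_1,\delta_2,\delta_3\in R$ (for instance $R=\mathbb{C}$ with complex parameters, or $R=\mathbb{C}[\beta,\dots,\delta_3]$ with the parameters as indeterminates). Let $n\ge 0$. *Diagrams.* Take a rectangle with $n$ nodes on its left side and $n$ nodes on its right side, and call its top and bottom sides boundaries. A $\mathrm{dGh}^2_n$-diagram consists of finitely many non-crossing strings in the rectangle, each connecting a node to another node or to a boundary, with at most one string end at each node (a node without a string is empty), together with finitely many ghosts (marked points) on the boundaries, away from the string ends, such that on each boundary the number of ghosts plus the number of string ends is even. String ends divide a boundary into domains. Two diagrams are equal if the same nodes are connected to each other, to the top and to the bottom, and the numbers of ghosts in corresponding domains agree modulo 2. A $\mathrm{Gh}^2_n$-diagram is one without empty nodes; $\mathrm{dGh}^1_n$- and $\mathrm{Gh}^1_n$-diagrams are the $\mathrm{dGh}^2_n$- and $\mathrm{Gh}^2_n$-diagrams without strings attached to the bottom boundary. *Algebras.* For $A\in\{\mathrm{Gh}^1_n,\mathrm{Gh}^2_n,\mathrm{dGh}^1_n,\mathrm{dGh}^2_n\}$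 let $A$ also denote the free $R$-module on the $A$-diagrams, with the bilinear product in which $xy$, for diagrams $x,y$, is found as follows. Draw $y$ to the right of $x$, identifying the right nodes of $x$ with the left nodes of $y$. If a string meets an empty node in the middle, then $xy=0$. Otherwise number the ghosts and string ends on each boundary by $1,2,\dots$ from left to right; remove each loop for a factor $\beta$; remove each boundary arc (a string with both ends on boundaries), leaving a ghost at each of its ends, for a factor which is: for an arc with both ends on the top boundary, $\alpha_1$ if its left end has an odd and its right end an even number, $\alpha_2$ if even and odd, $\alpha_3$ if both parities agree; for an arc with both ends on the bottom boundary, $\delta_1,\delta_2,\delta_3$ in the same cases; for an arc from top to bottom, $\gamma_{12}$ if the parities of its ends differ and $\gamma_3$ if they agree. Finally remove the middle line. Then $xy$ is the product of these factors times the resulting diagram. *Half-diagrams.* A throughline of a diagram is a string connecting its two sides. An $A$-half-diagram with $d$ defects on $n$ nodes is obtained from an $A$-diagram with $d$ throughlines by cutting the throughlines and discarding the right-hand part with the strings attached to it, the number of ghosts in the rightmost domain of each boundary being adjusted so that ghosts plus string ends are again even in number; the cut throughlines are the defects. For $A$-half-diagrams $S,T$ with $d$ defects, $C^d_{S,T}$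 is the diagram obtained by reflecting $T$ about a vertical line and connecting its defects to those of $S$ from top to bottom (ghosts in the joined domains are added). **Theorem.** For each of these four $A$, the product of two $A$-diagrams is zero or a scalar multiple of an $A$-diagram, $A$ is an associative unital $R$-algebra, and it is cellular in the sense of Graham and Lehrer, as follows. Its identity is the diagram with $n$ horizontal strings if $A$ is $\mathrm{Gh}^1_n$ or $\mathrm{Gh}^2_n$, and the sum of the $2^n$ diagrams in which each level has either a horizontal string or two empty nodes if $A$ is $\mathrm{dGh}^1_n$ or $\mathrm{dGh}^2_n$. Let $\Lambda=\{0,1,\dots,n\}$ with its usual order, let $M(d)$ be the set of $A$-half-diagrams with $d$ defects, and let $*$ be the $R$-linear map that reflects each diagram about a vertical line. Then 1. each $M(d)$ is finite, and $(d,S,T)\mapsto C^d_{S,T}$ is an injective map from $\bigsqcup_{d\in\Lambda}M(d)\times M(d)$ to $A$ whose image is an $R$-basis of $A$; 2. $*$ is an $R$-linear anti-involution of $A$ with $(C^d_{S,T})^*=C^d_{T,S}$; 3. for all $d\in\Lambda$ and $a\in A$ there are $r_a(S',S)\in R$ for $S',S\in M(d)$ such that for all $S,T\in M(d)$ $$aC^d_{S,T}\equiv\sum_{S'\in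 M(d)}r_a(S',S)\,C^d_{S',T}\pmod{A(<d)},$$ where $A(<d)$ is the $R$-submodule generated by all $C^{\mu}_{U,V}$ with $\mu<d$ and $U,V\in M(\mu)$. -/

import Mathlib

namespace GhostAlg

/-! ## Drawings and diagrams -/

/-- The nodes of a rectangle with `n` nodes on the left side and `m` nodes on the right side,
both numbered from top to bottom. -/
abbrev Node (n m : ℕ) : Type := Fin n ⊕ Fin m

/-- Combinatorial data of a picture in a rectangle with a top and a bottom boundary.
`partner p = some q` means that a string connects the nodes `p` and `q`.  The lists `top` and `bot`
record what is found along each boundary, from left to right: `none` is a ghost, and `some p` is the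
end of a string whose other end is the node `p`. -/
@[ext]
structure Drawing (n m : ℕ) where
  partner : Node n m → Option (Node n m)
  top : List (Option (Node n m))
  bot : List (Option (Node n m))

/-- Clockwise position on the perimeter of the rectangle, starting at the bottom left corner: the
left side upwards, the top from left to right, the right side downwards, the bottom from right to
left (lexicographic order). -/
def nodePos {n m : ℕ} : Node n m → ℕ ×ₗ ℤ
  | Sum.inl i => toLex (0, -((i : ℕ) : ℤ))
  | Sum.inr j => toLex (2, ((j : ℕ) : ℤ))

/-- Position on the perimeter of the entry with index `i` of the top boundary. -/
def topPos (i : ℕ) : ℕ ×ₗ ℤ := toLex (1, (i : ℤ))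

/-- Position on the perimeter of the entry with index `i` of the bottom boundary. -/
def botPos (i : ℕ) : ℕ ×ₗ ℤ := toLex (3, -(i : ℤ))

namespace Drawing

variable {n m k : ℕ}

/-- `D.IsString a b`: some string of `D` has its ends at the positions `a` and `b`. -/
inductive IsString (D : Drawing n m) : ℕ ×ₗ ℤ → ℕ ×ₗ ℤ → Prop
  | node {p q : Node n m} (h : D.partner p = some q) : IsString D (nodePos p) (nodePos q)
  | top {p : Node n m} {i : ℕ} (h : D.top[i]? = some (some p)) :
      IsString D (nodePos p) (topPos i)
  | bot {p : Node n m} {i : ℕ} (h : D.bot[i]? = some (some p)) :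
      IsString D (nodePos p) (botPos i)
  | symm {a b : ℕ ×ₗ ℤ} (h : IsString D a b) : IsString D b a

/-- A string is attached to the node `p`; otherwise `p` is an empty node. -/
def Occupied (D : Drawing n m) (p : Node n m) : Prop :=
  D.partner p ≠ none ∨ some p ∈ D.top ∨ some p ∈ D.bot

/-- Diagrams (possibly with empty nodes), drawn with at most one ghost in each domain.  As ghosts
only count modulo 2 in each domain, each diagram has exactly one such drawing. -/
structure IsDiagram (D : Drawing n m) : Prop where
  partner_ne : ∀ p, D.partner p ≠ some p
  partner_symm : ∀ p q, D.partner p = some q → D.partner q = some p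
  /-- At most one string end is attached to each node. -/
  ends_nodup : (D.top.reduceOption ++ D.bot.reduceOption).Nodup
  partner_eq_none : ∀ p, some p ∈ D.top ∨ some p ∈ D.bot → D.partner p = none
  /-- On each boundary, ghosts plus strings are even in number. -/
  even_top : Even D.top.length
  even_bot : Even D.bot.length
  /-- There are no two adjacent ghosts. -/
  reduced_top : D.top.IsChain (fun a b => a ≠ none ∨ b ≠ none)
  reduced_bot : D.bot.IsChain (fun a b => a ≠ none ∨ b ≠ none)
  noncrossing : ∀ a b c d, D.IsString a b → D.IsString c d → ¬ (a < c ∧ c < b ∧ b < d)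

/-- Reflection about a vertical line. -/
def reflect (D : Drawing n m) : Drawing m n where
  partner p := (D.partner p.swap).map Sum.swap
  top := D.top.reverse.map (Option.map Sum.swap)
  bot := D.bot.reverse.map (Option.map Sum.swap)

/-- A horizontal string at each level in `E`; the nodes at the other levels are empty. -/
def horizontal {n : ℕ} (E : Finset (Fin n)) : Drawing n n where
  partner
    | Sum.inl i => if i ∈ E then some (Sum.inr i) else none
    | Sum.inr i => if i ∈ E then some (Sum.inl i) else none
  top := []
  bot := []

end Drawing

/-! ## Concatenation -/

/-- Removes pairs of adjacent ghosts as long as there are any. -/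
def cancelGhosts {α : Type} : List (Option α) → List (Option α)
  | [] => []
  | some a :: l => some a :: cancelGhosts l
  | none :: l =>
    match cancelGhosts l with
    | none :: l' => l'
    | l' => none :: l'

/-- The nodes of two rectangles drawn side by side: left, middle and right. -/
abbrev Vertex (n m k : ℕ) : Type := Fin n ⊕ (Fin m ⊕ Fin k)

section Concatenation

variable {n m k : ℕ}

/-- The nodes of the left rectangle. -/
def vertexL : Node n m → Vertex n m k
  | Sum.inl i => Sum.inl i
  | Sum.inr j => Sum.inr (Sum.inl j)

/-- The nodes of the right rectangle. -/
def vertexR : Node m k → Vertex n m k := Sum.inr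

/-- The middle nodes. -/
def vertexM (j : Fin m) : Vertex n m k := Sum.inr (Sum.inl j)

/-- The nodes that remain after the middle line has been removed. -/
def vertexOuter : Node n k → Vertex n m k
  | Sum.inl i => Sum.inl i
  | Sum.inr j => Sum.inr (Sum.inr j)

variable (x : Drawing n m) (y : Drawing m k)

/-- Two nodes are connected by a string of one of the two drawings. -/
def Linked (u v : Vertex n m k) : Prop :=
  (∃ p q, x.partner p = some q ∧ u = vertexL p ∧ v = vertexL q) ∨
  (∃ p q, y.partner p = some q ∧ u = vertexR p ∧ v = vertexR q)

/-- Two nodes lie on the same string (or loop) of the concatenated picture. -/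
def Joined (u v : Vertex n m k) : Prop := Relation.EqvGen (Linked x y) u v

/-- The top boundary of the concatenated picture; `some v` is the end of a string that is attached
to the node `v` in its own rectangle. -/
def concatTop : List (Option (Vertex n m k)) :=
  x.top.map (Option.map vertexL) ++ y.top.map (Option.map vertexR)

/-- The bottom boundary of the concatenated picture. -/
def concatBot : List (Option (Vertex n m k)) :=
  x.bot.map (Option.map vertexL) ++ y.bot.map (Option.map vertexR)

/-- No string meets an empty node in the middle. -/
def Compatible : Prop := ∀ j : Fin m, x.Occupied (Sum.inr j) ↔ y.Occupied (Sum.inl j)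

/-- The number of loops in the concatenated picture: the connected components in which each node is
a middle node with a string to another node on either side. -/
noncomputable def loopCount : ℕ :=
  Nat.card {c : Quotient (Relation.EqvGen.setoid (Linked x y)) //
    ∀ v, Quotient.mk _ v = c →
      ∃ j, v = vertexM j ∧ x.partner (Sum.inr j) ≠ none ∧ y.partner (Sum.inl j) ≠ none}

/-- The boundary entries with index `i` in `W` and index `j` in `W'` are two ends on a common
string. -/
def SameString (W W' : List (Option (Vertex n m k))) (i j : ℕ) : Prop :=
  ∃ u v, W[i]? = some (some u) ∧ W'[j]? = some (some v) ∧ Joined x y u v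

/-- Number of boundary arcs with both ends on the top boundary, the number of the left end having
property `P` and that of the right end having property `Q`.  Entries are numbered from 1. -/
noncomputable def topArcCount (P Q : ℕ → Prop) : ℕ :=
  Nat.card {e : ℕ × ℕ // e.1 < e.2 ∧ SameString x y (concatTop x y) (concatTop x y) e.1 e.2 ∧
    P (e.1 + 1) ∧ Q (e.2 + 1)}

/-- The same for the bottom boundary. -/
noncomputable def botArcCount (P Q : ℕ → Prop) : ℕ :=
  Nat.card {e : ℕ × ℕ // e.1 < e.2 ∧ SameString x y (concatBot x y) (concatBot x y) e.1 e.2 ∧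
    P (e.1 + 1) ∧ Q (e.2 + 1)}

/-- Number of boundary arcs from the top boundary to the bottom boundary, the number of the top end
having property `P` and that of the bottom end having property `Q`. -/
noncomputable def crossArcCount (P Q : ℕ → Prop) : ℕ :=
  Nat.card {e : ℕ × ℕ // SameString x y (concatTop x y) (concatBot x y) e.1 e.2 ∧
    P (e.1 + 1) ∧ Q (e.2 + 1)}

open Classical in
/-- What a boundary entry becomes when the boundary arcs are removed: a string end that is
connected to a remaining node stays, the end of a boundary arc becomes a ghost, and a ghost stays. -/
noncomputable def remaining : Option (Vertex n m k) → Option (Node n k)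
  | none => none
  | some v => if h : ∃ p : Node n k, Joined x y v (vertexOuter p) then some h.choose else none

open Classical in
/-- Concatenation: the middle line, all loops and all boundary arcs are removed, a ghost is left at
each end of a boundary arc, and pairs of ghosts in the same domain are cancelled. -/
noncomputable def concat : Drawing n k where
  partner p :=
    if h : ∃ q : Node n k, q ≠ p ∧ Joined x y (vertexOuter p) (vertexOuter q) then some h.choose
    else none
  top := cancelGhosts ((concatTop x y).map (remaining x y))
  bot := cancelGhosts ((concatBot x y).map (remaining x y))

end Concatenation

/-- The nine parameters. -/
structure Params (R : Type*) where
  (β α₁ α₂ α₃ γ₁₂ γ₃ δ₁ δ₂ δ₃ : R)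

/-- The product of the parameters of the loops and boundary arcs in the concatenated picture. -/
noncomputable def weight {R : Type*} [CommRing R] (P : Params R) {n m k : ℕ}
    (x : Drawing n m) (y : Drawing m k) : R :=
  P.β ^ loopCount x y *
  (P.α₁ ^ topArcCount x y Odd Even * P.α₂ ^ topArcCount x y Even Odd *
    P.α₃ ^ (topArcCount x y Odd Odd + topArcCount x y Even Even)) *
  (P.δ₁ ^ botArcCount x y Odd Even * P.δ₂ ^ botArcCount x y Even Odd *
    P.δ₃ ^ (botArcCount x y Odd Odd + botArcCount x y Even Even)) *
  (P.γ₁₂ ^ (crossArcCount x y Odd Even + crossArcCount x y Even Odd) *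
    P.γ₃ ^ (crossArcCount x y Odd Odd + crossArcCount x y Even Even))

/-! ## The four algebras -/

/-- The four families of algebras. -/
inductive Kind
  | Gh1
  | Gh2
  | dGh1
  | dGh2

/-- Empty nodes are allowed in the dilute families. -/
def Kind.Dilute : Kind → Prop
  | Gh1 => False
  | Gh2 => False
  | dGh1 => True
  | dGh2 => True

/-- Strings may be attached to the bottom boundary in the two-boundary families. -/
def Kind.TwoBoundary : Kind → Prop
  | Gh1 => False
  | Gh2 => True
  | dGh1 => False
  | dGh2 => True

/-- The diagrams of each family. -/
structure Drawing.OfKind (κ : Kind) {n m : ℕ} (D : Drawing n m) : Prop where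
  isDiagram : D.IsDiagram
  occupied : ¬ κ.Dilute → ∀ p, D.Occupied p
  no_bot : ¬ κ.TwoBoundary → ∀ p, some p ∉ D.bot

/-- The diagrams with `n` nodes on each side. -/
abbrev Diagram (κ : Kind) (n : ℕ) : Type := {D : Drawing n n // D.OfKind κ}

/-- The half-diagrams on `n` nodes with `d` defects.  The free ends of the defects are the nodes on
the right side of the rectangle. -/
abbrev HalfDiagram (κ : Kind) (n d : ℕ) : Type :=
  {D : Drawing n d // D.OfKind κ ∧ ∀ j : Fin d, ∃ i : Fin n, D.partner (Sum.inr j) = some (Sum.inl i)}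

/-- The free `R`-module on the diagrams. -/
def GhostAlgebra (κ : Kind) (n : ℕ) {R : Type*} [CommRing R] (_P : Params R) : Type _ :=
  Diagram κ n →₀ R

namespace GhostAlgebra

variable {κ : Kind} {n : ℕ} {R : Type*} [CommRing R] {P : Params R}

noncomputable instance : AddCommGroup (GhostAlgebra κ n P) :=
  inferInstanceAs (AddCommGroup (Diagram κ n →₀ R))

noncomputable instance : Module R (GhostAlgebra κ n P) :=
  inferInstanceAs (Module R (Diagram κ n →₀ R))

/-- The basis of diagrams. -/
noncomputable def basis : Module.Basis (Diagram κ n) R (GhostAlgebra κ n P) :=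
  Module.Basis.ofRepr (LinearEquiv.refl R (Diagram κ n →₀ R))

open Classical in
/-- The basis element of a diagram (zero for a drawing that is not a diagram). -/
noncomputable def ofDrawing (D : Drawing n n) : GhostAlgebra κ n P :=
  if h : D.OfKind κ then basis ⟨D, h⟩ else 0

open Classical in
/-- The product of two diagrams. -/
noncomputable def diagramMul (x y : Diagram κ n) : GhostAlgebra κ n P :=
  if Compatible x.1 y.1 then weight P x.1 y.1 • ofDrawing (concat x.1 y.1) else 0

/-- The bilinear extension of the product of diagrams. -/
noncomputable def mulHom :
    GhostAlgebra κ n P →ₗ[R] GhostAlgebra κ n P →ₗ[R] GhostAlgebra κ n P :=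
  basis.constr R fun x => basis.constr R fun y => diagramMul x y

noncomputable instance : NonUnitalNonAssocRing (GhostAlgebra κ n P) where
  mul a b := mulHom a b
  left_distrib a b c := map_add (mulHom a) b c
  right_distrib a b c := LinearMap.map_add₂ mulHom a b c
  zero_mul a := LinearMap.map_zero₂ mulHom a
  mul_zero a := map_zero (mulHom a)

instance : IsScalarTower R (GhostAlgebra κ n P) (GhostAlgebra κ n P) where
  smul_assoc r a b := LinearMap.map_smul₂ mulHom r a b

instance : SMulCommClass R (GhostAlgebra κ n P) (GhostAlgebra κ n P) where
  smul_comm r a b := (map_smul (mulHom a) r b).symm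

open Classical in
/-- In the dilute algebras, the identity is the sum of all diagrams in which each level either has a
horizontal string or has two empty nodes; in the other algebras, it is the diagram with `n`
horizontal strings. -/
noncomputable instance : One (GhostAlgebra κ n P) where
  one :=
    if κ.Dilute then ∑ E : Finset (Fin n), ofDrawing (Drawing.horizontal E)
    else ofDrawing (Drawing.horizontal Finset.univ)

variable (κ n P)

/-- The linear map that reflects each diagram about a vertical line. -/
noncomputable def reflection : GhostAlgebra κ n P →ₗ[R] GhostAlgebra κ n P :=
  basis.constr R fun x => ofDrawing x.1.reflect

/-- The diagram obtained from two half-diagrams with `d` defects by reflecting the second one about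
a vertical line and connecting its defects to those of the first one from top to bottom. -/
noncomputable def glue (d : Fin (n + 1)) (S T : HalfDiagram κ n d) : GhostAlgebra κ n P :=
  ofDrawing (concat S.1 T.1.reflect)

end GhostAlgebra

/-! ## Cellular algebras -/

/-- `A` is an associative unital `R`-algebra and `(Λ, M, C, star)` is a cell datum for it, in the
sense of Graham and Lehrer. -/
structure IsCellDatum (R A : Type*) [CommRing R] [NonUnitalNonAssocRing A] [One A] [Module R A]
    [IsScalarTower R A A] [SMulCommClass R A A] {Λ : Type*} [PartialOrder Λ] (M : Λ → Type*)
    (C : (l : Λ) → M l → M l → A) (star : A →ₗ[R] A) : Prop where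
  mul_assoc : ∀ a b c : A, a * b * c = a * (b * c)
  one_mul : ∀ a : A, 1 * a = a
  mul_one : ∀ a : A, a * 1 = a
  finite : ∀ l, Finite (M l)
  injective : Function.Injective fun s : Σ l, M l × M l => C s.1 s.2.1 s.2.2
  linearIndependent : LinearIndependent R fun s : Σ l, M l × M l => C s.1 s.2.1 s.2.2
  span_eq_top : Submodule.span R (Set.range fun s : Σ l, M l × M l => C s.1 s.2.1 s.2.2) = ⊤
  star_star : ∀ a, star (star a) = a
  star_mul : ∀ a b, star (a * b) = star b * star a
  star_apply : ∀ l (S T : M l), star (C l S T) = C l T S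
  /-- The coefficients `r S' S` depend on `a` but not on `T`. -/
  mul_apply : ∀ (l : Λ) (a : A), ∃ r : M l → M l → R, ∀ S T : M l,
    a * C l S T - ∑ᶠ S' : M l, r S' S • C l S' T ∈
      Submodule.span R {b | ∃ μ, μ < l ∧ ∃ U V : M μ, b = C μ U V}

end GhostAlg

/-! A concatenated picture is planar, so each connected component of strings is a loop or has
exactly two ends. To prove this, the string ends of both rectangles are put into one linear order:
the perimeter of the right rectangle is inserted between the right side and the bottom of the left
one. In this order the strings form a noncrossing pairing, and the two copies of the lowest occupied
middle node are adjacent. Joining two adjacent points of a noncrossing pairing leaves a noncrossing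
pairing of the other points (`IsPairing.join`), so the middle nodes can be joined from bottom to
top. The result is `exists_isPairing_joined`, from which `concat_isDiagram` follows: products are
multiples of diagrams.

Associativity holds because both bracketings simplify the same picture of three rectangles in a row.
Simplifying a part first (`Contraction`) loses nothing: the loops and boundary arcs of the whole are
those of the part together with those of the simplified picture. The parameter of an arc depends on
the parities of the numbers of its ends, and these survive, since ghosts disappear in adjacent pairs
and each boundary of a diagram has an even number of entries. This gives `Contraction.drawing_eq`
and `Contraction.weight_eq`. Evenness also makes reflection compatible with the parameters
(`weight_reflect`): reflection flips the parity of every number and exchanges left and right ends.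

Cellularity is then mostly formal. A half-diagram with `d` defects is a drawing from `n` nodes to
`d` nodes in which every right node is connected to a left one (`Drawing.Through`). Write `T*` for
the reflection of `T`. For such `T`, the picture `T* T` simplifies to `d` horizontal strings. If `S
T* = S' T'*`, then `S = S T* T = S' Z` with `Z = T'* T`, and `Z` is again through. Hence `S` has at
most as many defects as `S'`, and if the numbers agree, then `Z` is the identity and `S = S'`.
Cutting the throughlines shows that every diagram has the form `S T*` (`concat_leftCut`), so the
diagrams correspond to the pairs of half-diagrams.

Finally, `x (S T*) = (x S) T*` up to a scalar that depends on `x` and `S` only, because attaching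
`T*` along its defects creates neither loops nor boundary arcs. If `x S` is through, it is a
half-diagram with `d` defects. Otherwise `(x S) T*` has fewer throughlines, by the same cancellation
argument. -/

namespace GhostAlg

/-! ## Cancellation of ghosts -/

/-- The second list arises from the first by repeatedly removing two adjacent ghosts. -/
inductive Cancels {α : Type} (l : List (Option α)) : List (Option α) → Prop
  | refl : Cancels l l
  | step {a b : List (Option α)} (h : Cancels l (a ++ none :: none :: b)) : Cancels l (a ++ b)

namespace Cancels

variable {α β : Type} {l l' l'' : List (Option α)}

theorem trans (h : Cancels l l') (h' : Cancels l' l'') : Cancels l l'' := by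
  induction h' with
  | refl => exact h
  | step _ ih => exact ih.step

theorem append_left (a : List (Option α)) (h : Cancels l l') : Cancels (a ++ l) (a ++ l') := by
  induction h with
  | refl => exact .refl
  | @step b c _ ih =>
    rw [← List.append_assoc] at ih ⊢
    exact ih.step

theorem append_right (a : List (Option α)) (h : Cancels l l') : Cancels (l ++ a) (l' ++ a) := by
  induction h with
  | refl => exact .refl
  | @step b c _ ih =>
    rw [List.append_assoc] at ih ⊢
    exact ih.step

theorem append {m m' : List (Option α)} (h : Cancels l l') (h' : Cancels m m') :
    Cancels (l ++ m) (l' ++ m') :=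
  (h.append_right m).trans (h'.append_left l')

theorem map (g : Option α → Option β) (hg : g none = none) (h : Cancels l l') :
    Cancels (l.map g) (l'.map g) := by
  induction h with
  | refl => exact .refl
  | step _ ih =>
    simp only [List.map_append, List.map_cons, hg] at ih ⊢
    exact ih.step

theorem reverse (h : Cancels l l') : Cancels l.reverse l'.reverse := by
  induction h with
  | refl => exact .refl
  | @step a b _ ih =>
    rw [List.reverse_append] at ih ⊢
    simp only [List.reverse_cons, List.append_assoc, List.singleton_append] at ih
    exact ih.step

theorem even_length (h : Cancels l l') : Even l'.length ↔ Even l.length := by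
  induction h with
  | refl => rfl
  | step _ ih =>
    rw [← ih]
    simp only [List.length_append, List.length_cons]
    grind

/-- The entries that are left sit in the original list at positions of the same parity, and only
ghosts have been removed. -/
theorem exists_orderEmbedding (h : Cancels l l') :
    ∃ f : ℕ ↪o ℕ, (∀ i, l'[i]? = l[f i]?) ∧ (∀ i, Even (f i) ↔ Even i) ∧
      ∀ k a, l[k]? = some (some a) → ∃ i, f i = k := by
  induction h with
  | refl => exact ⟨RelEmbedding.refl _, fun _ => rfl, fun _ => Iff.rfl, fun k _ _ => ⟨k, rfl⟩⟩
  | @step a b _ ih =>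
    obtain ⟨f, hf, hp, hs⟩ := ih
    -- The removed ghosts sit at the positions `a.length` and `a.length + 1`; later entries move by
    -- 2, which keeps their parity.
    have hmono : StrictMono fun i => if i < a.length then i else i + 2 := by
      intro i j hij
      dsimp only
      split_ifs <;> omega
    refine ⟨(OrderEmbedding.ofStrictMono _ hmono).trans f, fun i => ?_, fun i => ?_,
      fun k c hk => ?_⟩
    · change _ = _[f (if i < a.length then i else i + 2)]?
      rw [← hf]
      split_ifs with hi
      · rw [List.getElem?_append_left hi, List.getElem?_append_left hi]
      · rw [List.getElem?_append_right (by omega), List.getElem?_append_right (by omega),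
          show i + 2 - a.length = (i - a.length) + 1 + 1 by omega]
        rfl
    · change Even (f (if i < a.length then i else i + 2)) ↔ _
      rw [hp]
      split_ifs
      · rfl
      · grind
    · obtain ⟨i, rfl⟩ := hs k c hk
      rw [← hf] at hk
      by_cases hi : i < a.length
      · exact ⟨i, by change f (if i < a.length then i else i + 2) = _; rw [if_pos hi]⟩
      · rw [List.getElem?_append_right (by omega)] at hk
        obtain ⟨t, ht⟩ : ∃ t, i = a.length + t := ⟨i - a.length, by omega⟩
        subst ht
        rw [Nat.add_sub_cancel_left] at hk
        -- The offsets 0 and 1 belong to the removed ghosts, which carry no string end.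
        match t, hk with
        | 0, hk => simp at hk
        | 1, hk => simp at hk
        | t + 2, hk =>
          refine ⟨a.length + t, ?_⟩
          change f (if a.length + t < a.length then _ else a.length + t + 2) = _
          rw [if_neg (by omega)]
          rfl

end Cancels

section cancelGhosts

variable {α β : Type} {l l' : List (Option α)}

theorem cancels_cancelGhosts (l : List (Option α)) : Cancels l (cancelGhosts l) := by
  induction l with
  | nil => exact .refl
  | cons a l ih =>
    cases a with
    | some a => exact ih.append_left [some a]
    | none =>
      have h := ih.append_left [none]
      rw [cancelGhosts]
      split
      · next l' hl =>
        rw [hl] at h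
        exact Cancels.step (a := []) h
      · exact h

theorem isChain_cancelGhosts (l : List (Option α)) :
    (cancelGhosts l).IsChain fun a b => a ≠ none ∨ b ≠ none := by
  induction l with
  | nil => exact List.isChain_nil
  | cons a l ih =>
    cases a with
    | some a =>
      rw [cancelGhosts, List.isChain_cons]
      exact ⟨fun _ _ => Or.inl (by simp), ih⟩
    | none =>
      rw [cancelGhosts]
      split
      · next l' hl =>
        rw [hl] at ih
        exact (List.isChain_cons.1 ih).2
      · next hl =>
        rw [List.isChain_cons]
        refine ⟨fun b hb => Or.inr ?_, ih⟩
        rintro rfl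
        match hc : cancelGhosts l, hb with
        | b :: l', hb =>
          obtain rfl : b = none := by simpa using hb
          exact hl l' hc

theorem cancelGhosts_of_isChain (h : l.IsChain fun a b => a ≠ none ∨ b ≠ none) :
    cancelGhosts l = l := by
  induction l with
  | nil => rfl
  | cons a l ih =>
    rw [List.isChain_cons] at h
    cases a with
    | some a => rw [cancelGhosts, ih h.2]
    | none =>
      rw [cancelGhosts, ih h.2]
      split
      · next l' => have := h.1 none rfl; simp at this
      · rfl

theorem cancelGhosts_cons_congr {a : Option α} (h : cancelGhosts l = cancelGhosts l') :
    cancelGhosts (a :: l) = cancelGhosts (a :: l') := by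
  cases a <;> simp only [cancelGhosts, h]

/-- The recursion inspects only the head of the normal form. Since the normal form has no two
adjacent ghosts, prepending a ghost and cancelling is an involution on normal forms. -/
theorem cancelGhosts_none_none (l : List (Option α)) :
    cancelGhosts (none :: none :: l) = cancelGhosts l := by
  have h := isChain_cancelGhosts l
  rw [cancelGhosts, cancelGhosts]
  match hc : cancelGhosts l with
  | [] => rfl
  | some a :: l' => rfl
  | none :: [] => rfl
  | none :: some a :: l' => rfl
  | none :: none :: l' =>
    rw [hc] at h
    simp at h

/-- Confluence: the normal form does not depend on which pairs are removed first. Hence ghosts may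
be cancelled before or after concatenation, and in either reading direction. -/
theorem Cancels.cancelGhosts_eq (h : Cancels l l') : cancelGhosts l = cancelGhosts l' := by
  induction h with
  | refl => rfl
  | @step a b h ih =>
    rw [ih]
    clear ih h
    induction a with
    | nil => exact cancelGhosts_none_none b
    | cons c a ih => exact cancelGhosts_cons_congr ih

theorem Cancels.eq_cancelGhosts (h : Cancels l l')
    (h' : l'.IsChain fun a b => a ≠ none ∨ b ≠ none) : cancelGhosts l = l' :=
  h.cancelGhosts_eq.trans (cancelGhosts_of_isChain h')

theorem cancels_replicate (a b : List (Option α)) {t : ℕ} (ht : Even t) :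
    Cancels (a ++ List.replicate t none ++ b) (a ++ b) := by
  obtain ⟨s, rfl⟩ := ht
  induction s with
  | zero => simpa using Cancels.refl
  | succ s ih =>
    refine Cancels.trans ?_ ih
    rw [show s + 1 + (s + 1) = s + s + 1 + 1 by omega, List.append_assoc, List.append_assoc]
    exact Cancels.refl.step

theorem eq_nil_of_forall_eq_none (h : ∀ a ∈ l, a = none) (he : Even l.length)
    (hc : l.IsChain fun a b => a ≠ none ∨ b ≠ none) : l = [] := by
  have hl := List.eq_replicate_iff.2 ⟨rfl, h⟩
  rw [← cancelGhosts_of_isChain hc, hl]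
  have h := (cancels_replicate (α := α) [] [] he).cancelGhosts_eq
  simpa [cancelGhosts] using h

theorem mem_of_mem_cancelGhosts {a : Option α} (h : a ∈ cancelGhosts l) : a ∈ l := by
  obtain ⟨f, hf, -⟩ := (cancels_cancelGhosts l).exists_orderEmbedding
  obtain ⟨i, hi⟩ := List.mem_iff_getElem?.1 h
  exact List.mem_iff_getElem?.2 ⟨f i, by rw [← hf, hi]⟩

theorem some_mem_cancelGhosts {a : α} : some a ∈ cancelGhosts l ↔ some a ∈ l := by
  refine ⟨mem_of_mem_cancelGhosts, fun h => ?_⟩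
  obtain ⟨f, hf, -, hs⟩ := (cancels_cancelGhosts l).exists_orderEmbedding
  obtain ⟨k, hk⟩ := List.mem_iff_getElem?.1 h
  obtain ⟨i, rfl⟩ := hs k a hk
  exact List.mem_iff_getElem?.2 ⟨i, by rw [hf, hk]⟩

end cancelGhosts

end GhostAlg

namespace GhostAlg

/-! ## Noncrossing pairings and the joining of adjacent points -/

/-- Each class of the equivalence relation `r` contains no point or exactly two points of `S`, and
the pairs of points of `S` that arise in this way do not cross: both or none of the points of one
pair lie between the points of another one. -/
structure IsPairing {X : Type*} [LinearOrder X] (r : X → X → Prop) (S : Set X) : Prop where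
  equivalence : Equivalence r
  exists_ne : ∀ a ∈ S, ∃ b ∈ S, b ≠ a ∧ r a b
  eq_or_eq : ∀ a ∈ S, ∀ b ∈ S, ∀ c ∈ S, r a b → r a c → a = b ∨ a = c ∨ b = c
  noncrossing : ∀ a ∈ S, ∀ b ∈ S, ∀ c ∈ S, ∀ d ∈ S, r a b → r c d → c ≠ a → c ≠ b → d ≠ a → d ≠ b →
    ((a < c ↔ b < c) ↔ (a < d ↔ b < d))

/-- The equivalence relation that arises from `r` by joining the classes of `p` and `q`. -/
def joinClasses {X : Type*} (r : X → X → Prop) (p q : X) (u v : X) : Prop :=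
  r u v ∨ (r u p ∧ r q v) ∨ (r u q ∧ r p v)

section joinClasses

variable {X : Type*} {r : X → X → Prop} {p q : X}

theorem joinClasses_equivalence (h : Equivalence r) : Equivalence (joinClasses r p q) where
  refl u := Or.inl (h.refl u)
  symm {u v} := by
    have := @h.symm
    unfold joinClasses
    grind
  trans {u v w} := by
    have h1 := @h.symm
    have h2 := @h.trans
    rintro (h | ⟨h, h'⟩ | ⟨h, h'⟩) (k | ⟨k, k'⟩ | ⟨k, k'⟩)
    · exact Or.inl (h2 h k)
    · exact Or.inr (Or.inl ⟨h2 h k, k'⟩)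
    · exact Or.inr (Or.inr ⟨h2 h k, k'⟩)
    · exact Or.inr (Or.inl ⟨h, h2 h' k⟩)
    · exact Or.inl (h2 h (h2 (h1 (h2 h' k)) k'))
    · exact Or.inl (h2 h k')
    · exact Or.inr (Or.inr ⟨h, h2 h' k⟩)
    · exact Or.inl (h2 h k')
    · exact Or.inl (h2 h (h2 (h1 (h2 h' k)) k'))

theorem joinClasses_le {s : X → X → Prop} (hs : Equivalence s) (h : ∀ u v, r u v → s u v)
    (hpq : s p q) {u v : X} (huv : joinClasses r p q u v) : s u v := by
  rcases huv with h1 | ⟨h1, h2⟩ | ⟨h1, h2⟩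
  · exact h _ _ h1
  · exact hs.trans (h _ _ h1) (hs.trans hpq (h _ _ h2))
  · exact hs.trans (h _ _ h1) (hs.trans (hs.symm hpq) (h _ _ h2))

end joinClasses

/-- Addition modulo 2. It is used in the form: if neither half of a path separates two points from
each other, then the composed path does not separate them. -/
theorem iff_iff_iff_trans {A A' B B' Q Q' : Prop} (h : (A ↔ Q) ↔ (A' ↔ Q'))
    (h' : (Q ↔ B) ↔ (Q' ↔ B')) : (A ↔ B) ↔ (A' ↔ B') := by
  grind

/-- Joining two adjacent points of a noncrossing pairing. -/
theorem IsPairing.join {X : Type*} [LinearOrder X] {r : X → X → Prop} {S : Set X}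
    (h : IsPairing r S) {p q : X} (hp : p ∈ S) (hq : q ∈ S) (hpq : p < q)
    (hadj : ∀ c ∈ S, ¬ (p < c ∧ c < q)) : IsPairing (joinClasses r p q) (S \ {p, q}) := by
  have symm := @h.equivalence.symm
  have trans := @h.equivalence.trans
  have mem : ∀ a, a ∈ S \ {p, q} ↔ a ∈ S ∧ a ≠ p ∧ a ≠ q := by
    intro a
    simp
  -- The partners of `p` and `q` form the only new pair, unless `p` and `q` are partners of each
  -- other and simply disappear.
  obtain ⟨p', hp', hpp', hrp⟩ := h.exists_ne p hp
  obtain ⟨q', hq', hqq', hrq⟩ := h.exists_ne q hq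
  have classP : ∀ a ∈ S, a ≠ p → r a p → a = p' := fun a ha hap hr => by
    have := h.eq_or_eq p hp a ha p' hp' (symm hr) hrp
    tauto
  have classQ : ∀ a ∈ S, a ≠ q → r a q → a = q' := fun a ha hap hr => by
    have := h.eq_or_eq q hq a ha q' hq' (symm hr) hrq
    tauto
  have side : ∀ c ∈ S, c ≠ p → c ≠ q → (c < p ∧ c < q) ∨ (p < c ∧ q < c) := by
    intro c hc h1 h2
    rcases lt_or_gt_of_ne h1 with h3 | h3
    · exact Or.inl ⟨h3, h3.trans hpq⟩
    · rcases lt_or_gt_of_ne h2 with h4 | h4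
      · exact absurd ⟨h3, h4⟩ (hadj c hc)
      · exact Or.inr ⟨h3, h4⟩
  refine ⟨joinClasses_equivalence h.equivalence, fun a ha => ?_, fun a ha b hb c hc => ?_,
    fun a ha b hb c hc d hd => ?_⟩
  · rw [mem] at ha
    obtain ⟨ha, hap, haq⟩ := ha
    obtain ⟨b, hb, hba, hab⟩ := h.exists_ne a ha
    by_cases hbp : b = p
    · subst hbp
      have hp'q : p' ≠ q := by
        rintro rfl
        exact haq (classP a ha hap hab)
      have hqa : ¬ r q a := fun h' => hp'q (by
        have := classP q hq hpq.ne' (trans h' hab)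
        exact this.symm)
      refine ⟨q', (mem _).2 ⟨hq', ?_, hqq'⟩, ?_, Or.inr (Or.inl ⟨hab, hrq⟩)⟩
      · rintro rfl
        exact hqa (trans hrq (symm hab))
      · rintro rfl
        exact hqa hrq
    · by_cases hbq : b = q
      · subst hbq
        have hpa : ¬ r p a := fun h' => by
          have h1 := classP a ha hap (symm h')
          have h2 := classP b hq hpq.ne' (trans (symm hab) (symm h'))
          exact hba (h2.trans h1.symm)
        refine ⟨p', (mem _).2 ⟨hp', hpp', ?_⟩, ?_, Or.inr (Or.inr ⟨hab, hrp⟩)⟩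
        · rintro rfl
          exact hpa (trans hrp (symm hab))
        · rintro rfl
          exact hpa hrp
      · exact ⟨b, (mem _).2 ⟨hb, hbp, hbq⟩, hba, Or.inl hab⟩
  · rw [mem] at ha hb hc
    obtain ⟨ha, hap, haq⟩ := ha
    obtain ⟨hb, hbp, hbq⟩ := hb
    obtain ⟨hc, hcp, hcq⟩ := hc
    rintro (h1 | ⟨h1, h2⟩ | ⟨h1, h2⟩) (k1 | ⟨k1, k2⟩ | ⟨k1, k2⟩)
    · exact h.eq_or_eq a ha b hb c hc h1 k1
    · exact Or.inl ((classP a ha hap k1).trans (classP b hb hbp (trans (symm h1) k1)).symm)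
    · exact Or.inl ((classQ a ha haq k1).trans (classQ b hb hbq (trans (symm h1) k1)).symm)
    · exact Or.inr (Or.inl ((classP a ha hap h1).trans (classP c hc hcp (trans (symm k1) h1)).symm))
    · exact Or.inr (Or.inr ((classQ b hb hbq (symm h2)).trans (classQ c hc hcq (symm k2)).symm))
    · exact Or.inl ((classP a ha hap h1).trans (classP b hb hbp
        (trans (symm h2) (trans (symm k1) h1))).symm)
    · exact Or.inr (Or.inl ((classQ a ha haq h1).trans (classQ c hc hcq (trans (symm k1) h1)).symm))
    · exact Or.inl ((classQ a ha haq h1).trans (classQ b hb hbq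
        (trans (symm h2) (trans (symm k1) h1))).symm)
    · exact Or.inr (Or.inr ((classP b hb hbp (symm h2)).trans (classP c hc hcp (symm k2)).symm))
  · rw [mem] at ha hb hc hd
    obtain ⟨ha, hap, haq⟩ := ha
    obtain ⟨hb, hbp, hbq⟩ := hb
    obtain ⟨hc, hcp, hcq⟩ := hc
    obtain ⟨hd, hdp, hdq⟩ := hd
    intro hab hcd hca hcb hda hdb
    have nc := h.noncrossing
    have side' : ∀ c ∈ S, c ≠ p → c ≠ q → (p < c ↔ q < c) := fun c hc h1 h2 => by
      rcases side c hc h1 h2 with h3 | h3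
      · simp [h3.1.not_gt, h3.2.not_gt]
      · simp [h3.1, h3.2]
    have sc := side' c hc hcp hcq
    have sd := side' d hd hdp hdq
    have sa := side' a ha hap haq
    have sb := side' b hb hbp hbq
    have flip : ∀ u v : X, u ≠ v → (u < v ↔ ¬ v < u) := fun u v huv =>
      ⟨fun h => h.not_gt, fun h => lt_of_le_of_ne (not_lt.1 h) huv⟩
    -- Only one pair is new, so two different pairs cannot both arise from `p` and `q`; these four
    -- cases contradict uniqueness of partners. If one pair is new, the noncrossing relations for
    -- its two old halves are combined. They fit together because every remaining point has `p` and
    -- `q` on the same side.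
    rcases hab with h1 | ⟨h1, h2⟩ | ⟨h1, h2⟩ <;> rcases hcd with k1 | ⟨k1, k2⟩ | ⟨k1, k2⟩
    · exact nc a ha b hb c hc d hd h1 k1 hca hcb hda hdb
    · have n1 := nc a ha b hb c hc p hp h1 k1 hca hcb hap.symm hbp.symm
      have n2 := nc a ha b hb q hq d hd h1 k2 haq.symm hbq.symm hda hdb
      have f1 := flip a p hap
      have f2 := flip b p hbp
      have f3 := flip a q haq
      have f4 := flip b q hbq
      rw [f1, f2, sa, sb, ← f3, ← f4] at n1
      exact n1.trans n2
    · have n1 := nc a ha b hb c hc q hq h1 k1 hca hcb haq.symm hbq.symm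
      have n2 := nc a ha b hb p hp d hd h1 k2 hap.symm hbp.symm hda hdb
      have f1 := flip a p hap
      have f2 := flip b p hbp
      have f3 := flip a q haq
      have f4 := flip b q hbq
      rw [f3, f4, ← sa, ← sb, ← f1, ← f2] at n1
      exact n1.trans n2
    · have n1 := nc a ha p hp c hc d hd h1 k1 hca hcp hda hdp
      have n2 := nc q hq b hb c hc d hd h2 k1 hcq hcb hdq hdb
      rw [sc, sd] at n1
      exact iff_iff_iff_trans n1 n2
    · exact absurd ((classP c hc hcp k1).trans (classP a ha hap h1).symm) hca
    · exact absurd ((classQ c hc hcq k1).trans (classQ b hb hbq (symm h2)).symm) hcb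
    · have n1 := nc a ha q hq c hc d hd h1 k1 hca hcq hda hdq
      have n2 := nc p hp b hb c hc d hd h2 k1 hcp hcb hdp hdb
      rw [← sc, ← sd] at n1
      exact iff_iff_iff_trans n1 n2
    · exact absurd ((classP c hc hcp k1).trans (classP b hb hbp (symm h2)).symm) hcb
    · exact absurd ((classQ c hc hcq k1).trans (classQ a ha haq h1).symm) hca

end GhostAlg

namespace GhostAlg

/-! ## Strings of a diagram -/

section Positions

variable {n m : ℕ}

theorem lex_lt_iff {α β : Type*} [LT α] [LT β] {a b : α ×ₗ β} :
    a < b ↔ (ofLex a).1 < (ofLex b).1 ∨ (ofLex a).1 = (ofLex b).1 ∧ (ofLex a).2 < (ofLex b).2 :=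
  Prod.Lex.lt_iff

@[simp]
theorem nodePos_inj {p q : Node n m} : nodePos p = nodePos q ↔ p = q := by
  refine ⟨fun h => ?_, fun h => h ▸ rfl⟩
  rcases p with i | i <;> rcases q with j | j <;>
    simp [nodePos, Prod.ext_iff, Fin.ext_iff] at h ⊢ <;> exact h

@[simp]
theorem topPos_inj {i j : ℕ} : topPos i = topPos j ↔ i = j := by
  simp [topPos, Prod.ext_iff]

@[simp]
theorem botPos_inj {i j : ℕ} : botPos i = botPos j ↔ i = j := by
  simp [botPos, Prod.ext_iff]

@[simp]
theorem nodePos_ne_topPos {p : Node n m} {i : ℕ} : nodePos p ≠ topPos i := by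
  rcases p with j | j <;> simp [nodePos, topPos, Prod.ext_iff]

@[simp]
theorem nodePos_ne_botPos {p : Node n m} {i : ℕ} : nodePos p ≠ botPos i := by
  rcases p with j | j <;> simp [nodePos, botPos, Prod.ext_iff]

@[simp]
theorem topPos_ne_botPos {i j : ℕ} : topPos i ≠ botPos j := by
  simp [topPos, botPos, Prod.ext_iff]

@[simp]
theorem topPos_ne_nodePos {p : Node n m} {i : ℕ} : topPos i ≠ nodePos p := nodePos_ne_topPos.symm

@[simp]
theorem botPos_ne_nodePos {p : Node n m} {i : ℕ} : botPos i ≠ nodePos p := nodePos_ne_botPos.symm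

@[simp]
theorem botPos_ne_topPos {i j : ℕ} : botPos i ≠ topPos j := topPos_ne_botPos.symm

end Positions

/-- A position `a` is that of the node `p` or that of a boundary entry attached to `p`. -/
inductive Drawing.EndAt {n m : ℕ} (D : Drawing n m) : ℕ ×ₗ ℤ → Node n m → Prop
  | node (p : Node n m) : EndAt D (nodePos p) p
  | top {p : Node n m} {i : ℕ} (h : D.top[i]? = some (some p)) : EndAt D (topPos i) p
  | bot {p : Node n m} {i : ℕ} (h : D.bot[i]? = some (some p)) : EndAt D (botPos i) p

namespace Drawing

variable {n m : ℕ} {D : Drawing n m} {a b c : ℕ ×ₗ ℤ} {p q : Node n m}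

theorem EndAt.unique (h : D.EndAt a p) (h' : D.EndAt a q) : p = q := by
  generalize ha : a = a' at h'
  cases h <;> cases h' <;> simp at ha <;> subst ha
  · rfl
  · next h h' => simpa using h.symm.trans h'
  · next h h' => simpa using h.symm.trans h'

theorem IsString.exists_endAt (h : D.IsString a b) :
    ∃ p q, D.EndAt a p ∧ D.EndAt b q ∧ (p = q ∨ D.partner p = some q ∨ D.partner q = some p) := by
  induction h with
  | @node p q h => exact ⟨p, q, .node p, .node q, .inr (.inl h)⟩
  | @top p i h => exact ⟨p, p, .node p, .top h, .inl rfl⟩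
  | @bot p i h => exact ⟨p, p, .node p, .bot h, .inl rfl⟩
  | symm _ ih =>
    obtain ⟨p, q, h1, h2, h3⟩ := ih
    exact ⟨q, p, h2, h1, by tauto⟩

theorem isString_iff : D.IsString a b ↔
    (∃ p q, (D.partner p = some q ∨ D.partner q = some p) ∧ a = nodePos p ∧ b = nodePos q) ∨
    (∃ p i, D.top[i]? = some (some p) ∧
      (a = nodePos p ∧ b = topPos i ∨ b = nodePos p ∧ a = topPos i)) ∨
    (∃ p i, D.bot[i]? = some (some p) ∧
      (a = nodePos p ∧ b = botPos i ∨ b = nodePos p ∧ a = botPos i)) := by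
  refine ⟨fun h => ?_, ?_⟩
  · induction h with
    | @node p q h => exact .inl ⟨p, q, .inl h, rfl, rfl⟩
    | @top p i h => exact .inr (.inl ⟨p, i, h, .inl ⟨rfl, rfl⟩⟩)
    | @bot p i h => exact .inr (.inr ⟨p, i, h, .inl ⟨rfl, rfl⟩⟩)
    | symm _ ih =>
      rcases ih with ⟨p, q, h, h1, h2⟩ | ⟨p, i, h, h'⟩ | ⟨p, i, h, h'⟩
      · exact .inl ⟨q, p, h.symm, h2, h1⟩
      · exact .inr (.inl ⟨p, i, h, h'.symm⟩)
      · exact .inr (.inr ⟨p, i, h, h'.symm⟩)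
  · rintro (⟨p, q, h | h, rfl, rfl⟩ | ⟨p, i, h, ⟨rfl, rfl⟩ | ⟨rfl, rfl⟩⟩ |
      ⟨p, i, h, ⟨rfl, rfl⟩ | ⟨rfl, rfl⟩⟩)
    exacts [.node h, (IsString.node h).symm, .top h, (IsString.top h).symm, .bot h,
      (IsString.bot h).symm]

theorem isString_nodePos (hD : D.IsDiagram) : D.IsString (nodePos p) b ↔
    (∃ q, D.partner p = some q ∧ b = nodePos q) ∨
    (∃ i, D.top[i]? = some (some p) ∧ b = topPos i) ∨
    (∃ i, D.bot[i]? = some (some p) ∧ b = botPos i) := by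
  rw [isString_iff]
  simp only [nodePos_inj, nodePos_ne_topPos, nodePos_ne_botPos, and_false, or_false]
  constructor
  · rintro (⟨p, q, h, rfl, rfl⟩ | ⟨p, i, h, rfl, rfl⟩ | ⟨p, i, h, rfl, rfl⟩)
    · exact .inl ⟨q, h.elim id (hD.partner_symm _ _), rfl⟩
    · exact .inr (.inl ⟨i, h, rfl⟩)
    · exact .inr (.inr ⟨i, h, rfl⟩)
  · rintro (⟨q, h, rfl⟩ | ⟨i, h, rfl⟩ | ⟨i, h, rfl⟩)
    · exact .inl ⟨p, q, .inl h, rfl, rfl⟩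
    · exact .inr (.inl ⟨p, i, h, rfl, rfl⟩)
    · exact .inr (.inr ⟨p, i, h, rfl, rfl⟩)

theorem isString_topPos {i : ℕ} :
    D.IsString (topPos i) b ↔ ∃ p, D.top[i]? = some (some p) ∧ b = nodePos p := by
  rw [isString_iff]
  simp only [topPos_ne_nodePos, topPos_ne_botPos, topPos_inj, and_false, false_and, false_or,
    or_false, exists_false]
  constructor
  · rintro ⟨p, i, h, rfl, rfl⟩
    exact ⟨p, h, rfl⟩
  · rintro ⟨p, h, rfl⟩
    exact ⟨p, i, h, rfl, rfl⟩

theorem isString_botPos {i : ℕ} :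
    D.IsString (botPos i) b ↔ ∃ p, D.bot[i]? = some (some p) ∧ b = nodePos p := by
  rw [isString_iff]
  simp only [botPos_ne_nodePos, botPos_ne_topPos, botPos_inj, and_false, false_and, false_or,
    or_false, exists_false]
  constructor
  · rintro ⟨p, i, h, rfl, rfl⟩
    exact ⟨p, h, rfl⟩
  · rintro ⟨p, h, rfl⟩
    exact ⟨p, i, h, rfl, rfl⟩

theorem some_mem_iff {α : Type*} {l : List (Option α)} {a : α} :
    some a ∈ l ↔ ∃ i : ℕ, l[i]? = some (some a) :=
  List.mem_iff_getElem?

theorem index_unique_of_nodup {α : Type*} {l : List (Option α)} (h : l.reduceOption.Nodup)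
    {i j : ℕ} {a : α} (hi : l[i]? = some (some a)) (hj : l[j]? = some (some a)) : i = j := by
  induction l generalizing i j with
  | nil => simp at hi
  | cons b l ih =>
    have hmem : ∀ {k : ℕ}, l[k]? = some (some a) → a ∈ l.reduceOption := fun hk =>
      List.reduceOption_mem_iff.2 (List.mem_iff_getElem?.2 ⟨_, hk⟩)
    cases b with
    | none =>
      rw [List.reduceOption_cons_of_none] at h
      cases i <;> cases j <;> simp at hi hj
      exact congrArg _ (ih h hi hj)
    | some b =>
      rw [List.reduceOption_cons_of_some, List.nodup_cons] at h
      cases i <;> cases j <;> simp at hi hj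
      · rfl
      · exact absurd (hmem hj) (hi ▸ h.1)
      · exact absurd (hmem hi) (hj ▸ h.1)
      · exact congrArg _ (ih h.2 hi hj)

theorem IsDiagram.top_unique (hD : D.IsDiagram) {i j : ℕ} (hi : D.top[i]? = some (some p))
    (hj : D.top[j]? = some (some p)) : i = j :=
  index_unique_of_nodup (List.nodup_append.1 hD.ends_nodup).1 hi hj

theorem IsDiagram.bot_unique (hD : D.IsDiagram) {i j : ℕ} (hi : D.bot[i]? = some (some p))
    (hj : D.bot[j]? = some (some p)) : i = j :=
  index_unique_of_nodup (List.nodup_append.1 hD.ends_nodup).2.1 hi hj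

theorem IsDiagram.not_top_and_bot (hD : D.IsDiagram) (h : some p ∈ D.top) (h' : some p ∈ D.bot) :
    False :=
  (List.nodup_append.1 hD.ends_nodup).2.2 p (List.reduceOption_mem_iff.2 h) p
    (List.reduceOption_mem_iff.2 h') rfl

/-- A node carries at most one string end, so the three kinds of strings exclude each other at a
node. Together with `IsDiagram.isString_ne`, the strings define an involution without fixed points
on the string ends. -/
theorem IsDiagram.isString_unique (hD : D.IsDiagram) (h : D.IsString a b) (h' : D.IsString a c) :
    b = c := by
  obtain ⟨p, q, ha, -⟩ := h.exists_endAt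
  cases ha with
  | node p =>
    rw [isString_nodePos hD] at h h'
    have hn := hD.partner_eq_none p
    have ht := @IsDiagram.not_top_and_bot n m D p hD
    rw [some_mem_iff, some_mem_iff] at hn ht
    rcases h with ⟨q, h, rfl⟩ | ⟨i, h, rfl⟩ | ⟨i, h, rfl⟩ <;>
      rcases h' with ⟨q', h', rfl⟩ | ⟨i', h', rfl⟩ | ⟨i', h', rfl⟩
    · rw [h] at h'
      rw [Option.some.inj h']
    · rw [hn (.inl ⟨_, h'⟩)] at h
      simp at h
    · rw [hn (.inr ⟨_, h'⟩)] at h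
      simp at h
    · rw [hn (.inl ⟨_, h⟩)] at h'
      simp at h'
    · rw [hD.top_unique h h']
    · exact (ht ⟨_, h⟩ ⟨_, h'⟩).elim
    · rw [hn (.inr ⟨_, h⟩)] at h'
      simp at h'
    · exact (ht ⟨_, h'⟩ ⟨_, h⟩).elim
    · rw [hD.bot_unique h h']
  | top hi =>
    rw [isString_topPos] at h h'
    obtain ⟨p, h, rfl⟩ := h
    obtain ⟨q, h', rfl⟩ := h'
    simpa using h.symm.trans h'
  | bot hi =>
    rw [isString_botPos] at h h'
    obtain ⟨p, h, rfl⟩ := h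
    obtain ⟨q, h', rfl⟩ := h'
    simpa using h.symm.trans h'

theorem IsDiagram.isString_ne (hD : D.IsDiagram) (h : D.IsString a b) : a ≠ b := by
  rw [isString_iff] at h
  rcases h with ⟨p, q, h, rfl, rfl⟩ | ⟨p, i, h, ⟨rfl, rfl⟩ | ⟨rfl, rfl⟩⟩ |
      ⟨p, i, h, ⟨rfl, rfl⟩ | ⟨rfl, rfl⟩⟩
  · rw [Ne, nodePos_inj]
    rintro rfl
    exact hD.partner_ne p (h.elim id id)
  all_goals simp

theorem occupied_iff (hD : D.IsDiagram) : D.Occupied p ↔ ∃ b, D.IsString (nodePos p) b := by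
  simp only [isString_nodePos hD, Occupied, Option.ne_none_iff_exists', some_mem_iff]
  constructor
  · rintro (⟨q, h⟩ | ⟨i, h⟩ | ⟨i, h⟩)
    exacts [⟨_, .inl ⟨q, h, rfl⟩⟩, ⟨_, .inr (.inl ⟨i, h, rfl⟩)⟩, ⟨_, .inr (.inr ⟨i, h, rfl⟩)⟩]
  · rintro ⟨b, ⟨q, h, -⟩ | ⟨i, h, -⟩ | ⟨i, h, -⟩⟩
    exacts [.inl ⟨q, h⟩, .inr (.inl ⟨i, h⟩), .inr (.inr ⟨i, h⟩)]

/-- Two strings separate the ends of each other or do not meet. -/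
theorem IsDiagram.not_separated (hD : D.IsDiagram) {d : ℕ ×ₗ ℤ} (hab : D.IsString a b)
    (hcd : D.IsString c d) (hca : c ≠ a) (hcb : c ≠ b) (hda : d ≠ a) (hdb : d ≠ b) :
    (a < c ↔ b < c) ↔ (a < d ↔ b < d) := by
  -- `noncrossing` forbids one linear order of the four ends. Reversing each string and exchanging
  -- the two strings gives all the orders in which they cross.
  have h1 := hD.noncrossing a b c d hab hcd
  have h2 := hD.noncrossing b a c d hab.symm hcd
  have h3 := hD.noncrossing a b d c hab hcd.symm
  have h4 := hD.noncrossing b a d c hab.symm hcd.symm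
  have h5 := hD.noncrossing c d a b hcd hab
  have h6 := hD.noncrossing c d b a hcd hab.symm
  have h7 := hD.noncrossing d c a b hcd.symm hab
  have h8 := hD.noncrossing d c b a hcd.symm hab.symm
  rcases lt_or_gt_of_ne hca with o1 | o1 <;> rcases lt_or_gt_of_ne hcb with o2 | o2 <;>
    rcases lt_or_gt_of_ne hda with o3 | o3 <;> rcases lt_or_gt_of_ne hdb with o4 | o4 <;>
    simp only [o1, o2, o3, o4, o1.not_gt, o2.not_gt, o3.not_gt, o4.not_gt, true_and, and_true,
      not_true, iff_true, iff_false, not_false_iff] at h1 h2 h3 h4 h5 h6 h7 h8 ⊢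

end Drawing

end GhostAlg

namespace GhostAlg

/-! ## The concatenated picture is planar -/

/-- The order of the ends of strings in the concatenated picture, clockwise from the bottom left
corner of the left rectangle: the perimeter of the right rectangle is inserted between the right
side and the bottom of the left one. -/
def leftKey (a : ℕ ×ₗ ℤ) : ℕ ×ₗ (ℕ ×ₗ ℤ) := toLex (if (ofLex a).1 ≤ 2 then 0 else 2, a)

/-- The order of the ends of strings on the perimeter of the right rectangle, see `leftKey`. -/
def rightKey (a : ℕ ×ₗ ℤ) : ℕ ×ₗ (ℕ ×ₗ ℤ) := toLex (1, a)

section Keys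

variable {a b : ℕ ×ₗ ℤ}

/-- The block number 0 or 2 is itself monotone in the side, because the bottom is the last side of
the perimeter. -/
theorem leftKey_lt : leftKey a < leftKey b ↔ a < b := by
  simp only [leftKey, Prod.Lex.toLex_lt_toLex]
  rw [lex_lt_iff (a := a)]
  split_ifs <;> omega

theorem rightKey_lt : rightKey a < rightKey b ↔ a < b := by
  simp [rightKey, Prod.Lex.toLex_lt_toLex]

theorem leftKey_lt_rightKey : leftKey a < rightKey b ↔ (ofLex a).1 ≤ 2 := by
  simp only [leftKey, rightKey, Prod.Lex.toLex_lt_toLex]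
  split_ifs <;> simp_all

theorem rightKey_lt_leftKey : rightKey a < leftKey b ↔ ¬ (ofLex b).1 ≤ 2 := by
  simp only [leftKey, rightKey, Prod.Lex.toLex_lt_toLex]
  split_ifs <;> simp_all

@[simp]
theorem leftKey_inj : leftKey a = leftKey b ↔ a = b :=
  ⟨fun h => by simpa [leftKey] using congrArg (fun t => (ofLex t).2) h, fun h => h ▸ rfl⟩

@[simp]
theorem rightKey_inj : rightKey a = rightKey b ↔ a = b :=
  ⟨fun h => by simpa [rightKey] using congrArg (fun t => (ofLex t).2) h, fun h => h ▸ rfl⟩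

@[simp]
theorem leftKey_ne_rightKey : leftKey a ≠ rightKey b := by
  intro h
  have := congrArg (fun t => (ofLex t).1) h
  simp only [leftKey, rightKey, ofLex_toLex] at this
  split_ifs at this
  omega

@[simp]
theorem rightKey_ne_leftKey : rightKey a ≠ leftKey b := leftKey_ne_rightKey.symm

end Keys

section Planarity

variable {n m k : ℕ} (x : Drawing n m) (y : Drawing m k)

/-- Two points of the picture are equal or connected by a string of one of the two drawings. -/
def KeyLinked (u v : ℕ ×ₗ (ℕ ×ₗ ℤ)) : Prop :=
  u = v ∨ (∃ a b, x.IsString a b ∧ u = leftKey a ∧ v = leftKey b) ∨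
    ∃ a b, y.IsString a b ∧ u = rightKey a ∧ v = rightKey b

/-- All ends of strings of the two drawings. -/
def keyEnds : Set (ℕ ×ₗ (ℕ ×ₗ ℤ)) :=
  {u | (∃ a b, x.IsString a b ∧ u = leftKey a) ∨ ∃ a b, y.IsString a b ∧ u = rightKey a}

variable {x y}

/-- Within one rectangle this is planarity of the diagram. Strings of different rectangles do not
separate each other's ends, because the whole right rectangle occupies one gap in the perimeter of
the left one. -/
theorem isPairing_keyLinked (hx : x.IsDiagram) (hy : y.IsDiagram) :
    IsPairing (KeyLinked x y) (keyEnds x y) where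
  equivalence := by
    refine ⟨fun _ => .inl rfl, ?_, ?_⟩
    · rintro u v (rfl | ⟨a, b, h, rfl, rfl⟩ | ⟨a, b, h, rfl, rfl⟩)
      exacts [.inl rfl, .inr (.inl ⟨_, _, h.symm, rfl, rfl⟩), .inr (.inr ⟨_, _, h.symm, rfl, rfl⟩)]
    · rintro u v w (rfl | ⟨a, b, h, rfl, rfl⟩ | ⟨a, b, h, rfl, rfl⟩) h'
      · exact h'
      · rcases h' with rfl | ⟨c, d, h', e, rfl⟩ | ⟨c, d, h', e, rfl⟩
        · exact .inr (.inl ⟨_, _, h, rfl, rfl⟩)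
        · rw [leftKey_inj] at e
          subst e
          exact .inl (by rw [hx.isString_unique h.symm h'])
        · simp at e
      · rcases h' with rfl | ⟨c, d, h', e, rfl⟩ | ⟨c, d, h', e, rfl⟩
        · exact .inr (.inr ⟨_, _, h, rfl, rfl⟩)
        · simp at e
        · rw [rightKey_inj] at e
          subst e
          exact .inl (by rw [hy.isString_unique h.symm h'])
  exists_ne := by
    rintro u (⟨a, b, h, rfl⟩ | ⟨a, b, h, rfl⟩)
    · exact ⟨leftKey b, .inl ⟨b, a, h.symm, rfl⟩, by simpa using (hx.isString_ne h).symm,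
        .inr (.inl ⟨a, b, h, rfl, rfl⟩)⟩
    · exact ⟨rightKey b, .inr ⟨b, a, h.symm, rfl⟩, by simpa using (hy.isString_ne h).symm,
        .inr (.inr ⟨a, b, h, rfl, rfl⟩)⟩
  eq_or_eq := by
    rintro u - v - w - (rfl | ⟨a, b, h, rfl, rfl⟩ | ⟨a, b, h, rfl, rfl⟩)
      (rfl | ⟨c, d, h', e, rfl⟩ | ⟨c, d, h', e, rfl⟩)
    any_goals tauto
    · rw [leftKey_inj] at e
      subst e
      exact .inr (.inr (by rw [hx.isString_unique h h']))
    · simp at e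
    · simp at e
    · rw [rightKey_inj] at e
      subst e
      exact .inr (.inr (by rw [hy.isString_unique h h']))
  noncrossing := by
    rintro u - v - s - t - (rfl | ⟨a, b, h, rfl, rfl⟩ | ⟨a, b, h, rfl, rfl⟩)
      (rfl | ⟨c, d, h', rfl, rfl⟩ | ⟨c, d, h', rfl, rfl⟩)
    any_goals simp only [iff_self, implies_true]
    · simp only [ne_eq, leftKey_inj, leftKey_lt]
      exact hx.not_separated h h'
    · simp only [leftKey_lt_rightKey, iff_self, implies_true]
    · simp only [rightKey_lt_leftKey, iff_self, implies_true]
    · simp only [ne_eq, rightKey_inj, rightKey_lt]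
      exact hy.not_separated h h'

end Planarity

end GhostAlg

/-! ### Joining the middle nodes from bottom to top -/

namespace GhostAlg

section Planarity

variable {n m k : ℕ} (x : Drawing n m) (y : Drawing m k)

/-- The end of a string at the point `u` of the picture is attached to the node `v`. -/
def KeyAt (u : ℕ ×ₗ (ℕ ×ₗ ℤ)) (v : Vertex n m k) : Prop :=
  (∃ a p, x.EndAt a p ∧ u = leftKey a ∧ v = vertexL p) ∨
    ∃ a p, y.EndAt a p ∧ u = rightKey a ∧ v = vertexR p

/-- Two points of the picture are equal or attached to joined nodes. -/
def KeyJoined (u v : ℕ ×ₗ (ℕ ×ₗ ℤ)) : Prop :=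
  u = v ∨ ∃ s t, KeyAt x y u s ∧ KeyAt x y v t ∧ Joined x y s t

/-- The ends that remain when the middle nodes with number at least `t` are removed. -/
def keyEndsBelow (t : ℕ) : Set (ℕ ×ₗ (ℕ ×ₗ ℤ)) :=
  keyEnds x y \ {u | ∃ j : Fin m, t ≤ j ∧ (u = leftKey (nodePos (Sum.inr j : Node n m)) ∨
    u = rightKey (nodePos (Sum.inl j : Node m k)))}

/-- The ends of strings in the concatenated picture before the cancellation of ghosts: the occupied
outer nodes and the string ends on the boundaries. -/
inductive RawEnd : ℕ ×ₗ ℤ → Vertex n m k → Prop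
  | left {i : Fin n} (h : x.Occupied (Sum.inl i)) :
    RawEnd (nodePos (Sum.inl i : Node n k)) (Sum.inl i)
  | right {j : Fin k} (h : y.Occupied (Sum.inr j)) :
    RawEnd (nodePos (Sum.inr j : Node n k)) (Sum.inr (Sum.inr j))
  | top {i : ℕ} {v : Vertex n m k} (h : (concatTop x y)[i]? = some (some v)) : RawEnd (topPos i) v
  | bot {i : ℕ} {v : Vertex n m k} (h : (concatBot x y)[i]? = some (some v)) : RawEnd (botPos i) v

variable {x y}

theorem joined_equivalence : Equivalence (Joined x y) := Relation.EqvGen.is_equivalence _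

theorem Joined.symm {u v : Vertex n m k} (h : Joined x y u v) : Joined x y v u :=
  joined_equivalence.symm h

theorem Joined.trans {u v w : Vertex n m k} (h : Joined x y u v) (h' : Joined x y v w) :
    Joined x y u w :=
  joined_equivalence.trans h h'

theorem Joined.refl (v : Vertex n m k) : Joined x y v v := joined_equivalence.refl v

theorem joined_left {p q : Node n m} (h : x.partner p = some q) :
    Joined x y (vertexL p) (vertexL q) :=
  .rel _ _ (.inl ⟨p, q, h, rfl, rfl⟩)

theorem joined_right {p q : Node m k} (h : y.partner p = some q) :
    Joined x y (vertexR p) (vertexR q) :=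
  .rel _ _ (.inr ⟨p, q, h, rfl, rfl⟩)

theorem vertexOuter_injective : Function.Injective (vertexOuter : Node n k → Vertex n m k) := by
  rintro (i | i) (j | j) h <;> simp_all [vertexOuter]

theorem KeyAt.unique {u : ℕ ×ₗ (ℕ ×ₗ ℤ)} {v w : Vertex n m k} (h : KeyAt x y u v)
    (h' : KeyAt x y u w) : v = w := by
  rcases h with ⟨a, p, h, rfl, rfl⟩ | ⟨a, p, h, rfl, rfl⟩ <;>
    rcases h' with ⟨b, q, h', e, rfl⟩ | ⟨b, q, h', e, rfl⟩
  · rw [leftKey_inj] at e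
    subst e
    rw [h.unique h']
  · simp at e
  · simp at e
  · rw [rightKey_inj] at e
    subst e
    rw [h.unique h']

theorem keyJoined_equivalence : Equivalence (KeyJoined x y) where
  refl _ := .inl rfl
  symm := by
    rintro u v (rfl | ⟨s, t, h, h', j⟩)
    exacts [.inl rfl, .inr ⟨t, s, h', h, j.symm⟩]
  trans := by
    rintro u v w (rfl | ⟨s, t, h1, h2, j⟩) h'
    · exact h'
    · rcases h' with rfl | ⟨s', t', h1', h2', j'⟩
      · exact .inr ⟨s, t, h1, h2, j⟩
      · rw [h2.unique h1'] at j
        exact .inr ⟨s, t', h1, h2', j.trans j'⟩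

theorem keyJoined_of_keyLinked {u v : ℕ ×ₗ (ℕ ×ₗ ℤ)} (h : KeyLinked x y u v) :
    KeyJoined x y u v := by
  rcases h with rfl | ⟨a, b, h, rfl, rfl⟩ | ⟨a, b, h, rfl, rfl⟩
  · exact .inl rfl
  · obtain ⟨p, q, hp, hq, h⟩ := h.exists_endAt
    refine .inr ⟨vertexL p, vertexL q, .inl ⟨_, _, hp, rfl, rfl⟩, .inl ⟨_, _, hq, rfl, rfl⟩, ?_⟩
    rcases h with rfl | h | h
    exacts [.refl _, joined_left h, (joined_left h).symm]
  · obtain ⟨p, q, hp, hq, h⟩ := h.exists_endAt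
    refine .inr ⟨vertexR p, vertexR q, .inr ⟨_, _, hp, rfl, rfl⟩, .inr ⟨_, _, hq, rfl, rfl⟩, ?_⟩
    rcases h with rfl | h | h
    exacts [.refl _, joined_right h, (joined_right h).symm]

/-- A middle node is one vertex but two points of the order, one on the perimeter of each rectangle.
-/
theorem keyJoined_middle (j : Fin m) :
    KeyJoined x y (leftKey (nodePos (Sum.inr j : Node n m)))
      (rightKey (nodePos (Sum.inl j : Node m k))) :=
  .inr ⟨vertexM j, vertexM j, .inl ⟨_, _, .node _, rfl, rfl⟩, .inr ⟨_, _, .node _, rfl, rfl⟩, .refl _⟩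

theorem leftKey_mem_keyEnds {a : ℕ ×ₗ ℤ} : leftKey a ∈ keyEnds x y ↔ ∃ b, x.IsString a b := by
  simp only [keyEnds, Set.mem_ofPred_eq, leftKey_inj, leftKey_ne_rightKey, and_false, exists_false,
    or_false]
  exact ⟨fun ⟨_, b, h, e⟩ => ⟨b, e ▸ h⟩, fun ⟨b, h⟩ => ⟨a, b, h, rfl⟩⟩

theorem rightKey_mem_keyEnds {a : ℕ ×ₗ ℤ} : rightKey a ∈ keyEnds x y ↔ ∃ b, y.IsString a b := by
  simp only [keyEnds, Set.mem_ofPred_eq, rightKey_inj, rightKey_ne_leftKey, and_false, exists_false,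
    false_or]
  exact ⟨fun ⟨_, b, h, e⟩ => ⟨b, e ▸ h⟩, fun ⟨b, h⟩ => ⟨a, b, h, rfl⟩⟩

/-- The middle nodes can be joined one after the other, from bottom to top. -/
theorem exists_isPairing_keyEndsBelow (hx : x.IsDiagram) (hy : y.IsDiagram)
    (hc : Compatible x y) (s t : ℕ) (hst : t + s = m) :
    ∃ r, IsPairing r (keyEndsBelow x y t) ∧ (∀ u v, KeyLinked x y u v → r u v) ∧
      (∀ j : Fin m, t ≤ j → x.Occupied (Sum.inr j) →
        r (leftKey (nodePos (Sum.inr j : Node n m))) (rightKey (nodePos (Sum.inl j : Node m k)))) ∧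
      ∀ u v, r u v → KeyJoined x y u v := by
  induction s generalizing t with
  | zero =>
    refine ⟨KeyLinked x y, ?_, fun _ _ h => h, fun j hj => by omega,
      fun _ _ => keyJoined_of_keyLinked⟩
    have : keyEndsBelow x y t = keyEnds x y := by
      refine sdiff_eq_left.2 (Set.disjoint_left.2 ?_)
      rintro u - ⟨j, hj, -⟩
      omega
    rw [this]
    exact isPairing_keyLinked hx hy
  | succ s ih =>
    obtain ⟨r, hr, hl, hj, hs⟩ := ih (t + 1) (by omega)
    set i : Fin m := ⟨t, by omega⟩ with hi
    set p := leftKey (nodePos (Sum.inr i : Node n m)) with hp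
    set q := rightKey (nodePos (Sum.inl i : Node m k)) with hq
    have hS : keyEndsBelow x y t = keyEndsBelow x y (t + 1) \ {p, q} := by
      ext u
      simp only [keyEndsBelow, Set.mem_sdiff, Set.mem_ofPred_eq, Set.mem_insert_iff,
        Set.mem_singleton_iff, not_exists, not_and, and_assoc]
      refine and_congr_right fun _ => ⟨fun h => ⟨fun j hj => h j (by omega), h i le_rfl⟩,
        fun ⟨h, h'⟩ j hj => ?_⟩
      rcases eq_or_lt_of_le hj with e | e
      · obtain rfl : j = i := Fin.ext e.symm
        exact h'
      · exact h j e
    by_cases ho : x.Occupied (Sum.inr i)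
    · have hpS : p ∈ keyEndsBelow x y (t + 1) := by
        refine ⟨leftKey_mem_keyEnds.2 ((Drawing.occupied_iff hx).1 ho), ?_⟩
        rintro ⟨j, hj, e⟩
        simp only [hp, leftKey_inj, nodePos_inj, leftKey_ne_rightKey, or_false, Sum.inr.injEq] at e
        subst e
        simp [hi] at hj
      have hqS : q ∈ keyEndsBelow x y (t + 1) := by
        refine ⟨rightKey_mem_keyEnds.2 ((Drawing.occupied_iff hy).1 ((hc i).1 ho)), ?_⟩
        rintro ⟨j, hj, e⟩
        simp only [hq, rightKey_inj, nodePos_inj, rightKey_ne_leftKey, false_or, Sum.inl.injEq] at e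
        subst e
        simp [hi] at hj
      have hpq : p < q := by simp [hp, hq, leftKey_lt_rightKey, nodePos]
      refine ⟨joinClasses r p q, ?_, fun u v h => .inl (hl u v h), fun j hj' ho' => ?_,
        fun u v h => joinClasses_le keyJoined_equivalence hs (keyJoined_middle i) h⟩
      · rw [hS]
        refine hr.join hpS hqS hpq ?_
        -- The right side of `x` is traversed downwards and the left side of `y` upwards, so the two
        -- copies of the middle nodes are nested like parentheses. A point between the copies of the
        -- node `i` would be a copy of a lower middle node, and these have been removed.
        rintro u ⟨⟨a, b, h, rfl⟩ | ⟨a, b, h, rfl⟩, hu⟩ ⟨h1, h2⟩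
        · rw [hp, leftKey_lt, lex_lt_iff] at h1
          rw [hq, leftKey_lt_rightKey] at h2
          obtain ⟨v, -, hv, -⟩ := h.exists_endAt
          cases hv with
          | node v =>
            rcases v with j | j
            · simp [nodePos] at h1
            · refine hu ⟨j, ?_, .inl rfl⟩
              simp [nodePos, hi] at h1
              omega
          | top _ => simp [nodePos, topPos] at h1
          | bot _ => simp [botPos] at h2
        · rw [hq, rightKey_lt, lex_lt_iff] at h2
          obtain ⟨v, -, hv, -⟩ := h.exists_endAt
          cases hv with
          | node v =>
            rcases v with j | j
            · refine hu ⟨j, ?_, .inr rfl⟩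
              simp [nodePos, hi] at h2
              omega
            · simp [nodePos] at h2
          | top _ => simp [nodePos, topPos] at h2
          | bot _ => simp [nodePos, botPos] at h2
      · rcases eq_or_lt_of_le hj' with e | e
        · obtain rfl : j = i := Fin.ext e.symm
          exact .inr (.inl ⟨hr.equivalence.refl _, hr.equivalence.refl _⟩)
        · exact .inl (hj j e ho')
    -- By compatibility the node is empty on both sides, so neither of its copies is a string end
    -- and there is nothing to join.
    · refine ⟨r, ?_, hl, fun j hj' ho' => ?_, hs⟩
      · rw [hS, sdiff_eq_left.2]
        · exact hr
        · refine Set.disjoint_right.2 ?_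
          rintro u (rfl | rfl) ⟨hu, -⟩
          · exact ho ((Drawing.occupied_iff hx).2 (leftKey_mem_keyEnds.1 hu))
          · exact ho ((hc i).2 ((Drawing.occupied_iff hy).2 (rightKey_mem_keyEnds.1 hu)))
      · rcases eq_or_lt_of_le hj' with e | e
        · obtain rfl : j = i := Fin.ext e.symm
          exact absurd ho' ho
        · exact hj j e ho'

end Planarity

end GhostAlg

/-! ### The ends of the concatenated picture as a noncrossing pairing -/

namespace GhostAlg

section Planarity

variable {n m k : ℕ} {x : Drawing n m} {y : Drawing m k}

/-- Where a position on the perimeter of the concatenated rectangle sits in the picture; `A` and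
`B` are the numbers of entries on the top and the bottom of the left rectangle. -/
def rawKey (A B : ℕ) (a : ℕ ×ₗ ℤ) : ℕ ×ₗ (ℕ ×ₗ ℤ) :=
  if (ofLex a).1 = 0 ∨ ((ofLex a).1 = 1 ∧ (ofLex a).2 < A) ∨ ((ofLex a).1 = 3 ∧ -(ofLex a).2 < B)
  then leftKey a
  else rightKey (toLex ((ofLex a).1,
    if (ofLex a).1 = 1 then (ofLex a).2 - A else if (ofLex a).1 = 3 then (ofLex a).2 + B
    else (ofLex a).2))

/-- Walking around the outer rectangle visits the remaining ends in the order of the keys. On the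
top the entries of `x` come first; the bottom is traversed from right to left, so there the entries
of `y` come first. -/
theorem rawKey_lt {A B : ℕ} {a b : ℕ ×ₗ ℤ} (ha : (ofLex a).1 ≤ 3) (hb : (ofLex b).1 ≤ 3)
    (h : a < b) : rawKey A B a < rawKey A B b := by
  rw [lex_lt_iff] at h
  unfold rawKey
  by_cases h1 : (ofLex a).1 = 0 ∨ ((ofLex a).1 = 1 ∧ (ofLex a).2 < A) ∨
      ((ofLex a).1 = 3 ∧ -(ofLex a).2 < B) <;>
    by_cases h2 : (ofLex b).1 = 0 ∨ ((ofLex b).1 = 1 ∧ (ofLex b).2 < A) ∨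
      ((ofLex b).1 = 3 ∧ -(ofLex b).2 < B)
  · rwa [if_pos h1, if_pos h2, leftKey_lt, lex_lt_iff]
  · rw [if_pos h1, if_neg h2, leftKey_lt_rightKey]
    omega
  · rw [if_neg h1, if_pos h2, rightKey_lt_leftKey]
    omega
  · rw [if_neg h1, if_neg h2, rightKey_lt, Prod.Lex.toLex_lt_toLex]
    split_ifs <;> omega

@[simp]
theorem rawKey_left {A B : ℕ} {i : Fin n} :
    rawKey A B (nodePos (Sum.inl i : Node n k)) = leftKey (nodePos (Sum.inl i : Node n m)) := by
  simp [rawKey, nodePos]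

@[simp]
theorem rawKey_right {A B : ℕ} {j : Fin k} :
    rawKey A B (nodePos (Sum.inr j : Node n k)) = rightKey (nodePos (Sum.inr j : Node m k)) := by
  simp [rawKey, nodePos]

theorem rawKey_top_left {A B i : ℕ} (h : i < A) : rawKey A B (topPos i) = leftKey (topPos i) := by
  simp [rawKey, topPos, h]

theorem rawKey_top_right {A B i : ℕ} : rawKey A B (topPos (A + i)) = rightKey (topPos i) := by
  simp [rawKey, topPos]

theorem rawKey_bot_left {A B i : ℕ} (h : i < B) : rawKey A B (botPos i) = leftKey (botPos i) := by
  simp [rawKey, botPos, h]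

theorem rawKey_bot_right {A B i : ℕ} : rawKey A B (botPos (B + i)) = rightKey (botPos i) := by
  simp [rawKey, botPos]

theorem getElem?_append_map {α β γ : Type*} {f : α → γ} {g : β → γ} {l : List (Option α)}
    {l' : List (Option β)} {i : ℕ} {c : γ} :
    (l.map (Option.map f) ++ l'.map (Option.map g))[i]? = some (some c) ↔
      (i < l.length ∧ ∃ a, l[i]? = some (some a) ∧ f a = c) ∨
      ∃ j, i = l.length + j ∧ ∃ b, l'[j]? = some (some b) ∧ g b = c := by
  rcases lt_or_ge i l.length with h | h
  · rw [List.getElem?_append_left (by simpa using h)]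
    simp only [List.getElem?_map, Option.map_eq_some_iff, h, true_and]
    constructor
    · rintro ⟨_, h, a, rfl, e⟩
      exact .inl ⟨a, h, e⟩
    · rintro (⟨a, h, e⟩ | ⟨j, e, -⟩)
      · exact ⟨_, h, a, rfl, e⟩
      · omega
  · obtain ⟨j, rfl⟩ := Nat.exists_eq_add_of_le h
    rw [List.getElem?_append_right (by simp)]
    simp only [List.length_map, Nat.add_sub_cancel_left, List.getElem?_map, Option.map_eq_some_iff]
    constructor
    · rintro ⟨_, h, a, rfl, e⟩
      exact .inr ⟨j, rfl, a, h, e⟩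
    · rintro (⟨h, -⟩ | ⟨i, e, b, h, e'⟩)
      · omega
      · obtain rfl : j = i := by omega
        exact ⟨_, h, b, rfl, e'⟩

theorem RawEnd.fst_le {a : ℕ ×ₗ ℤ} {v : Vertex n m k} (h : RawEnd x y a v) : (ofLex a).1 ≤ 3 := by
  cases h <;> simp [nodePos, topPos, botPos]

theorem RawEnd.keyAt {a : ℕ ×ₗ ℤ} {v : Vertex n m k} (h : RawEnd x y a v) :
    KeyAt x y (rawKey x.top.length x.bot.length a) v := by
  cases h with
  | left h =>
    rw [rawKey_left]
    exact .inl ⟨_, _, .node _, rfl, rfl⟩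
  | right h =>
    rw [rawKey_right]
    exact .inr ⟨_, _, .node _, rfl, rfl⟩
  | top h =>
    rcases getElem?_append_map.1 h with ⟨hi, p, h', rfl⟩ | ⟨j, rfl, p, h', rfl⟩
    · rw [rawKey_top_left hi]
      exact .inl ⟨_, _, .top h', rfl, rfl⟩
    · rw [rawKey_top_right]
      exact .inr ⟨_, _, .top h', rfl, rfl⟩
  | bot h =>
    rcases getElem?_append_map.1 h with ⟨hi, p, h', rfl⟩ | ⟨j, rfl, p, h', rfl⟩
    · rw [rawKey_bot_left hi]
      exact .inl ⟨_, _, .bot h', rfl, rfl⟩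
    · rw [rawKey_bot_right]
      exact .inr ⟨_, _, .bot h', rfl, rfl⟩

theorem leftKey_mem_keyEndsBelow_zero {a : ℕ ×ₗ ℤ} : leftKey a ∈ keyEndsBelow x y 0 ↔
    (∃ b, x.IsString a b) ∧ ∀ j : Fin m, a ≠ nodePos (Sum.inr j : Node n m) := by
  simp [keyEndsBelow, leftKey_mem_keyEnds]

theorem rightKey_mem_keyEndsBelow_zero {a : ℕ ×ₗ ℤ} : rightKey a ∈ keyEndsBelow x y 0 ↔
    (∃ b, y.IsString a b) ∧ ∀ j : Fin m, a ≠ nodePos (Sum.inl j : Node m k) := by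
  simp [keyEndsBelow, rightKey_mem_keyEnds]

theorem RawEnd.mem_keyEndsBelow (hx : x.IsDiagram) (hy : y.IsDiagram) {a : ℕ ×ₗ ℤ}
    {v : Vertex n m k} (h : RawEnd x y a v) :
    rawKey x.top.length x.bot.length a ∈ keyEndsBelow x y 0 := by
  cases h with
  | left h =>
    rw [rawKey_left, leftKey_mem_keyEndsBelow_zero, ← Drawing.occupied_iff hx]
    exact ⟨h, by simp⟩
  | right h =>
    rw [rawKey_right, rightKey_mem_keyEndsBelow_zero, ← Drawing.occupied_iff hy]
    exact ⟨h, by simp⟩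
  | top h =>
    rcases getElem?_append_map.1 h with ⟨hi, p, h', rfl⟩ | ⟨j, rfl, p, h', rfl⟩
    · rw [rawKey_top_left hi, leftKey_mem_keyEndsBelow_zero]
      exact ⟨⟨_, (Drawing.IsString.top h').symm⟩, by simp⟩
    · rw [rawKey_top_right, rightKey_mem_keyEndsBelow_zero]
      exact ⟨⟨_, (Drawing.IsString.top h').symm⟩, by simp⟩
  | bot h =>
    rcases getElem?_append_map.1 h with ⟨hi, p, h', rfl⟩ | ⟨j, rfl, p, h', rfl⟩
    · rw [rawKey_bot_left hi, leftKey_mem_keyEndsBelow_zero]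
      exact ⟨⟨_, (Drawing.IsString.bot h').symm⟩, by simp⟩
    · rw [rawKey_bot_right, rightKey_mem_keyEndsBelow_zero]
      exact ⟨⟨_, (Drawing.IsString.bot h').symm⟩, by simp⟩

theorem exists_rawEnd_of_mem_keyEndsBelow (hx : x.IsDiagram) (hy : y.IsDiagram)
    {u : ℕ ×ₗ (ℕ ×ₗ ℤ)} (h : u ∈ keyEndsBelow x y 0) :
    ∃ a v, RawEnd x y a v ∧ rawKey x.top.length x.bot.length a = u := by
  rcases h.1 with ⟨a, b, hs, rfl⟩ | ⟨a, b, hs, rfl⟩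
  · obtain ⟨p, -, ha, -⟩ := hs.exists_endAt
    have hm := (leftKey_mem_keyEndsBelow_zero.1 h).2
    cases ha with
    | node p =>
      rcases p with i | j
      · exact ⟨_, _, .left ((Drawing.occupied_iff hx).2 ⟨_, hs⟩), rawKey_left⟩
      · exact absurd rfl (hm j)
    | @top p i ha =>
      exact ⟨_, _, .top (getElem?_append_map.2 (.inl ⟨(List.getElem?_eq_some_iff.1 ha).1, p, ha, rfl⟩)),
        rawKey_top_left (List.getElem?_eq_some_iff.1 ha).1⟩
    | @bot p i ha =>
      exact ⟨_, _, .bot (getElem?_append_map.2 (.inl ⟨(List.getElem?_eq_some_iff.1 ha).1, p, ha, rfl⟩)),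
        rawKey_bot_left (List.getElem?_eq_some_iff.1 ha).1⟩
  · obtain ⟨p, -, ha, -⟩ := hs.exists_endAt
    have hm := (rightKey_mem_keyEndsBelow_zero.1 h).2
    cases ha with
    | node p =>
      rcases p with i | j
      · exact absurd rfl (hm i)
      · exact ⟨_, _, .right ((Drawing.occupied_iff hy).2 ⟨_, hs⟩), rawKey_right⟩
    | @top p i ha =>
      exact ⟨_, _, .top (getElem?_append_map.2 (.inr ⟨i, rfl, p, ha, rfl⟩)), rawKey_top_right⟩
    | @bot p i ha =>
      exact ⟨_, _, .bot (getElem?_append_map.2 (.inr ⟨i, rfl, p, ha, rfl⟩)), rawKey_bot_right⟩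

/-- A point of the picture that belongs to the class of a node. -/
def vertexKey : Vertex n m k → ℕ ×ₗ (ℕ ×ₗ ℤ)
  | Sum.inl i => leftKey (nodePos (Sum.inl i : Node n m))
  | Sum.inr (Sum.inl j) => leftKey (nodePos (Sum.inr j : Node n m))
  | Sum.inr (Sum.inr l) => rightKey (nodePos (Sum.inr l : Node m k))

/-- The connected components of the concatenated picture define a noncrossing pairing of its
remaining ends. -/
theorem exists_isPairing_joined (hx : x.IsDiagram) (hy : y.IsDiagram) (hc : Compatible x y) :
    ∃ r, IsPairing r (keyEndsBelow x y 0) ∧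
      ∀ u ∈ keyEndsBelow x y 0, ∀ v ∈ keyEndsBelow x y 0, ∀ s t, KeyAt x y u s → KeyAt x y v t →
        (r u v ↔ Joined x y s t) := by
  obtain ⟨r, hr, hl, hm, hj⟩ := exists_isPairing_keyEndsBelow hx hy hc m 0 (by omega)
  have trans := @hr.equivalence.trans
  have symm := @hr.equivalence.symm
  have hL : ∀ p : Node n m, vertexKey (vertexL p : Vertex n m k) = leftKey (nodePos p) := by
    rintro (i | i) <;> rfl
  -- The point chosen for a middle node is its copy on the side of `x`; the copy on the side of `y`
  -- is related to it only if the node is occupied.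
  have hR : ∀ p : Node m k, y.Occupied p →
      r (rightKey (nodePos p)) (vertexKey (vertexR p : Vertex n m k)) := by
    rintro (i | i) h
    · exact symm (hm i (Nat.zero_le _) ((hc i).2 h))
    · exact hr.equivalence.refl _
  -- The relation `r` contains all strings and identifies the two copies of each occupied middle
  -- node, hence it contains the generators of `Joined`.
  have hJ : ∀ s t, Joined x y s t → r (vertexKey s) (vertexKey t) := by
    intro s t h
    induction h with
    | rel s t h =>
      rcases h with ⟨p, q, h, rfl, rfl⟩ | ⟨p, q, h, rfl, rfl⟩
      · rw [hL, hL]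
        exact hl _ _ (.inr (.inl ⟨_, _, .node h, rfl, rfl⟩))
      · have h' := hy.partner_symm _ _ h
        refine trans (symm (hR p (.inl (by simp [h])))) (trans ?_ (hR q (.inl (by simp [h']))))
        exact hl _ _ (.inr (.inr ⟨_, _, .node h, rfl, rfl⟩))
    | refl s => exact hr.equivalence.refl _
    | symm _ _ _ ih => exact symm ih
    | trans _ _ _ _ _ ih ih' => exact trans ih ih'
  have hA : ∀ u ∈ keyEndsBelow x y 0, ∀ s, KeyAt x y u s → r u (vertexKey s) := by
    rintro _ hu _ (⟨a, p, ha, rfl, rfl⟩ | ⟨a, p, ha, rfl, rfl⟩)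
    · rw [hL]
      cases ha with
      | node => exact hr.equivalence.refl _
      | top h => exact hl _ _ (.inr (.inl ⟨_, _, (Drawing.IsString.top h).symm, rfl, rfl⟩))
      | bot h => exact hl _ _ (.inr (.inl ⟨_, _, (Drawing.IsString.bot h).symm, rfl, rfl⟩))
    · have key : ∀ {a}, y.IsString a (nodePos p) → r (rightKey a) (vertexKey (vertexR p)) :=
        fun h => trans (hl _ _ (.inr (.inr ⟨_, _, h, rfl, rfl⟩)))
          (hR p ((Drawing.occupied_iff hy).2 ⟨_, h.symm⟩))
      cases ha with
      | node =>
        rw [rightKey_mem_keyEndsBelow_zero] at hu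
        exact hR p ((Drawing.occupied_iff hy).2 hu.1)
      | top h => exact key (Drawing.IsString.top h).symm
      | bot h => exact key (Drawing.IsString.bot h).symm
  refine ⟨r, hr, fun u hu v hv s t hs ht => ⟨fun h => ?_, fun h => ?_⟩⟩
  · rcases hj u v h with rfl | ⟨s', t', hs', ht', h⟩
    · rw [hs.unique ht]
      exact .refl _
    · rwa [hs.unique hs', ht.unique ht']
  · exact trans (hA u hu s hs) (trans (hJ s t h) (symm (hA v hv t ht)))

variable {a b c d : ℕ ×ₗ ℤ} {v w u t : Vertex n m k}

/-- A string entering the picture cannot stop in the middle: the component of an end has a second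
end, by the pairing of the keys. -/
theorem RawEnd.exists_ne (hx : x.IsDiagram) (hy : y.IsDiagram) (hc : Compatible x y)
    (h : RawEnd x y a v) : ∃ b w, RawEnd x y b w ∧ b ≠ a ∧ Joined x y v w := by
  obtain ⟨r, hr, hj⟩ := exists_isPairing_joined hx hy hc
  obtain ⟨s, hs, hne, has⟩ := hr.exists_ne _ (h.mem_keyEndsBelow hx hy)
  obtain ⟨b, w, hb, rfl⟩ := exists_rawEnd_of_mem_keyEndsBelow hx hy hs
  exact ⟨b, w, hb, fun e => hne (by rw [e]),
    (hj _ (h.mem_keyEndsBelow hx hy) _ hs _ _ h.keyAt hb.keyAt).1 has⟩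

theorem rawKey_injOn {A B : ℕ} (ha : (ofLex a).1 ≤ 3) (hb : (ofLex b).1 ≤ 3)
    (h : rawKey A B a = rawKey A B b) : a = b := by
  rcases lt_trichotomy a b with h' | h' | h'
  · exact absurd h (rawKey_lt ha hb h').ne
  · exact h'
  · exact absurd h (rawKey_lt hb ha h').ne'

/-- At most two ends lie on a connected component of the picture. -/
theorem RawEnd.eq_or_eq (hx : x.IsDiagram) (hy : y.IsDiagram) (hc : Compatible x y)
    (ha : RawEnd x y a v) (hb : RawEnd x y b w) (hd : RawEnd x y c u) (hab : Joined x y v w)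
    (had : Joined x y v u) : a = b ∨ a = c ∨ b = c := by
  obtain ⟨r, hr, hj⟩ := exists_isPairing_joined hx hy hc
  have ma := ha.mem_keyEndsBelow hx hy
  have mb := hb.mem_keyEndsBelow hx hy
  have md := hd.mem_keyEndsBelow hx hy
  have := hr.eq_or_eq _ ma _ mb _ md ((hj _ ma _ mb _ _ ha.keyAt hb.keyAt).2 hab)
    ((hj _ ma _ md _ _ ha.keyAt hd.keyAt).2 had)
  exact this.imp (rawKey_injOn ha.fst_le hb.fst_le)
    (Or.imp (rawKey_injOn ha.fst_le hd.fst_le) (rawKey_injOn hb.fst_le hd.fst_le))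

theorem RawEnd.noncrossing (hx : x.IsDiagram) (hy : y.IsDiagram) (hc : Compatible x y)
    (ha : RawEnd x y a v) (hb : RawEnd x y b w) (hc' : RawEnd x y c u) (hd : RawEnd x y d t)
    (hab : Joined x y v w) (hcd : Joined x y u t) : ¬ (a < c ∧ c < b ∧ b < d) := by
  rintro ⟨h1, h2, h3⟩
  obtain ⟨r, hr, hj⟩ := exists_isPairing_joined hx hy hc
  have ma := ha.mem_keyEndsBelow hx hy
  have mb := hb.mem_keyEndsBelow hx hy
  have mc := hc'.mem_keyEndsBelow hx hy
  have md := hd.mem_keyEndsBelow hx hy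
  have k1 := rawKey_lt (A := x.top.length) (B := x.bot.length) ha.fst_le hc'.fst_le h1
  have k2 := rawKey_lt (A := x.top.length) (B := x.bot.length) hc'.fst_le hb.fst_le h2
  have k3 := rawKey_lt (A := x.top.length) (B := x.bot.length) hb.fst_le hd.fst_le h3
  have := hr.noncrossing _ ma _ mb _ mc _ md ((hj _ ma _ mb _ _ ha.keyAt hb.keyAt).2 hab)
    ((hj _ mc _ md _ _ hc'.keyAt hd.keyAt).2 hcd) k1.ne' k2.ne (k1.trans (k2.trans k3)).ne' k3.ne'
  simp [k1, k2.not_gt, k3, k1.trans (k2.trans k3)] at this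

end Planarity

end GhostAlg

namespace GhostAlg

/-! ## Pictures -/

/-- A picture in a rectangle from which closed loops and boundary arcs have not been removed.  The
strings are attached to vertices; vertices on the same string are related.  A component all of whose
vertices are `Closed` is a loop. -/
structure Picture (n k : ℕ) (V : Type) where
  rel : Setoid V
  out : Node n k → V
  top : List (Option V)
  bot : List (Option V)
  Closed : V → Prop

/-- Pairs of indices of string ends on two boundaries that are connected, in the relative position
`T` and with numbers that have the properties `P` and `Q`. -/
def arcs {V : Type} (r : V → V → Prop) (T : ℕ → ℕ → Prop) (W W' : List (Option V))
    (P Q : ℕ → Prop) : Set (ℕ × ℕ) :=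
  {e | T e.1 e.2 ∧ (∃ u v, W[e.1]? = some (some u) ∧ W'[e.2]? = some (some v) ∧ r u v) ∧
    P (e.1 + 1) ∧ Q (e.2 + 1)}

theorem finite_arcs {V : Type} (r : V → V → Prop) (T : ℕ → ℕ → Prop) (W W' : List (Option V))
    (P Q : ℕ → Prop) : (arcs r T W W' P Q).Finite := by
  refine Set.Finite.subset ((Set.finite_Iio W.length).prod (Set.finite_Iio W'.length)) ?_
  rintro ⟨i, j⟩ ⟨-, ⟨u, v, hu, hv, -⟩, -⟩
  exact ⟨(List.getElem?_eq_some_iff.1 hu).1, (List.getElem?_eq_some_iff.1 hv).1⟩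

namespace Picture

variable {n k : ℕ} {V : Type} (c : Picture n k V)

open Classical in
/-- What a boundary entry becomes when the boundary arcs are removed. -/
noncomputable def remaining : Option V → Option (Node n k)
  | none => none
  | some v => if h : ∃ p : Node n k, c.rel v (c.out p) then some h.choose else none

open Classical in
/-- The drawing that is left when loops and boundary arcs have been removed. -/
noncomputable def drawing : Drawing n k where
  partner p :=
    if h : ∃ q : Node n k, q ≠ p ∧ c.rel (c.out p) (c.out q) then some h.choose else none
  top := cancelGhosts (c.top.map c.remaining)
  bot := cancelGhosts (c.bot.map c.remaining)

/-- The loops of a picture, as sets of vertices. -/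
def loops : Set (Set V) := {C | ∃ v, C = {w | c.rel v w} ∧ ∀ w ∈ C, c.Closed w}

/-- The number of arcs with both ends on the top boundary. -/
noncomputable def topCount (P Q : ℕ → Prop) : ℕ := (arcs c.rel (· < ·) c.top c.top P Q).ncard

/-- The number of arcs with both ends on the bottom boundary. -/
noncomputable def botCount (P Q : ℕ → Prop) : ℕ := (arcs c.rel (· < ·) c.bot c.bot P Q).ncard

/-- The number of arcs from the top to the bottom boundary. -/
noncomputable def crossCount (P Q : ℕ → Prop) : ℕ :=
  (arcs c.rel (fun _ _ => True) c.top c.bot P Q).ncard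

/-- The product of the parameters of all loops and boundary arcs. -/
noncomputable def weight {R : Type*} [CommRing R] (P : Params R) : R :=
  P.β ^ c.loops.ncard *
  (P.α₁ ^ c.topCount Odd Even * P.α₂ ^ c.topCount Even Odd *
    P.α₃ ^ (c.topCount Odd Odd + c.topCount Even Even)) *
  (P.δ₁ ^ c.botCount Odd Even * P.δ₂ ^ c.botCount Even Odd *
    P.δ₃ ^ (c.botCount Odd Odd + c.botCount Even Even)) *
  (P.γ₁₂ ^ (c.crossCount Odd Even + c.crossCount Even Odd) *
    P.γ₃ ^ (c.crossCount Odd Odd + c.crossCount Even Even))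

/-- The picture of two drawings side by side. -/
def pair {n m k : ℕ} (x : Drawing n m) (y : Drawing m k) : Picture n k (Vertex n m k) where
  rel := Relation.EqvGen.setoid (Linked x y)
  out := vertexOuter
  top := concatTop x y
  bot := concatBot x y
  Closed v := ∃ j, v = vertexM j ∧ x.partner (Sum.inr j) ≠ none ∧ y.partner (Sum.inl j) ≠ none

theorem drawing_pair {n m k : ℕ} (x : Drawing n m) (y : Drawing m k) :
    (pair x y).drawing = concat x y := by
  have : (pair x y).remaining = GhostAlg.remaining x y := by
    funext v
    cases v <;> rfl
  simp only [drawing, this]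
  rfl

theorem weight_pair {R : Type*} [CommRing R] (P : Params R) {n m k : ℕ} (x : Drawing n m)
    (y : Drawing m k) : (pair x y).weight P = GhostAlg.weight P x y := by
  -- One side counts classes in a quotient, the other one sets of vertices; a class corresponds to
  -- its fibre.
  have h1 : (pair x y).loops.ncard = loopCount x y := by
    have e : ∀ v w, (Quotient.mk (Relation.EqvGen.setoid (Linked x y)) w = Quotient.mk _ v) ↔
        (pair x y).rel v w := fun v w => Quotient.eq.trans
          ⟨Setoid.symm' (Relation.EqvGen.setoid (Linked x y)),
            Setoid.symm' (Relation.EqvGen.setoid (Linked x y))⟩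
    have hmem : ∀ c : Quotient (Relation.EqvGen.setoid (Linked x y)),
        (∀ v, Quotient.mk _ v = c → (pair x y).Closed v) ↔
          {v | Quotient.mk _ v = c} ∈ (pair x y).loops := by
      intro c
      refine ⟨fun h => ?_, fun ⟨_, _, h⟩ => h⟩
      induction c using Quotient.inductionOn with | _ v =>
      exact ⟨v, Set.ext (e v), h⟩
    rw [← Nat.card_coe_set_eq]
    refine (Nat.card_congr (Equiv.ofBijective
      (fun c => ⟨{v | Quotient.mk _ v = c.1}, (hmem c.1).1 c.2⟩) ⟨?_, ?_⟩)).symm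
    · rintro ⟨c, hc⟩ ⟨d, hd⟩ h
      induction c using Quotient.inductionOn with | _ v =>
      have h' := congrArg Subtype.val h
      exact Subtype.ext ((Set.ext_iff.1 h' v).1 rfl)
    · rintro ⟨C, v, rfl, h⟩
      exact ⟨⟨Quotient.mk _ v, fun w hw => h w ((e v w).1 hw)⟩, Subtype.ext (Set.ext (e v))⟩
  have h2 : ∀ P Q, (pair x y).topCount P Q = topArcCount x y P Q := fun P Q => rfl
  have h3 : ∀ P Q, (pair x y).botCount P Q = botArcCount x y P Q := fun P Q => rfl
  have h4 : ∀ P Q, (pair x y).crossCount P Q = crossArcCount x y P Q := fun P Q => by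
    rw [crossCount, ← Nat.card_coe_set_eq]
    exact Nat.card_congr (Equiv.subtypeEquivRight fun e => ⟨fun h => h.2, fun h => ⟨trivial, h⟩⟩)
  simp only [weight, GhostAlg.weight, h1, h2, h3, h4]

end Picture

end GhostAlg

namespace GhostAlg

/-! ## Pictures in which a part is simplified first -/

/-- The picture `c` contains `c₀` as a part, and `c'` arises from `c` when `c₀` is replaced by its
drawing. -/
structure Contraction {a b n l : ℕ} {V₀ V' V : Type} (c₀ : Picture a b V₀) (c' : Picture n l V')
    (c : Picture n l V) where
  /-- The vertices of the part. -/
  ι : V₀ → V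
  /-- The vertices that remain. -/
  e : V' → V
  /-- The outer nodes of the part. -/
  o : Node a b → V'
  /-- The connections outside of the part. -/
  link : V' → V' → Prop
  topPre : List (Option V')
  topSuf : List (Option V')
  botPre : List (Option V')
  botSuf : List (Option V')
  /-- The part has a string to another node at an outer node. -/
  inner : Node a b → Prop
  /-- The rest of the picture has a string to another node at an outer node of the part. -/
  outer : Node a b → Prop
  ι_injective : Function.Injective ι
  e_injective : Function.Injective e
  ι_out : ∀ p, ι (c₀.out p) = e (o p)
  eq_out : ∀ v u, ι v = e u → ∃ p, v = c₀.out p ∧ u = o p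
  cover : ∀ w, (∃ v, w = ι v) ∨ ∃ u, w = e u
  e_out : ∀ p, c.out p = e (c'.out p)
  rel_ι : ∀ v w, c₀.rel v w → c.rel (ι v) (ι w)
  rel_e : ∀ u v, c'.rel u v → c.rel (e u) (e v)
  rel_le : ∀ s : V → V → Prop, Equivalence s → (∀ v w, c₀.rel v w → s (ι v) (ι w)) →
    (∀ u v, link u v → s (e u) (e v)) → ∀ v w, c.rel v w → s v w
  rel_link : ∀ u v, link u v → c'.rel u v
  rel_out : ∀ p q, c₀.rel (c₀.out p) (c₀.out q) → c'.rel (o p) (o q)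
  top_eq : c.top = topPre.map (Option.map e) ++ c₀.top.map (Option.map ι) ++
    topSuf.map (Option.map e)
  bot_eq : c.bot = botPre.map (Option.map e) ++ c₀.bot.map (Option.map ι) ++
    botSuf.map (Option.map e)
  top_eq' : c'.top = topPre ++ c₀.drawing.top.map (Option.map o) ++ topSuf
  bot_eq' : c'.bot = botPre ++ c₀.drawing.bot.map (Option.map o) ++ botSuf
  even_topPre : Even topPre.length
  even_botPre : Even botPre.length
  closed_ι : ∀ v, (∀ p, v ≠ c₀.out p) → (c.Closed (ι v) ↔ c₀.Closed v)
  closed_e : ∀ u, (∀ p, u ≠ o p) → (c.Closed (e u) ↔ c'.Closed u)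
  closed_o : ∀ p, c.Closed (e (o p)) ↔ inner p ∧ outer p
  closed_o' : ∀ p, c'.Closed (o p) ↔ c₀.drawing.partner p ≠ none ∧ outer p
  not_closed_out : ∀ p, ¬ c₀.Closed (c₀.out p)
  partner_ne_none : ∀ p, c₀.drawing.partner p ≠ none ↔
    ∀ v, c₀.rel (c₀.out p) v → c₀.Closed v ∨ ∃ q, v = c₀.out q ∧ inner q
  arc_top : ∀ (i j : ℕ) v v', i < j → c₀.top[i]? = some (some v) → c₀.top[j]? = some (some v') →
    c₀.rel v v' → ∀ p, ¬ c₀.rel v (c₀.out p)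
  arc_bot : ∀ (i j : ℕ) v v', i < j → c₀.bot[i]? = some (some v) → c₀.bot[j]? = some (some v') →
    c₀.rel v v' → ∀ p, ¬ c₀.rel v (c₀.out p)
  arc_cross : ∀ (i j : ℕ) v v', c₀.top[i]? = some (some v) → c₀.bot[j]? = some (some v') →
    c₀.rel v v' → ∀ p, ¬ c₀.rel v (c₀.out p)

namespace Contraction

variable {a b n l : ℕ} {V₀ V' V : Type} {c₀ : Picture a b V₀} {c' : Picture n l V'}
  {c : Picture n l V} (h : Contraction c₀ c' c)

/-- The vertex `w` is represented by the remaining vertex `u`. -/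
def Rep (w : V) (u : V') : Prop := w = h.e u ∨ ∃ v p, w = h.ι v ∧ u = h.o p ∧ c₀.rel v (c₀.out p)

theorem rep_e (u : V') : h.Rep (h.e u) u := .inl rfl

variable {h}

theorem rep_ι {v : V₀} {u : V'} (hr : h.Rep (h.ι v) u) :
    ∃ p, u = h.o p ∧ c₀.rel v (c₀.out p) := by
  rcases hr with hr | ⟨v', p, hr, rfl, hv⟩
  · obtain ⟨p, rfl, rfl⟩ := h.eq_out _ _ hr
    exact ⟨p, rfl, c₀.rel.refl' _⟩
  · rw [h.ι_injective hr]
    exact ⟨p, rfl, hv⟩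

/-- Two outer nodes of the part may lie on the same string of the part, and then both represent its
vertices. The representative is therefore unique only up to `c'.rel`. -/
theorem Rep.unique {w : V} {u u' : V'} (hr : h.Rep w u) (hr' : h.Rep w u') : c'.rel u u' := by
  rcases h.cover w with ⟨v, rfl⟩ | ⟨u₀, rfl⟩
  · obtain ⟨p, rfl, hp⟩ := rep_ι hr
    obtain ⟨q, rfl, hq⟩ := rep_ι hr'
    exact h.rel_out p q (c₀.rel.trans' (c₀.rel.symm' hp) hq)
  · have key : ∀ u, h.Rep (h.e u₀) u → c'.rel u₀ u := by
      rintro u (hr | ⟨v, p, hr, rfl, hv⟩)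
      · rw [h.e_injective hr]
      · obtain ⟨q, rfl, rfl⟩ := h.eq_out _ _ hr.symm
        exact h.rel_out _ _ hv
    exact c'.rel.trans' (c'.rel.symm' (key u hr)) (key u' hr')

theorem Rep.rel {w : V} {u : V'} (hr : h.Rep w u) : c.rel w (h.e u) := by
  rcases hr with rfl | ⟨v, p, rfl, rfl, hv⟩
  · exact c.rel.refl' _
  · rw [← h.ι_out]
    exact h.rel_ι _ _ hv

theorem rep_of_rel {v v' : V₀} {u : V'} (hv : c₀.rel v v') (hr : h.Rep (h.ι v') u) :
    h.Rep (h.ι v) u := by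
  obtain ⟨p, rfl, hp⟩ := rep_ι hr
  exact .inr ⟨v, p, rfl, rfl, c₀.rel.trans' hv hp⟩

/-- By the minimality `rel_le` it is enough that the alternative on the right is an equivalence
relation containing the connections inside and outside the part. A connection stays inside the part
or can be followed between representatives in `c'`. -/
theorem rel_cases {w w' : V} (hw : c.rel w w') :
    (∃ v v', w = h.ι v ∧ w' = h.ι v' ∧ c₀.rel v v') ∨
      ∃ u u', h.Rep w u ∧ h.Rep w' u' ∧ c'.rel u u' := by
  refine h.rel_le (fun w w' => (∃ v v', w = h.ι v ∧ w' = h.ι v' ∧ c₀.rel v v') ∨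
      ∃ u u', h.Rep w u ∧ h.Rep w' u' ∧ c'.rel u u') ⟨fun w => ?_, ?_, ?_⟩ ?_ ?_ w w' hw
  · rcases h.cover w with ⟨v, rfl⟩ | ⟨u, rfl⟩
    · exact .inl ⟨v, v, rfl, rfl, c₀.rel.refl' _⟩
    · exact .inr ⟨u, u, h.rep_e u, h.rep_e u, c'.rel.refl' _⟩
  · rintro w w' (⟨v, v', h1, h2, h3⟩ | ⟨u, u', h1, h2, h3⟩)
    · exact .inl ⟨v', v, h2, h1, c₀.rel.symm' h3⟩
    · exact .inr ⟨u', u, h2, h1, c'.rel.symm' h3⟩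
  · rintro w w' w'' (⟨v, v', rfl, rfl, h3⟩ | ⟨u, u', h1, h2, h3⟩)
      (⟨t, t', k1, k2, k3⟩ | ⟨t, t', k1, k2, k3⟩)
    · rw [← h.ι_injective k1] at k3
      exact .inl ⟨v, t', rfl, k2, c₀.rel.trans' h3 k3⟩
    · exact .inr ⟨t, t', rep_of_rel h3 k1, k2, k3⟩
    · subst k1 k2
      exact .inr ⟨u, u', h1, rep_of_rel (c₀.rel.symm' k3) h2, h3⟩
    · exact .inr ⟨u, t', h1, k2, c'.rel.trans' h3 (c'.rel.trans' (h2.unique k1) k3)⟩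
  · intro v w hvw
    exact .inl ⟨v, w, rfl, rfl, hvw⟩
  · intro u v huv
    exact .inr ⟨u, v, h.rep_e u, h.rep_e v, h.rel_link _ _ huv⟩

theorem rel_iff_of_rep {w w' : V} {u u' : V'} (hr : h.Rep w u) (hr' : h.Rep w' u') :
    c.rel w w' ↔ c'.rel u u' := by
  refine ⟨fun hw => ?_, fun hu => ?_⟩
  · rcases rel_cases (h := h) hw with ⟨v, v', rfl, rfl, hv⟩ | ⟨t, t', ht, ht', htt⟩
    · exact hr.unique (rep_of_rel hv hr')
    · exact c'.rel.trans' (hr.unique ht) (c'.rel.trans' htt (ht'.unique hr'))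
  · exact c.rel.trans' hr.rel (c.rel.trans' (h.rel_e _ _ hu) (c.rel.symm' hr'.rel))

theorem exists_rep_of_rel {w w' : V} {u : V'} (hw : c.rel w w') (hr : h.Rep w u) :
    ∃ u', h.Rep w' u' ∧ c'.rel u u' := by
  rcases rel_cases (h := h) hw with ⟨v, v', rfl, rfl, hv⟩ | ⟨t, t', ht, ht', htt⟩
  · exact ⟨u, rep_of_rel (c₀.rel.symm' hv) hr, c'.rel.refl' _⟩
  · exact ⟨t', ht', c'.rel.trans' (hr.unique ht) htt⟩

/-- A component of the part that meets no outer node has no way out of the part. -/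
theorem exists_of_rel_ι {v : V₀} {w : V} (hw : c.rel (h.ι v) w)
    (hv : ∀ p, ¬ c₀.rel v (c₀.out p)) : ∃ v', w = h.ι v' ∧ c₀.rel v v' := by
  rcases rel_cases (h := h) hw with ⟨t, v', ht, rfl, htv⟩ | ⟨t, t', ht, -⟩
  · rw [h.ι_injective ht]
    exact ⟨v', rfl, htv⟩
  · obtain ⟨p, -, hp⟩ := rep_ι ht
    exact absurd hp (hv p)

end Contraction

namespace Picture

variable {n k : ℕ} {V : Type} {c : Picture n k V} {v : V}

theorem rel_of_remaining {p : Node n k} (h : c.remaining (some v) = some p) :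
    c.rel v (c.out p) := by
  rw [remaining] at h
  split_ifs at h with h'
  obtain rfl := Option.some.inj h
  exact h'.choose_spec

theorem remaining_eq_none : c.remaining (some v) = none ↔ ∀ p, ¬ c.rel v (c.out p) := by
  rw [remaining]
  split_ifs with h'
  · exact iff_of_false (by simp) fun hn => hn _ h'.choose_spec
  · exact iff_of_true rfl (not_exists.1 h')

/-- The chosen element depends on nothing but the predicate. Equivalent predicates give the same
choice, so no uniqueness is needed. -/
theorem dite_choose_congr {α : Type*} {p q : α → Prop} {_ : Decidable (∃ a, p a)}
    {_ : Decidable (∃ a, q a)} (h : ∀ a, p a ↔ q a) :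
    (if h : ∃ a, p a then some h.choose else none) =
      if h : ∃ a, q a then some h.choose else none := by
  obtain rfl : p = q := funext fun a => propext (h a)
  split_ifs <;> rfl

theorem remaining_congr {n k : ℕ} {V V' : Type} {c : Picture n k V} {c' : Picture n k V'} {v : V}
    {v' : V'} (h : ∀ p, c.rel v (c.out p) ↔ c'.rel v' (c'.out p)) :
    c.remaining (some v) = c'.remaining (some v') := by
  rw [remaining, remaining]
  exact dite_choose_congr h

end Picture

theorem getElem?_append_append {α : Type*} {l₁ l₂ l₃ : List α} {i : ℕ} {a : α} :
    (l₁ ++ l₂ ++ l₃)[i]? = some a ↔ l₁[i]? = some a ∨ (∃ j, i = l₁.length + j ∧ l₂[j]? = some a) ∨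
      ∃ j, i = l₁.length + l₂.length + j ∧ l₃[j]? = some a := by
  have key : ∀ {l l' : List α} {i : ℕ}, (l ++ l')[i]? = some a ↔
      l[i]? = some a ∨ ∃ j, i = l.length + j ∧ l'[j]? = some a := by
    intro l l' i
    rcases lt_or_ge i l.length with h | h
    · rw [List.getElem?_append_left h]
      exact ⟨.inl, fun h' => h'.elim id fun ⟨j, e, _⟩ => by omega⟩
    · rw [List.getElem?_append_right h]
      constructor
      · intro h'
        exact .inr ⟨_, by omega, h'⟩
      · rintro (h' | ⟨j, rfl, h'⟩)
        · have := (List.getElem?_eq_some_iff.1 h').1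
          omega
        · rwa [Nat.add_sub_cancel_left]
  rw [key, key, List.length_append, or_assoc]

/-! ### Boundary entries, boundary arcs and the resulting drawing under contraction -/

namespace Contraction

variable {a b n l : ℕ} {V₀ V' V : Type} {c₀ : Picture a b V₀} {c' : Picture n l V'}
  {c : Picture n l V} (h : Contraction c₀ c' c)

/-- All entries of a boundary. -/
def fullList (pre suf : List (Option V')) (W₀ : List (Option V₀)) : List (Option V) :=
  pre.map (Option.map h.e) ++ W₀.map (Option.map h.ι) ++ suf.map (Option.map h.e)

/-- The entries of a boundary when the arcs of the part have been removed but ghosts have not been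
cancelled. -/
noncomputable def midList (pre suf : List (Option V')) (W₀ : List (Option V₀)) :
    List (Option V') :=
  pre ++ (W₀.map c₀.remaining).map (Option.map h.o) ++ suf

/-- The entries of a boundary when the part has been replaced by its drawing. -/
noncomputable def redList (pre suf : List (Option V')) (W₀ : List (Option V₀)) :
    List (Option V') :=
  pre ++ (cancelGhosts (W₀.map c₀.remaining)).map (Option.map h.o) ++ suf

variable (pre suf : List (Option V')) (W₀ : List (Option V₀))

theorem cancels_midList_redList : Cancels (h.midList pre suf W₀) (h.redList pre suf W₀) :=
  (((cancels_cancelGhosts _).map (Option.map h.o) rfl).append_left pre).append_right suf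

variable {h pre suf W₀} {i : ℕ}

theorem exists_of_midList {u : V'} (hu : (h.midList pre suf W₀)[i]? = some (some u)) :
    ∃ w, (h.fullList pre suf W₀)[i]? = some (some w) ∧ h.Rep w u := by
  rw [midList, getElem?_append_append] at hu
  simp only [fullList, getElem?_append_append, List.length_map, List.getElem?_map,
    Option.map_eq_some_iff] at hu ⊢
  rcases hu with hu | ⟨j, rfl, _, ⟨v, hv, rfl⟩, p, hp, rfl⟩ | ⟨j, rfl, hj⟩
  · exact ⟨_, .inl ⟨_, hu, u, rfl, rfl⟩, h.rep_e u⟩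
  · cases v with
    | none => simp [Picture.remaining] at hp
    | some v =>
      exact ⟨_, .inr (.inl ⟨j, rfl, _, hv, v, rfl, rfl⟩),
        .inr ⟨v, p, rfl, rfl, Picture.rel_of_remaining hp⟩⟩
  · exact ⟨_, .inr (.inr ⟨j, rfl, _, hj, u, rfl, rfl⟩), h.rep_e u⟩

theorem midList_of_fullList {w : V} (hw : (h.fullList pre suf W₀)[i]? = some (some w)) :
    (∃ u, (h.midList pre suf W₀)[i]? = some (some u) ∧ h.Rep w u) ∨
      ∃ v j, i = pre.length + j ∧ W₀[j]? = some (some v) ∧ w = h.ι v ∧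
        ∀ p, ¬ c₀.rel v (c₀.out p) := by
  simp only [midList, fullList, getElem?_append_append, List.length_map, List.getElem?_map,
    Option.map_eq_some_iff] at hw ⊢
  rcases hw with ⟨_, hu, u, rfl, rfl⟩ | ⟨j, rfl, _, hv, v, rfl, rfl⟩ | ⟨j, rfl, _, hj, u, rfl, rfl⟩
  · exact .inl ⟨u, .inl hu, h.rep_e u⟩
  · cases hp : c₀.remaining (some v) with
    | none => exact .inr ⟨v, j, rfl, hv, rfl, Picture.remaining_eq_none.1 hp⟩
    | some p =>
      exact .inl ⟨h.o p, .inr (.inl ⟨j, rfl, _, ⟨_, hv, rfl⟩, p, hp, rfl⟩),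
        .inr ⟨v, p, rfl, rfl, Picture.rel_of_remaining hp⟩⟩
  · exact .inl ⟨u, .inr (.inr ⟨j, rfl, hj⟩), h.rep_e u⟩

theorem fullList_of_part {v : V₀} (hv : W₀[i]? = some (some v)) :
    (h.fullList pre suf W₀)[pre.length + i]? = some (some (h.ι v)) := by
  simp only [fullList, getElem?_append_append, List.length_map, List.getElem?_map,
    Option.map_eq_some_iff]
  exact .inr (.inl ⟨i, rfl, _, hv, v, rfl, rfl⟩)

theorem midList_of_part {v : V₀} (hv : W₀[i]? = some (some v))
    (hp : ∀ p, ¬ c₀.rel v (c₀.out p)) : (h.midList pre suf W₀)[pre.length + i]? = some none := by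
  simp only [midList, getElem?_append_append, List.length_map, List.getElem?_map,
    Option.map_eq_some_iff]
  exact .inr (.inl ⟨i, rfl, _, ⟨_, hv, rfl⟩, by rw [Picture.remaining_eq_none.2 hp]; rfl⟩)

/-- The arcs of the whole are the arcs inside the part, with indices shifted by the prefixes, and
the arcs of the simplified picture, with indices moved by the embeddings that undo the cancellation
of ghosts. Both maps preserve the conditions on the numbers, which are parities in the application.
-/
theorem ncard_arcs {T : ℕ → ℕ → Prop} {pre' suf' : List (Option V')} {W₀' : List (Option V₀)}
    {P Q : ℕ → Prop} {f f' : ℕ ↪o ℕ}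
    (hf : ∀ i, (h.redList pre suf W₀)[i]? = (h.midList pre suf W₀)[f i]?)
    (hf' : ∀ i, (h.redList pre' suf' W₀')[i]? = (h.midList pre' suf' W₀')[f' i]?)
    (hs : ∀ i a, (h.midList pre suf W₀)[i]? = some (some a) → ∃ j, f j = i)
    (hs' : ∀ i a, (h.midList pre' suf' W₀')[i]? = some (some a) → ∃ j, f' j = i)
    (hT : ∀ i j, T (f i) (f' j) ↔ T i j)
    (hT' : ∀ i j, T (pre.length + i) (pre'.length + j) ↔ T i j)
    (hP : ∀ i, P (f i + 1) ↔ P (i + 1)) (hQ : ∀ i, Q (f' i + 1) ↔ Q (i + 1))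
    (hP' : ∀ i, P (pre.length + i + 1) ↔ P (i + 1))
    (hQ' : ∀ i, Q (pre'.length + i + 1) ↔ Q (i + 1))
    (hA : ∀ i j v v', T i j → W₀[i]? = some (some v) → W₀'[j]? = some (some v') → c₀.rel v v' →
      ∀ p, ¬ c₀.rel v (c₀.out p)) :
    (arcs c.rel T (h.fullList pre suf W₀) (h.fullList pre' suf' W₀') P Q).ncard =
      (arcs c₀.rel T W₀ W₀' P Q).ncard +
        (arcs c'.rel T (h.redList pre suf W₀) (h.redList pre' suf' W₀') P Q).ncard := by
  have e : arcs c.rel T (h.fullList pre suf W₀) (h.fullList pre' suf' W₀') P Q =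
      (fun e : ℕ × ℕ => (pre.length + e.1, pre'.length + e.2)) '' arcs c₀.rel T W₀ W₀' P Q ∪
      Prod.map f f' '' arcs c'.rel T (h.redList pre suf W₀) (h.redList pre' suf' W₀') P Q := by
    apply Set.Subset.antisymm
    · rintro ⟨i, j⟩ ⟨ht, ⟨w, w', hw, hw', hr⟩, hp, hq⟩
      have part : ∀ v v' i' j', i = pre.length + i' → W₀[i']? = some (some v) → w = h.ι v →
          j = pre'.length + j' → W₀'[j']? = some (some v') → w' = h.ι v' →
          (∀ p, ¬ c₀.rel v (c₀.out p)) → (i, j) ∈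
          (fun e : ℕ × ℕ => (pre.length + e.1, pre'.length + e.2)) '' arcs c₀.rel T W₀ W₀' P Q := by
        rintro v v' i' j' rfl hv rfl rfl hv' rfl hn
        obtain ⟨v'', e, hr⟩ := exists_of_rel_ι hr hn
        obtain rfl := h.ι_injective e
        exact ⟨(i', j'), ⟨(hT' _ _).1 ht, ⟨v, v', hv, hv', hr⟩, (hP' _).1 hp, (hQ' _).1 hq⟩, rfl⟩
      -- Both ends of an arc are still visible after the arcs of the part have been removed, or
      -- neither is. In the mixed cases the arc would stay inside the part and yet reach one of its
      -- outer nodes.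
      rcases midList_of_fullList hw with ⟨u, hu, hwu⟩ | ⟨v, i', hi, hv, hwv, hn⟩
      · rcases midList_of_fullList hw' with ⟨u', hu', hwu'⟩ | ⟨v', j', hj, hv', hwv', hn⟩
        · right
          obtain ⟨i, rfl⟩ := hs _ _ hu
          obtain ⟨j, rfl⟩ := hs' _ _ hu'
          rw [← hf] at hu
          rw [← hf'] at hu'
          exact ⟨(i, j), ⟨(hT _ _).1 ht, ⟨u, u', hu, hu', (rel_iff_of_rep hwu hwu').1 hr⟩,
            (hP _).1 hp, (hQ _).1 hq⟩, rfl⟩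
        · exfalso
          subst hwv'
          obtain ⟨v, rfl, hv⟩ := exists_of_rel_ι (c.rel.symm' hr) hn
          obtain ⟨p, -, hp⟩ := rep_ι hwu
          exact hn p (c₀.rel.trans' hv hp)
      · left
        rcases midList_of_fullList hw' with ⟨u', hu', hwu'⟩ | ⟨v', j', hj, hv', hwv', -⟩
        · exfalso
          subst hwv
          obtain ⟨v', rfl, hv'⟩ := exists_of_rel_ι hr hn
          obtain ⟨p, -, hp⟩ := rep_ι hwu'
          exact hn p (c₀.rel.trans' hv' hp)
        · exact part v v' i' j' hi hv hwv hj hv' hwv' hn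
    · rintro _ (⟨⟨i, j⟩, ⟨ht, ⟨v, v', hv, hv', hr⟩, hp, hq⟩, rfl⟩ |
        ⟨⟨i, j⟩, ⟨ht, ⟨u, u', hu, hu', hr⟩, hp, hq⟩, rfl⟩)
      · exact ⟨(hT' _ _).2 ht, ⟨_, _, fullList_of_part hv, fullList_of_part hv', h.rel_ι _ _ hr⟩,
          (hP' _).2 hp, (hQ' _).2 hq⟩
      · rw [hf] at hu
        rw [hf'] at hu'
        obtain ⟨w, hw, hwu⟩ := exists_of_midList hu
        obtain ⟨w', hw', hwu'⟩ := exists_of_midList hu'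
        exact ⟨(hT _ _).2 ht, ⟨w, w', hw, hw', (rel_iff_of_rep hwu hwu').2 hr⟩,
          (hP _).2 hp, (hQ _).2 hq⟩
  rw [e, Set.ncard_union_eq _ ((finite_arcs ..).image _) ((finite_arcs ..).image _),
    Set.ncard_image_of_injective, Set.ncard_image_of_injective]
  · exact f.injective.prodMap f'.injective
  · rintro ⟨i, j⟩ ⟨i', j'⟩ e
    simpa using e
  -- An end of an arc inside the part has become a ghost in `midList`, whereas an arc of `c'` starts
  -- at a genuine string end there.
  · rw [Set.disjoint_left]
    rintro _ ⟨⟨i, j⟩, ⟨ht, ⟨v, v', hv, hv', hr⟩, hp, hq⟩, rfl⟩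
      ⟨⟨i', j'⟩, ⟨-, ⟨u, u', hu, -⟩, -⟩, e⟩
    have := midList_of_part (h := h) (pre := pre) (suf := suf) hv (hA i j v v' ht hv hv' hr)
    rw [hf, show f i' = pre.length + i from congrArg Prod.fst e, this] at hu
    simp at hu

/-- Passing to representatives does not change which outer nodes are reached. Before cancellation
the boundaries agree entry by entry once the arcs of the part have become ghosts, and cancellation
is confluent. -/
theorem drawing_eq (h : Contraction c₀ c' c) : c.drawing = c'.drawing := by
  have hout : ∀ {w u} p, h.Rep w u → (c.rel w (c.out p) ↔ c'.rel u (c'.out p)) := by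
    intro w u p hw
    rw [h.e_out]
    exact rel_iff_of_rep hw (h.rep_e _)
  have hlist : ∀ pre suf W₀, cancelGhosts ((h.fullList pre suf W₀).map c.remaining) =
      cancelGhosts ((h.redList pre suf W₀).map c'.remaining) := by
    intro pre suf W₀
    rw [← ((h.cancels_midList_redList pre suf W₀).map c'.remaining rfl).cancelGhosts_eq]
    congr 1
    have he : ∀ l : List (Option V'), (l.map (Option.map h.e)).map c.remaining =
        l.map c'.remaining := by
      intro l
      rw [List.map_map]
      refine List.map_congr_left fun u _ => ?_
      cases u with
      | none => rfl
      | some u => exact Picture.remaining_congr fun p => hout p (h.rep_e u)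
    rw [fullList, midList, List.map_append, List.map_append, he, he, List.map_append,
      List.map_append]
    congr 2
    rw [List.map_map, List.map_map, List.map_map]
    refine List.map_congr_left fun v _ => ?_
    cases v with
    | none => rfl
    | some v =>
      simp only [Function.comp_apply, Option.map_some]
      cases hp : c₀.remaining (some v) with
      | none =>
        rw [Picture.remaining_eq_none] at hp
        refine (Picture.remaining_eq_none.2 fun p hr => ?_)
        rw [h.e_out] at hr
        obtain ⟨v', e, hv⟩ := exists_of_rel_ι hr hp
        obtain ⟨q, rfl, -⟩ := h.eq_out _ _ e.symm
        exact hp q hv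
      | some p =>
        exact Picture.remaining_congr fun q =>
          hout q (.inr ⟨v, p, rfl, rfl, Picture.rel_of_remaining hp⟩)
  unfold Picture.drawing
  congr 1
  · funext p
    refine Picture.dite_choose_congr fun q => and_congr_right fun _ => ?_
    rw [h.e_out p]
    exact hout q (h.rep_e _)
  · rw [h.top_eq, h.top_eq']
    exact hlist _ _ _
  · rw [h.bot_eq, h.bot_eq']
    exact hlist _ _ _

end Contraction

end GhostAlg

/-! ### Loops and weights under contraction -/

namespace GhostAlg

namespace Contraction

variable {a b n l : ℕ} {V₀ V' V : Type} {c₀ : Picture a b V₀} {c' : Picture n l V'}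
  {c : Picture n l V}

/-- A loop that meets no remaining vertex is a loop of the part. Any other loop is determined by its
remaining vertices, which form a loop of `c'`. The condition `partner_ne_none` relates the
closedness of the stretches inside the part to the strings of its drawing. -/
theorem ncard_loops [Finite V] [Finite V₀] [Finite V'] (h : Contraction c₀ c' c) :
    c.loops.ncard = c₀.loops.ncard + c'.loops.ncard := by
  have e : c.loops = (fun C => h.ι '' C) '' c₀.loops ∪
      (fun C => {w | ∃ u ∈ C, c.rel (h.e u) w}) '' c'.loops := by
    apply Set.Subset.antisymm
    · rintro _ ⟨w, rfl, hw⟩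
      by_cases hu : ∃ u, c.rel w (h.e u)
      · right
        obtain ⟨u, hu⟩ := hu
        refine ⟨{u' | c'.rel u u'}, ⟨u, rfl, fun u' hu' => ?_⟩, ?_⟩
        · have hcl : ∀ {t}, c.rel (h.e u') t → c.Closed t := fun ht =>
            hw _ (c.rel.trans' hu (c.rel.trans' (h.rel_e _ _ hu') ht))
          by_cases hp : ∃ p, u' = h.o p
          · obtain ⟨p, rfl⟩ := hp
            -- The whole component is closed, in particular its stretch in the part at `p`; hence
            -- this stretch ends at another outer node and is a string of the drawing.
            refine (h.closed_o' p).2 ⟨(h.partner_ne_none p).2 fun v hv => ?_,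
              ((h.closed_o p).1 (hcl (c.rel.refl' _))).2⟩
            have hv' : c.Closed (h.ι v) := hcl (by rw [← h.ι_out]; exact h.rel_ι _ _ hv)
            by_cases hq : ∃ q, v = c₀.out q
            · obtain ⟨q, rfl⟩ := hq
              rw [h.ι_out, h.closed_o] at hv'
              exact .inr ⟨q, rfl, hv'.1⟩
            · exact .inl ((h.closed_ι v (not_exists.1 hq)).1 hv')
          · exact (h.closed_e u' (not_exists.1 hp)).1 (hcl (c.rel.refl' _))
        · ext t
          constructor
          · rintro ⟨u', hu', ht⟩
            exact c.rel.trans' hu (c.rel.trans' (h.rel_e _ _ hu') ht)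
          · intro ht
            exact ⟨u, c'.rel.refl' _, c.rel.trans' (c.rel.symm' hu) ht⟩
      · left
        rcases h.cover w with ⟨v, rfl⟩ | ⟨u, rfl⟩
        · have hn : ∀ v', c₀.rel v v' → ∀ p, v' ≠ c₀.out p := by
            rintro _ hv p rfl
            exact hu ⟨h.o p, by rw [← h.ι_out]; exact h.rel_ι _ _ hv⟩
          refine ⟨{v' | c₀.rel v v'}, ⟨v, rfl, fun v' hv' => ?_⟩, ?_⟩
          · exact (h.closed_ι v' (hn v' hv')).1 (hw _ (h.rel_ι _ _ hv'))
          · ext t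
            constructor
            · rintro ⟨v', hv', rfl⟩
              exact h.rel_ι _ _ hv'
            · intro ht
              obtain ⟨v', rfl, hv'⟩ := exists_of_rel_ι ht fun p hp => hn _ hp p rfl
              exact ⟨v', hv', rfl⟩
        · exact absurd ⟨u, c.rel.refl' _⟩ hu
    · rintro _ (⟨_, ⟨v, rfl, hv⟩, rfl⟩ | ⟨_, ⟨u, rfl, hu⟩, rfl⟩)
      · have hn : ∀ v', c₀.rel v v' → ∀ p, v' ≠ c₀.out p := by
          rintro _ hv' p rfl
          exact h.not_closed_out p (hv _ hv')
        refine ⟨h.ι v, ?_, ?_⟩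
        · ext t
          constructor
          · rintro ⟨v', hv', rfl⟩
            exact h.rel_ι _ _ hv'
          · intro ht
            obtain ⟨v', rfl, hv'⟩ := exists_of_rel_ι ht fun p hp => hn _ hp p rfl
            exact ⟨v', hv', rfl⟩
        · rintro _ ⟨v', hv', rfl⟩
          exact (h.closed_ι v' (hn v' hv')).2 (hv v' hv')
      · refine ⟨h.e u, ?_, ?_⟩
        · ext t
          constructor
          · rintro ⟨u', hu', ht⟩
            exact c.rel.trans' (h.rel_e _ _ hu') ht
          · intro ht
            exact ⟨u, c'.rel.refl' _, ht⟩
        · rintro t ⟨u₁, hu₁, ht⟩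
          obtain ⟨u', hr, hu₁'⟩ := exists_rep_of_rel ht (h.rep_e u₁)
          have hu' := c'.rel.trans' hu₁ hu₁'
          rcases hr with rfl | ⟨v, p, rfl, rfl, hv⟩
          · by_cases hp : ∃ p, u' = h.o p
            · obtain ⟨p, rfl⟩ := hp
              have hp := (h.closed_o' p).1 (hu _ hu')
              refine (h.closed_o p).2 ⟨?_, hp.2⟩
              rcases (h.partner_ne_none p).1 hp.1 _ (c₀.rel.refl' _) with hcl | ⟨q, hq, hq'⟩
              · exact absurd hcl (h.not_closed_out p)
              · have : h.e (h.o p) = h.e (h.o q) := by rw [← h.ι_out, ← h.ι_out, hq]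
                have h1 : c.Closed (h.e (h.o q)) ↔ _ := h.closed_o q
                have h2 := (h.closed_o' q).1 (h.e_injective this ▸ hu _ hu')
                exact ((h.closed_o p).1 (this ▸ h1.2 ⟨hq', h2.2⟩)).1
            · exact (h.closed_e u' (not_exists.1 hp)).2 (hu _ hu')
          · have hp := (h.closed_o' p).1 (hu _ hu')
            -- A vertex visible in `c'` only through `p` lies on the string of the part at `p`. As
            -- this string leads to another outer node, its vertices are closed or outer nodes with
            -- a string inside the part.
            rcases (h.partner_ne_none p).1 hp.1 v (c₀.rel.symm' hv) with hcl | ⟨q, rfl, hq⟩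
            · refine (h.closed_ι v ?_).2 hcl
              rintro q rfl
              exact h.not_closed_out q hcl
            · rw [h.ι_out]
              exact (h.closed_o q).2 ⟨hq, ((h.closed_o' q).1
                (hu _ (c'.rel.trans' hu' (c'.rel.symm' (h.rel_out q p hv))))).2⟩
  rw [e, Set.ncard_union_eq _ (Set.toFinite _) (Set.toFinite _), Set.ncard_image_of_injective _
    h.ι_injective.image_injective, Set.InjOn.ncard_image]
  · rintro _ ⟨u, rfl, -⟩ _ ⟨u', rfl, -⟩ he
    dsimp only at he
    have key : ∀ u u' : V', {w | ∃ t ∈ {t | c'.rel u t}, c.rel (h.e t) w} =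
        {w | ∃ t ∈ {t | c'.rel u' t}, c.rel (h.e t) w} → ∀ t, c'.rel u t → c'.rel u' t := by
      intro u u' he t ht
      obtain ⟨s, hs, hst⟩ := (Set.ext_iff.1 he (h.e t)).1 ⟨t, ht, c.rel.refl' _⟩
      exact c'.rel.trans' hs ((rel_iff_of_rep (h.rep_e _) (h.rep_e _)).1 hst)
    exact Set.ext fun t => ⟨key u u' he t, key u' u he.symm t⟩
  · rw [Set.disjoint_left]
    rintro _ ⟨_, ⟨v, rfl, hv⟩, rfl⟩ ⟨_, ⟨u, rfl, hu⟩, he⟩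
    dsimp only at he
    obtain ⟨v', hv', e'⟩ := (Set.ext_iff.1 he (h.e u)).1 ⟨u, c'.rel.refl' _, c.rel.refl' _⟩
    obtain ⟨p, rfl, -⟩ := h.eq_out _ _ e'
    exact h.not_closed_out p (hv _ hv')

/-- Loops and arcs are counted in two steps. -/
theorem weight_eq [Finite V] [Finite V₀] [Finite V'] {R : Type*} [CommRing R] (P : Params R)
    (h : Contraction c₀ c' c) : c.weight P = c₀.weight P * c'.weight P := by
  -- The type of an arc depends only on the parities of its numbers. The prefixes have even length
  -- and the embeddings preserve parity.
  have hpar : ∀ {P : ℕ → Prop} {i j : ℕ}, P = Odd ∨ P = Even → (Even i ↔ Even j) →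
      (P (i + 1) ↔ P (j + 1)) := by
    rintro P i j (rfl | rfl) hij
    · rw [Nat.odd_add_one, Nat.odd_add_one, Nat.not_odd_iff_even, Nat.not_odd_iff_even, hij]
    · rw [Nat.even_add_one, Nat.even_add_one, hij]
  obtain ⟨f, hf, hfp, hfs⟩ :=
    (h.cancels_midList_redList h.topPre h.topSuf c₀.top).exists_orderEmbedding
  obtain ⟨g, hg, hgp, hgs⟩ :=
    (h.cancels_midList_redList h.botPre h.botSuf c₀.bot).exists_orderEmbedding
  have ht : c.top = h.fullList h.topPre h.topSuf c₀.top := h.top_eq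
  have hb : c.bot = h.fullList h.botPre h.botSuf c₀.bot := h.bot_eq
  have ht' : c'.top = h.redList h.topPre h.topSuf c₀.top := h.top_eq'
  have hb' : c'.bot = h.redList h.botPre h.botSuf c₀.bot := h.bot_eq'
  have hadd : ∀ {i j : ℕ}, Even j → (Even (j + i) ↔ Even i) := fun hj => by
    rw [Nat.even_add]
    tauto
  have htop : ∀ P Q, P = Odd ∨ P = Even → Q = Odd ∨ Q = Even →
      c.topCount P Q = c₀.topCount P Q + c'.topCount P Q := by
    intro P Q hP hQ
    rw [Picture.topCount, Picture.topCount, Picture.topCount, ht, ht']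
    exact ncard_arcs hf hf hfs hfs (fun _ _ => f.lt_iff_lt) (fun _ _ => Nat.add_lt_add_iff_left)
      (fun i => hpar hP (hfp i)) (fun i => hpar hQ (hfp i)) (fun i => hpar hP (hadd h.even_topPre))
      (fun i => hpar hQ (hadd h.even_topPre)) h.arc_top
  have hbot : ∀ P Q, P = Odd ∨ P = Even → Q = Odd ∨ Q = Even →
      c.botCount P Q = c₀.botCount P Q + c'.botCount P Q := by
    intro P Q hP hQ
    rw [Picture.botCount, Picture.botCount, Picture.botCount, hb, hb']
    exact ncard_arcs hg hg hgs hgs (fun _ _ => g.lt_iff_lt) (fun _ _ => Nat.add_lt_add_iff_left)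
      (fun i => hpar hP (hgp i)) (fun i => hpar hQ (hgp i)) (fun i => hpar hP (hadd h.even_botPre))
      (fun i => hpar hQ (hadd h.even_botPre)) h.arc_bot
  have hcross : ∀ P Q, P = Odd ∨ P = Even → Q = Odd ∨ Q = Even →
      c.crossCount P Q = c₀.crossCount P Q + c'.crossCount P Q := by
    intro P Q hP hQ
    rw [Picture.crossCount, Picture.crossCount, Picture.crossCount, ht, ht', hb, hb']
    exact ncard_arcs hf hg hfs hgs (fun _ _ => Iff.rfl) (fun _ _ => Iff.rfl)
      (fun i => hpar hP (hfp i)) (fun i => hpar hQ (hgp i)) (fun i => hpar hP (hadd h.even_topPre))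
      (fun i => hpar hQ (hadd h.even_botPre)) fun i j v v' _ => h.arc_cross i j v v'
  simp only [Picture.weight, h.ncard_loops, htop _ _ (.inl rfl) (.inl rfl),
    htop _ _ (.inl rfl) (.inr rfl), htop _ _ (.inr rfl) (.inl rfl), htop _ _ (.inr rfl) (.inr rfl),
    hbot _ _ (.inl rfl) (.inl rfl), hbot _ _ (.inl rfl) (.inr rfl), hbot _ _ (.inr rfl) (.inl rfl),
    hbot _ _ (.inr rfl) (.inr rfl), hcross _ _ (.inl rfl) (.inl rfl),
    hcross _ _ (.inl rfl) (.inr rfl), hcross _ _ (.inr rfl) (.inl rfl),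
    hcross _ _ (.inr rfl) (.inr rfl), pow_add]
  ring

end Contraction

end GhostAlg

namespace GhostAlg

/-! ## The concatenation of two diagrams is a diagram -/

section Pair

variable {n m k : ℕ} (x : Drawing n m) (y : Drawing m k)

/-- An outer node is occupied. -/
def OuterOccupied : Node n k → Prop
  | Sum.inl i => x.Occupied (Sum.inl i)
  | Sum.inr j => y.Occupied (Sum.inr j)

/-- An outer node is connected to another node of its own rectangle. -/
def OuterPartner : Node n k → Prop
  | Sum.inl i => x.partner (Sum.inl i) ≠ none
  | Sum.inr j => y.partner (Sum.inr j) ≠ none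

/-- The end of a string on a boundary is attached to the node `v` of its rectangle. -/
def EntryAt (v : Vertex n m k) : Prop :=
  (∃ p, v = vertexL p ∧ (some p ∈ x.top ∨ some p ∈ x.bot)) ∨
    ∃ p, v = vertexR p ∧ (some p ∈ y.top ∨ some p ∈ y.bot)

variable {x y} {v w : Vertex n m k} {p q : Node n k}

theorem OuterPartner.outerOccupied (h : OuterPartner x y p) : OuterOccupied x y p := by
  rcases p with i | j <;> exact .inl h

theorem rawEnd_outer (h : OuterOccupied x y p) : RawEnd x y (nodePos p) (vertexOuter p) := by
  rcases p with i | j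
  · exact .left h
  · exact .right h

theorem entryAt_of_top {i : ℕ} (h : (concatTop x y)[i]? = some (some v)) : EntryAt x y v := by
  rcases getElem?_append_map.1 h with ⟨-, p, h', rfl⟩ | ⟨j, -, p, h', rfl⟩
  · exact .inl ⟨p, rfl, .inl (List.mem_of_getElem? h')⟩
  · exact .inr ⟨p, rfl, .inl (List.mem_of_getElem? h')⟩

theorem entryAt_of_bot {i : ℕ} (h : (concatBot x y)[i]? = some (some v)) : EntryAt x y v := by
  rcases getElem?_append_map.1 h with ⟨-, p, h', rfl⟩ | ⟨j, -, p, h', rfl⟩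
  · exact .inl ⟨p, rfl, .inr (List.mem_of_getElem? h')⟩
  · exact .inr ⟨p, rfl, .inr (List.mem_of_getElem? h')⟩

theorem EntryAt.exists_rawEnd (h : EntryAt x y v) :
    ∃ a, RawEnd x y a v ∧ ∀ p : Node n k, a ≠ nodePos p := by
  rcases h with ⟨p, rfl, h | h⟩ | ⟨p, rfl, h | h⟩ <;> obtain ⟨i, h⟩ := Drawing.some_mem_iff.1 h
  · exact ⟨topPos i, .top (getElem?_append_map.2
      (.inl ⟨(List.getElem?_eq_some_iff.1 h).1, p, h, rfl⟩)), by simp⟩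
  · exact ⟨botPos i, .bot (getElem?_append_map.2
      (.inl ⟨(List.getElem?_eq_some_iff.1 h).1, p, h, rfl⟩)), by simp⟩
  · exact ⟨_, .top (getElem?_append_map.2 (.inr ⟨i, rfl, p, h, rfl⟩)), by simp⟩
  · exact ⟨_, .bot (getElem?_append_map.2 (.inr ⟨i, rfl, p, h, rfl⟩)), by simp⟩

theorem RawEnd.cases_outer {a : ℕ ×ₗ ℤ} (h : RawEnd x y a v) :
    (∃ p, a = nodePos p ∧ v = vertexOuter p ∧ OuterOccupied x y p) ∨
      ((∀ p : Node n k, a ≠ nodePos p) ∧ EntryAt x y v) := by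
  cases h with
  | @left i h => exact .inl ⟨Sum.inl i, rfl, rfl, h⟩
  | @right j h => exact .inl ⟨Sum.inr j, rfl, rfl, h⟩
  | top h => exact .inr ⟨by simp, entryAt_of_top h⟩
  | bot h => exact .inr ⟨by simp, entryAt_of_bot h⟩

theorem vertexL_eq_outer {p : Node n m} {q : Node n k} :
    (vertexL p : Vertex n m k) = vertexOuter q ↔ ∃ i, p = Sum.inl i ∧ q = Sum.inl i := by
  rcases p with i | i <;> rcases q with j | j <;> simp [vertexL, vertexOuter, eq_comm]

theorem vertexR_eq_outer {p : Node m k} {q : Node n k} :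
    (vertexR p : Vertex n m k) = vertexOuter q ↔ ∃ i, p = Sum.inr i ∧ q = Sum.inr i := by
  rcases p with i | i <;> rcases q with j | j <;> simp [vertexR, vertexOuter, eq_comm]

theorem vertexL_eq_middle {p : Node n m} {j : Fin m} :
    (vertexL p : Vertex n m k) = vertexM j ↔ p = Sum.inr j := by
  rcases p with i | i <;> simp [vertexL, vertexM]

theorem vertexR_eq_middle {p : Node m k} {j : Fin m} :
    (vertexR p : Vertex n m k) = vertexM j ↔ p = Sum.inl j := by
  rcases p with i | i <;> simp [vertexR, vertexM]

theorem vertexOuter_ne_middle {p : Node n k} {j : Fin m} :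
    (vertexOuter p : Vertex n m k) ≠ vertexM j := by
  rcases p with i | i <;> simp [vertexOuter, vertexM]

theorem vertex_cases (v : Vertex n m k) :
    (∃ p : Node n k, v = vertexOuter p) ∨ ∃ j : Fin m, v = vertexM j := by
  rcases v with i | i | i
  exacts [.inl ⟨Sum.inl i, rfl⟩, .inr ⟨i, rfl⟩, .inl ⟨Sum.inr i, rfl⟩]

theorem EntryAt.outerOccupied (h : EntryAt x y (vertexOuter p)) : OuterOccupied x y p := by
  rcases h with ⟨q, e, h⟩ | ⟨q, e, h⟩
  · obtain ⟨i, rfl, rfl⟩ := vertexL_eq_outer.1 e.symm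
    exact .inr h
  · obtain ⟨i, rfl, rfl⟩ := vertexR_eq_outer.1 e.symm
    exact .inr h

theorem EntryAt.not_outerPartner (hx : x.IsDiagram) (hy : y.IsDiagram)
    (h : EntryAt x y (vertexOuter p)) : ¬ OuterPartner x y p := by
  rcases h with ⟨q, e, h⟩ | ⟨q, e, h⟩
  · obtain ⟨i, rfl, rfl⟩ := vertexL_eq_outer.1 e.symm
    exact not_not.2 (hx.partner_eq_none _ h)
  · obtain ⟨i, rfl, rfl⟩ := vertexR_eq_outer.1 e.symm
    exact not_not.2 (hy.partner_eq_none _ h)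

theorem EntryAt.not_closed (hx : x.IsDiagram) (hy : y.IsDiagram)
    (h : EntryAt x y v) : ¬ (Picture.pair x y).Closed v := by
  rintro ⟨j, rfl, h1, h2⟩
  rcases h with ⟨q, e, h⟩ | ⟨q, e, h⟩
  · rw [vertexL_eq_middle.1 e.symm] at h
    exact h1 (hx.partner_eq_none _ h)
  · rw [vertexR_eq_middle.1 e.symm] at h
    exact h2 (hy.partner_eq_none _ h)

theorem linked_symm (hx : x.IsDiagram) (hy : y.IsDiagram) (h : Linked x y v w) :
    Linked x y w v := by
  rcases h with ⟨p, q, h, rfl, rfl⟩ | ⟨p, q, h, rfl, rfl⟩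
  · exact .inl ⟨q, p, hx.partner_symm _ _ h, rfl, rfl⟩
  · exact .inr ⟨q, p, hy.partner_symm _ _ h, rfl, rfl⟩

/-- Links are symmetric in diagrams, so every vertex of a nontrivial component is the first vertex
of some link. -/
theorem Joined.exists_linked (hx : x.IsDiagram) (hy : y.IsDiagram) (h : Joined x y v w)
    (hne : v ≠ w) : ∃ u, Linked x y v u := by
  have key : v = w ∨ (∃ u, Linked x y v u) ∧ ∃ u, Linked x y w u := by
    clear hne
    induction h with
    | rel v w h => exact .inr ⟨⟨w, h⟩, ⟨v, linked_symm hx hy h⟩⟩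
    | refl v => exact .inl rfl
    | symm v w _ ih => exact ih.imp Eq.symm And.symm
    | trans u v w _ _ ih ih' =>
      rcases ih with rfl | ih
      · exact ih'
      · rcases ih' with rfl | ih'
        · exact .inr ih
        · exact .inr ⟨ih.1, ih'.2⟩
  exact (key.resolve_left hne).1

theorem linked_outer (h : Linked x y (vertexOuter p) v) : OuterPartner x y p := by
  rcases h with ⟨q, r, h, e, -⟩ | ⟨q, r, h, e, -⟩
  · obtain ⟨i, rfl, rfl⟩ := vertexL_eq_outer.1 e.symm
    simp [OuterPartner, h]
  · obtain ⟨i, rfl, rfl⟩ := vertexR_eq_outer.1 e.symm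
    simp [OuterPartner, h]

theorem linked_middle {j : Fin m} (h : Linked x y (vertexM j) v) :
    x.partner (Sum.inr j) ≠ none ∨ y.partner (Sum.inl j) ≠ none := by
  rcases h with ⟨q, r, h, e, -⟩ | ⟨q, r, h, e, -⟩
  · rw [vertexL_eq_middle.1 e.symm] at h
    simp [h]
  · rw [vertexR_eq_middle.1 e.symm] at h
    simp [h]

theorem outerPartner_of_joined (hx : x.IsDiagram) (hy : y.IsDiagram)
    (h : Joined x y (vertexOuter p) v) (hne : v ≠ vertexOuter p) : OuterPartner x y p := by
  obtain ⟨u, h⟩ := h.exists_linked hx hy hne.symm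
  exact linked_outer h

theorem EntryAt.outerOccupied_of_joined (hx : x.IsDiagram) (hy : y.IsDiagram) (h : EntryAt x y v)
    (hj : Joined x y v (vertexOuter p)) : OuterOccupied x y p := by
  by_cases e : v = vertexOuter p
  · subst e
    exact h.outerOccupied
  · exact (outerPartner_of_joined hx hy hj.symm e).outerOccupied

/-- Different outer nodes on one component are occupied, hence they are ends of the picture, and a
component has at most two ends. -/
theorem joined_outer_unique (hx : x.IsDiagram) (hy : y.IsDiagram) (hc : Compatible x y)
    {r : Node n k} (hq : Joined x y (vertexOuter p) (vertexOuter q))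
    (hr : Joined x y (vertexOuter p) (vertexOuter r)) : p = q ∨ p = r ∨ q = r := by
  by_cases hpq : p = q
  · exact .inl hpq
  by_cases hpr : p = r
  · exact .inr (.inl hpr)
  have ne : ∀ {s t : Node n k}, s ≠ t → (vertexOuter s : Vertex n m k) ≠ vertexOuter t := fun h e =>
    h (vertexOuter_injective e)
  have h1 := (outerPartner_of_joined hx hy hq (ne (Ne.symm hpq))).outerOccupied
  have h2 := (outerPartner_of_joined hx hy hq.symm (ne hpq)).outerOccupied
  have h3 := (outerPartner_of_joined hx hy hr.symm (ne hpr)).outerOccupied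
  simpa using RawEnd.eq_or_eq hx hy hc (rawEnd_outer h1) (rawEnd_outer h2) (rawEnd_outer h3) hq hr

theorem EntryAt.outer_unique (hx : x.IsDiagram) (hy : y.IsDiagram) (hc : Compatible x y)
    (h : EntryAt x y v) (hp : Joined x y v (vertexOuter p)) (hq : Joined x y v (vertexOuter q)) :
    p = q := by
  obtain ⟨a, ha, hne⟩ := h.exists_rawEnd
  have := RawEnd.eq_or_eq hx hy hc ha (rawEnd_outer (h.outerOccupied_of_joined hx hy hp))
    (rawEnd_outer (h.outerOccupied_of_joined hx hy hq)) hp hq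
  rcases this with h | h | h
  · exact absurd h (hne _)
  · exact absurd h (hne _)
  · simpa using h

/-- The ends of a boundary arc are not connected to outer nodes. -/
theorem RawEnd.not_joined_outer (hx : x.IsDiagram) (hy : y.IsDiagram) (hc : Compatible x y)
    {a b : ℕ ×ₗ ℤ} (ha : RawEnd x y a v) (hb : RawEnd x y b w)
    (ha' : ∀ p : Node n k, a ≠ nodePos p) (hb' : ∀ p : Node n k, b ≠ nodePos p) (hab : a ≠ b)
    (h : Joined x y v w) (p : Node n k) : ¬ Joined x y v (vertexOuter p) := by
  intro hp
  have hv : EntryAt x y v := by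
    rcases ha.cases_outer with ⟨q, rfl, -⟩ | ⟨-, h⟩
    · exact absurd rfl (ha' q)
    · exact h
  rcases RawEnd.eq_or_eq hx hy hc ha hb (rawEnd_outer (hv.outerOccupied_of_joined hx hy hp)) h hp
    with h | h | h
  exacts [hab h, ha' _ h, hb' _ h]

/-- An outer node is connected to at most one other outer node, which makes the choice in `concat`
unambiguous. -/
theorem concat_partner (hx : x.IsDiagram) (hy : y.IsDiagram) (hc : Compatible x y) :
    (concat x y).partner p = some q ↔ q ≠ p ∧ Joined x y (vertexOuter p) (vertexOuter q) := by
  rw [concat]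
  dsimp only
  split_ifs with h
  · have hs := h.choose_spec
    rw [Option.some.injEq]
    refine ⟨fun e => e ▸ hs, fun hq => ?_⟩
    rcases joined_outer_unique hx hy hc hs.2 hq.2 with e | e | e
    exacts [absurd e.symm hs.1, absurd e.symm hq.1, e]
  · exact iff_of_false (by simp) fun hq => h ⟨q, hq⟩

theorem concat_partner_ne_none :
    (concat x y).partner p ≠ none ↔ ∃ q ≠ p, Joined x y (vertexOuter p) (vertexOuter q) := by
  rw [concat]
  dsimp only
  split_ifs with h
  · simpa using h
  · simpa using h

theorem remaining_eq_some (hx : x.IsDiagram) (hy : y.IsDiagram) (hc : Compatible x y)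
    (h : EntryAt x y v) : remaining x y (some v) = some p ↔ Joined x y v (vertexOuter p) := by
  rw [remaining]
  split_ifs with h'
  · rw [Option.some.injEq]
    refine ⟨fun e => e ▸ h'.choose_spec, fun hp => ?_⟩
    exact h.outer_unique hx hy hc h'.choose_spec hp
  · exact iff_of_false (by simp) fun hq => h' ⟨p, hq⟩

theorem joined_of_remaining {a : Option (Vertex n m k)} (h : remaining x y a = some p) :
    ∃ v, a = some v ∧ Joined x y v (vertexOuter p) := by
  cases a with
  | none => simp [remaining] at h
  | some v =>
    rw [remaining] at h
    split_ifs at h with h'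
    exact ⟨v, rfl, Option.some.inj h ▸ h'.choose_spec⟩

/-- The nodes that are connected to another remaining node. -/
theorem concat_partner_ne_none_iff_forall (hx : x.IsDiagram) (hy : y.IsDiagram)
    (hc : Compatible x y) : (concat x y).partner p ≠ none ↔
      ∀ v, Joined x y (vertexOuter p) v →
        (Picture.pair x y).Closed v ∨ ∃ q, v = vertexOuter q ∧ OuterPartner x y q := by
  have ne : ∀ {s t : Node n k}, s ≠ t → (vertexOuter s : Vertex n m k) ≠ vertexOuter t := fun h e =>
    h (vertexOuter_injective e)
  rw [concat_partner_ne_none]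
  constructor
  · rintro ⟨q, hqp, hq⟩ v hv
    have hpp := outerPartner_of_joined hx hy hq (ne hqp)
    have hqq := outerPartner_of_joined hx hy hq.symm (ne hqp.symm)
    -- A boundary entry on the component would be a third end besides `p` and `q`.
    have hno : ¬ EntryAt x y v := by
      intro h
      obtain ⟨a, ha, hne⟩ := h.exists_rawEnd
      have := RawEnd.eq_or_eq hx hy hc (rawEnd_outer hpp.outerOccupied)
        (rawEnd_outer hqq.outerOccupied) ha hq hv
      rcases this with h | h | h
      exacts [hqp (nodePos_inj.1 h).symm, hne _ h.symm, hne _ h.symm]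
    rcases vertex_cases v with ⟨r, rfl⟩ | ⟨j, rfl⟩
    · refine .inr ⟨r, rfl, ?_⟩
      by_cases hr : r = p
      · rwa [hr]
      · exact outerPartner_of_joined hx hy hv.symm (ne (Ne.symm hr))
    · refine .inl ⟨j, rfl, ?_⟩
      obtain ⟨u, hu⟩ := hv.symm.exists_linked hx hy vertexOuter_ne_middle.symm
      have hxo : x.Occupied (Sum.inr j) := by
        rcases linked_middle hu with h | h
        · exact .inl h
        · exact (hc j).2 (.inl h)
      refine ⟨hxo.resolve_right fun h => hno (.inl ⟨_, rfl, h⟩),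
        ((hc j).1 hxo).resolve_right fun h => hno (.inr ⟨_, rfl, h⟩)⟩
  · intro h
    have hpp : OuterPartner x y p := by
      rcases h _ (.refl _) with ⟨j, e, -⟩ | ⟨q, e, hq⟩
      · exact absurd e vertexOuter_ne_middle
      · rwa [vertexOuter_injective e]
    -- The second end of the component is another outer node, as desired, or a boundary entry. The
    -- latter is excluded, since its vertex is neither closed nor an outer node with a string to
    -- another node of its rectangle.
    obtain ⟨b, w, hb, hne, hj⟩ := RawEnd.exists_ne hx hy hc (rawEnd_outer hpp.outerOccupied)
    rcases hb.cases_outer with ⟨q, rfl, rfl, -⟩ | ⟨-, he⟩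
    · exact ⟨q, fun e => hne (by rw [e]), hj⟩
    · rcases h w hj with h | ⟨q, rfl, hq⟩
      · exact absurd h (he.not_closed hx hy)
      · exact absurd hq (he.not_outerPartner hx hy)

theorem some_mem_concat_top :
    some p ∈ (concat x y).top ↔ some p ∈ (concatTop x y).map (remaining x y) :=
  some_mem_cancelGhosts

theorem some_mem_concat_bot :
    some p ∈ (concat x y).bot ↔ some p ∈ (concatBot x y).map (remaining x y) :=
  some_mem_cancelGhosts

theorem entryAt_of_mem {v : Vertex n m k} (h : some v ∈ concatTop x y ∨ some v ∈ concatBot x y) :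
    EntryAt x y v := by
  rcases h with h | h
  · obtain ⟨i, h⟩ := Drawing.some_mem_iff.1 h
    exact entryAt_of_top h
  · obtain ⟨i, h⟩ := Drawing.some_mem_iff.1 h
    exact entryAt_of_bot h

theorem exists_of_mem_concat (h : some p ∈ (concat x y).top ∨ some p ∈ (concat x y).bot) :
    ∃ v, EntryAt x y v ∧ Joined x y v (vertexOuter p) := by
  rw [some_mem_concat_top, some_mem_concat_bot, List.mem_map, List.mem_map] at h
  rcases h with ⟨a, ha, h⟩ | ⟨a, ha, h⟩ <;> obtain ⟨v, rfl, hv⟩ := joined_of_remaining h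
  · exact ⟨v, entryAt_of_mem (.inl ha), hv⟩
  · exact ⟨v, entryAt_of_mem (.inr ha), hv⟩

/-- The string at an occupied outer node has a second end, which is another outer node or a boundary
entry. Hence concatenation does not change which outer nodes are occupied, and compatibility with a
third factor can be tested before or after it. -/
theorem concat_occupied (hx : x.IsDiagram) (hy : y.IsDiagram) (hc : Compatible x y) :
    (concat x y).Occupied p ↔ OuterOccupied x y p := by
  constructor
  · rintro (h | h)
    · obtain ⟨q, hqp, hq⟩ := concat_partner_ne_none.1 h
      exact (outerPartner_of_joined hx hy hq
        fun e => hqp (vertexOuter_injective e)).outerOccupied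
    · obtain ⟨v, hv, hj⟩ := exists_of_mem_concat h
      exact hv.outerOccupied_of_joined hx hy hj
  · intro h
    obtain ⟨b, w, hb, hne, hj⟩ := RawEnd.exists_ne hx hy hc (rawEnd_outer h)
    rcases hb.cases_outer with ⟨q, rfl, rfl, -⟩ | ⟨hn, he⟩
    · exact .inl (concat_partner_ne_none.2 ⟨q, fun e => hne (by rw [e]), hj⟩)
    · have hr := (remaining_eq_some hx hy hc he).2 hj.symm
      right
      rw [some_mem_concat_top, some_mem_concat_bot, List.mem_map, List.mem_map]
      cases hb with
      | left => exact absurd rfl (hn _)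
      | right => exact absurd rfl (hn _)
      | top h => exact .inl ⟨_, List.mem_of_getElem? h, hr⟩
      | bot h => exact .inr ⟨_, List.mem_of_getElem? h, hr⟩

end Pair

end GhostAlg

/-! ### Planarity is inherited along order-preserving maps of the perimeter; products are diagrams
-/

namespace GhostAlg

section Map

variable {n m : ℕ}

/-- If the strings of a drawing are strings of a planar picture, in the same order on the perimeter,
then they do not cross. -/
theorem Drawing.noncrossing_of_map {D : Drawing n m} {S : ℕ ×ₗ ℤ → ℕ ×ₗ ℤ → Prop}
    {ν : Node n m → ℕ ×ₗ ℤ} {f g : ℕ ↪o ℕ} (hside : ∀ p, (ofLex (ν p)).1 = (ofLex (nodePos p)).1)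
    (hν : ∀ p q, nodePos p < nodePos q → ν p < ν q) (hsymm : ∀ a b, S a b → S b a)
    (hnode : ∀ p q, D.partner p = some q → S (ν p) (ν q))
    (htop : ∀ p (i : ℕ), D.top[i]? = some (some p) → S (ν p) (topPos (f i)))
    (hbot : ∀ p (i : ℕ), D.bot[i]? = some (some p) → S (ν p) (botPos (g i)))
    (hS : ∀ a b c d, S a b → S c d → ¬ (a < c ∧ c < b ∧ b < d)) :
    ∀ a b c d, D.IsString a b → D.IsString c d → ¬ (a < c ∧ c < b ∧ b < d) := by
  let Φ : ℕ ×ₗ ℤ → ℕ ×ₗ ℤ → Prop := fun a a' => (∃ p, a = nodePos p ∧ a' = ν p) ∨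
    (∃ i, a = topPos i ∧ a' = topPos (f i)) ∨ ∃ i, a = botPos i ∧ a' = botPos (g i)
  have hΦ : ∀ a b, D.IsString a b → ∃ a' b', Φ a a' ∧ Φ b b' ∧ S a' b' := by
    intro a b h
    induction h with
    | @node p q h => exact ⟨_, _, .inl ⟨p, rfl, rfl⟩, .inl ⟨q, rfl, rfl⟩, hnode p q h⟩
    | @top p i h => exact ⟨_, _, .inl ⟨p, rfl, rfl⟩, .inr (.inl ⟨i, rfl, rfl⟩), htop p i h⟩
    | @bot p i h => exact ⟨_, _, .inl ⟨p, rfl, rfl⟩, .inr (.inr ⟨i, rfl, rfl⟩), hbot p i h⟩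
    | symm _ ih =>
      obtain ⟨a', b', h1, h2, h3⟩ := ih
      exact ⟨b', a', h2, h1, hsymm _ _ h3⟩
  -- Corresponding positions lie on the same side of the perimeter; between different sides the
  -- number of the side decides.
  have mono : ∀ a b a' b', Φ a a' → Φ b b' → a < b → a' < b' := by
    have node : ∀ p : Node n m, (ofLex (nodePos p)).1 = 0 ∨ (ofLex (nodePos p)).1 = 2 := by
      rintro (i | i) <;> simp [nodePos]
    rintro a b a' b' (⟨p, rfl, rfl⟩ | ⟨i, rfl, rfl⟩ | ⟨i, rfl, rfl⟩)
      (⟨q, rfl, rfl⟩ | ⟨j, rfl, rfl⟩ | ⟨j, rfl, rfl⟩) hab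
    · exact hν p q hab
    · have := node p
      rw [lex_lt_iff, hside]
      rw [lex_lt_iff] at hab
      simp only [topPos, ofLex_toLex] at hab ⊢
      omega
    · have := node p
      rw [lex_lt_iff, hside]
      rw [lex_lt_iff] at hab
      simp only [botPos, ofLex_toLex] at hab ⊢
      omega
    · have := node q
      rw [lex_lt_iff, hside]
      rw [lex_lt_iff] at hab
      simp only [topPos, ofLex_toLex] at hab ⊢
      omega
    · simpa [topPos, Prod.Lex.toLex_lt_toLex] using hab
    · simp [topPos, botPos, Prod.Lex.toLex_lt_toLex]
    · have := node q
      rw [lex_lt_iff, hside]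
      rw [lex_lt_iff] at hab
      simp only [botPos, ofLex_toLex] at hab ⊢
      omega
    · simp [topPos, botPos, Prod.Lex.toLex_lt_toLex] at hab
    · simpa [botPos, Prod.Lex.toLex_lt_toLex] using hab
  rintro a b c d hab hcd ⟨h1, h2, h3⟩
  obtain ⟨a', b', ha, hb, hs⟩ := hΦ a b hab
  obtain ⟨c', d', hc, hd, hs'⟩ := hΦ c d hcd
  exact hS a' b' c' d' hs hs' ⟨mono _ _ _ _ ha hc h1, mono _ _ _ _ hc hb h2, mono _ _ _ _ hb hd h3⟩

theorem nodup_reduceOption {α : Type*} {l : List (Option α)}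
    (h : ∀ (i j : ℕ) (a : α), l[i]? = some (some a) → l[j]? = some (some a) → i = j) :
    l.reduceOption.Nodup := by
  induction l with
  | nil => simp
  | cons b l ih =>
    have ih := ih fun i j a hi hj => Nat.succ_injective (h (i + 1) (j + 1) a (by simpa using hi)
      (by simpa using hj))
    cases b with
    | none => rwa [List.reduceOption_cons_of_none]
    | some b =>
      rw [List.reduceOption_cons_of_some, List.nodup_cons]
      refine ⟨fun hb => ?_, ih⟩
      obtain ⟨i, hi⟩ := List.mem_iff_getElem?.1 (List.reduceOption_mem_iff.1 hb)
      have := h 0 (i + 1) b (by simp) (by simpa using hi)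
      omega

end Map

section Concat

variable {n m k : ℕ} {x : Drawing n m} {y : Drawing m k}

theorem even_length_concatTop (hx : x.IsDiagram) (hy : y.IsDiagram) :
    Even (concatTop x y).length := by
  simpa [concatTop] using hx.even_top.add hy.even_top

theorem even_length_concatBot (hx : x.IsDiagram) (hy : y.IsDiagram) :
    Even (concatBot x y).length := by
  simpa [concatBot] using hx.even_bot.add hy.even_bot

theorem exists_rawEnd_of_remaining {l : List (Option (Vertex n m k))} {i : ℕ} {p : Node n k}
    (h : (l.map (remaining x y))[i]? = some (some p)) :
    ∃ v, l[i]? = some (some v) ∧ Joined x y v (vertexOuter p) := by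
  rw [List.getElem?_map, Option.map_eq_some_iff] at h
  obtain ⟨a, ha, h⟩ := h
  obtain ⟨v, rfl, hv⟩ := joined_of_remaining h
  exact ⟨v, ha, hv⟩

theorem concat_isDiagram (hx : x.IsDiagram) (hy : y.IsDiagram) (hc : Compatible x y) :
    (concat x y).IsDiagram := by
  obtain ⟨f, hf, -, -⟩ :=
    (cancels_cancelGhosts ((concatTop x y).map (remaining x y))).exists_orderEmbedding
  obtain ⟨g, hg, -, -⟩ :=
    (cancels_cancelGhosts ((concatBot x y).map (remaining x y))).exists_orderEmbedding
  have hT : ∀ {i p}, (concat x y).top[i]? = some (some p) →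
      ∃ v, RawEnd x y (topPos (f i)) v ∧ Joined x y v (vertexOuter p) := by
    intro i p h
    obtain ⟨v, hv, hj⟩ := exists_rawEnd_of_remaining ((hf i).symm.trans h)
    exact ⟨v, .top hv, hj⟩
  have hB : ∀ {i p}, (concat x y).bot[i]? = some (some p) →
      ∃ v, RawEnd x y (botPos (g i)) v ∧ Joined x y v (vertexOuter p) := by
    intro i p h
    obtain ⟨v, hv, hj⟩ := exists_rawEnd_of_remaining ((hg i).symm.trans h)
    exact ⟨v, .bot hv, hj⟩
  -- Two boundary entries leading to the same outer node would be the two ends of a boundary arc,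
  -- and such an arc meets no outer node.
  have same : ∀ {a b : ℕ ×ₗ ℤ} {v w : Vertex n m k} {p : Node n k}, RawEnd x y a v →
      RawEnd x y b w → (∀ p : Node n k, a ≠ nodePos p) → (∀ p : Node n k, b ≠ nodePos p) →
      Joined x y v (vertexOuter p) → Joined x y w (vertexOuter p) → a = b := by
    intro a b v w p ha hb hna hnb hv hw
    by_contra hne
    exact RawEnd.not_joined_outer hx hy hc ha hb hna hnb hne (hv.trans hw.symm) p hv
  have occ : ∀ {p}, OuterOccupied x y p → RawEnd x y (nodePos p) (vertexOuter p) := rawEnd_outer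
  refine ⟨fun p h => ((concat_partner hx hy hc).1 h).1 rfl, fun p q h => ?_, ?_, fun p hp => ?_,
    ?_, ?_, isChain_cancelGhosts _, isChain_cancelGhosts _, ?_⟩
  · rw [concat_partner hx hy hc] at h ⊢
    exact ⟨h.1.symm, h.2.symm⟩
  · rw [List.nodup_append]
    refine ⟨nodup_reduceOption fun i j p hi hj => ?_, nodup_reduceOption fun i j p hi hj => ?_,
      fun p hp q hq e => ?_⟩
    · obtain ⟨v, hv, hvp⟩ := hT hi
      obtain ⟨w, hw, hwp⟩ := hT hj
      simpa using same hv hw (by simp) (by simp) hvp hwp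
    · obtain ⟨v, hv, hvp⟩ := hB hi
      obtain ⟨w, hw, hwp⟩ := hB hj
      simpa using same hv hw (by simp) (by simp) hvp hwp
    · subst e
      obtain ⟨i, hi⟩ := List.mem_iff_getElem?.1 (List.reduceOption_mem_iff.1 hp)
      obtain ⟨j, hj⟩ := List.mem_iff_getElem?.1 (List.reduceOption_mem_iff.1 hq)
      obtain ⟨v, hv, hvp⟩ := hT hi
      obtain ⟨w, hw, hwp⟩ := hB hj
      simpa using same hv hw (by simp) (by simp) hvp hwp
  · obtain ⟨v, hv, hj⟩ := exists_of_mem_concat hp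
    by_contra hne
    obtain ⟨q, hqp, hq⟩ := concat_partner_ne_none.1 hne
    exact hqp (hv.outer_unique hx hy hc (hj.trans hq) hj)
  · exact (cancels_cancelGhosts _).even_length.2 (by simpa using even_length_concatTop hx hy)
  · exact (cancels_cancelGhosts _).even_length.2 (by simpa using even_length_concatBot hx hy)
  · refine Drawing.noncrossing_of_map (ν := nodePos) (f := f) (g := g)
      (S := fun a b => ∃ v w, RawEnd x y a v ∧ RawEnd x y b w ∧ Joined x y v w) (fun _ => rfl)
      (fun _ _ h => h) ?_ (fun p q h => ?_) (fun p i h => ?_) (fun p i h => ?_) ?_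
    · rintro a b ⟨v, w, hv, hw, h⟩
      exact ⟨w, v, hw, hv, h.symm⟩
    · have ho : ∀ {p q}, (concat x y).partner p = some q → RawEnd x y (nodePos p) (vertexOuter p) :=
        fun h => occ ((concat_occupied hx hy hc).1 (.inl (by simp [h])))
      have h' := (concat_partner hx hy hc).1 h
      have h'' := (concat_partner hx hy hc).2 ⟨h'.1.symm, h'.2.symm⟩
      exact ⟨_, _, ho h, ho h'', h'.2⟩
    · obtain ⟨v, hv, hj⟩ := hT h
      exact ⟨_, _, occ ((concat_occupied hx hy hc).1 (.inr (.inl (List.mem_of_getElem? h)))), hv,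
        hj.symm⟩
    · obtain ⟨v, hv, hj⟩ := hB h
      exact ⟨_, _, occ ((concat_occupied hx hy hc).1 (.inr (.inr (List.mem_of_getElem? h)))), hv,
        hj.symm⟩
    · rintro a b c d ⟨v, w, hv, hw, h⟩ ⟨u, t, hu, ht, h'⟩
      exact RawEnd.noncrossing hx hy hc hv hw hu ht h h'

theorem concat_ofKind {κ : Kind} (hx : x.OfKind κ) (hy : y.OfKind κ) (hc : Compatible x y) :
    (concat x y).OfKind κ where
  isDiagram := concat_isDiagram hx.isDiagram hy.isDiagram hc
  occupied h p := by
    rw [concat_occupied hx.isDiagram hy.isDiagram hc]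
    rcases p with i | j
    · exact hx.occupied h _
    · exact hy.occupied h _
  no_bot h p hp := by
    rw [some_mem_concat_bot, List.mem_map] at hp
    obtain ⟨a, ha, hp⟩ := hp
    obtain ⟨v, rfl, -⟩ := joined_of_remaining hp
    simp only [concatBot, List.mem_append, List.mem_map, Option.map_eq_some_iff] at ha
    rcases ha with ⟨_, ha, q, rfl, -⟩ | ⟨_, ha, q, rfl, -⟩
    · exact hx.no_bot h q ha
    · exact hy.no_bot h q ha

end Concat

end GhostAlg

namespace GhostAlg

/-! ## Associativity of concatenation -/

section Triple

variable {n m k l : ℕ}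

/-- The nodes of three rectangles drawn side by side. -/
abbrev Vertex₃ (n m k l : ℕ) : Type := Fin n ⊕ (Fin m ⊕ (Fin k ⊕ Fin l))

/-- The nodes of the first two rectangles. -/
def vertexLeft : Vertex n m k → Vertex₃ n m k l
  | Sum.inl i => Sum.inl i
  | Sum.inr (Sum.inl i) => Sum.inr (Sum.inl i)
  | Sum.inr (Sum.inr i) => Sum.inr (Sum.inr (Sum.inl i))

/-- The nodes of the last two rectangles. -/
def vertexRight : Vertex m k l → Vertex₃ n m k l := Sum.inr

/-- The nodes that remain when the first middle line has been removed. -/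
def vertexSkipFirst : Vertex n k l → Vertex₃ n m k l
  | Sum.inl i => Sum.inl i
  | Sum.inr i => Sum.inr (Sum.inr i)

/-- The nodes that remain when the second middle line has been removed. -/
def vertexSkipSecond : Vertex n m l → Vertex₃ n m k l
  | Sum.inl i => Sum.inl i
  | Sum.inr (Sum.inl i) => Sum.inr (Sum.inl i)
  | Sum.inr (Sum.inr i) => Sum.inr (Sum.inr (Sum.inr i))

variable (x : Drawing n m) (y : Drawing m k) (z : Drawing k l)

/-- Two nodes are connected by a string of one of the three drawings. -/
def Linked₃ (u v : Vertex₃ n m k l) : Prop :=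
  (∃ a b, Linked x y a b ∧ u = vertexLeft a ∧ v = vertexLeft b) ∨
    ∃ a b, Linked y z a b ∧ u = vertexRight a ∧ v = vertexRight b

/-- The picture of three drawings side by side. -/
def Picture.triple : Picture n l (Vertex₃ n m k l) where
  rel := Relation.EqvGen.setoid (Linked₃ x y z)
  out p := vertexSkipFirst (vertexOuter p)
  top := (concatTop x y).map (Option.map vertexLeft) ++
    z.top.map (Option.map fun p => vertexRight (vertexR p))
  bot := (concatBot x y).map (Option.map vertexLeft) ++
    z.bot.map (Option.map fun p => vertexRight (vertexR p))
  Closed v := (∃ j, v = Sum.inr (Sum.inl j) ∧ x.partner (Sum.inr j) ≠ none ∧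
      y.partner (Sum.inl j) ≠ none) ∨
    ∃ j, v = Sum.inr (Sum.inr (Sum.inl j)) ∧ y.partner (Sum.inr j) ≠ none ∧
      z.partner (Sum.inl j) ≠ none

variable {x y z}

theorem eqvGen_le {V : Type*} {r s : V → V → Prop} (hs : Equivalence s)
    (h : ∀ u v, r u v → s u v) {u v : V} (huv : Relation.EqvGen r u v) : s u v := by
  induction huv with
  | rel u v h' => exact h u v h'
  | refl u => exact hs.refl u
  | symm _ _ _ ih => exact hs.symm ih
  | trans _ _ _ _ _ ih ih' => exact hs.trans ih ih'

theorem equivalence_comap {V V' : Type*} {s : V → V → Prop} (hs : Equivalence s) (f : V' → V) :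
    Equivalence fun u v => s (f u) (f v) :=
  ⟨fun _ => hs.refl _, fun h => hs.symm h, fun h h' => hs.trans h h'⟩

theorem joined₃_equivalence : Equivalence (Relation.EqvGen (Linked₃ x y z)) :=
  Relation.EqvGen.is_equivalence _

theorem eqvGen_vertexLeft {u v : Vertex n m k} (h : Joined x y u v) :
    Relation.EqvGen (Linked₃ x y z) (vertexLeft u) (vertexLeft v) :=
  eqvGen_le (equivalence_comap joined₃_equivalence vertexLeft)
    (fun _ _ h => .rel _ _ (.inl ⟨_, _, h, rfl, rfl⟩)) h

theorem eqvGen_vertexRight {u v : Vertex m k l} (h : Joined y z u v) :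
    Relation.EqvGen (Linked₃ x y z) (vertexRight u) (vertexRight v) :=
  eqvGen_le (equivalence_comap joined₃_equivalence vertexRight)
    (fun _ _ h => .rel _ _ (.inr ⟨_, _, h, rfl, rfl⟩)) h

theorem vertexLeft_injective : Function.Injective (vertexLeft : Vertex n m k → Vertex₃ n m k l) := by
  rintro (i | i | i) (j | j | j) h <;> simp_all [vertexLeft]

theorem vertexSkipFirst_injective :
    Function.Injective (vertexSkipFirst : Vertex n k l → Vertex₃ n m k l) := by
  rintro (i | i) (j | j) h <;> simp_all [vertexSkipFirst]

theorem vertexSkipSecond_injective :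
    Function.Injective (vertexSkipSecond : Vertex n m l → Vertex₃ n m k l) := by
  rintro (i | i | i) (j | j | j) h <;> simp_all [vertexSkipSecond]

theorem vertexLeft_outer (p : Node n k) : (vertexLeft (vertexOuter p : Vertex n m k) :
    Vertex₃ n m k l) = vertexSkipFirst (vertexL p) := by
  rcases p with i | i <;> rfl

theorem vertexRight_outer (p : Node m l) : (vertexRight (vertexOuter p : Vertex m k l) :
    Vertex₃ n m k l) = vertexSkipSecond (vertexR p) := by
  rcases p with i | i <;> rfl

theorem vertexRight_R (p : Node k l) : (vertexRight (vertexR p : Vertex m k l) :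
    Vertex₃ n m k l) = vertexSkipFirst (vertexR p) := by
  rcases p with i | i <;> rfl

theorem vertexLeft_L (p : Node n m) : (vertexLeft (vertexL p : Vertex n m k) :
    Vertex₃ n m k l) = vertexSkipSecond (vertexL p) := by
  rcases p with i | i <;> rfl

theorem vertexLeft_R (p : Node m k) : (vertexLeft (vertexR p : Vertex n m k) :
    Vertex₃ n m k l) = vertexRight (vertexL p) := by
  rcases p with i | i <;> rfl

theorem vertexSkip_outer (p : Node n l) : (vertexSkipFirst (vertexOuter p : Vertex n k l) :
    Vertex₃ n m k l) = vertexSkipSecond (vertexOuter p) := by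
  rcases p with i | i <;> rfl

theorem joined_partner_concat (h : ∀ p q, (concat x y).partner p = some q →
      Joined x y (vertexOuter p) (vertexOuter q)) {u v : Vertex n k l}
    (huv : Joined (concat x y) z u v) :
    Relation.EqvGen (Linked₃ x y z) (vertexSkipFirst u) (vertexSkipFirst v) := by
  refine eqvGen_le (equivalence_comap joined₃_equivalence vertexSkipFirst) ?_ huv
  rintro _ _ (⟨p, q, hp, rfl, rfl⟩ | ⟨p, q, hp, rfl, rfl⟩)
  · rw [← vertexLeft_outer, ← vertexLeft_outer]
    exact eqvGen_vertexLeft (h p q hp)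
  · rw [← vertexRight_R, ← vertexRight_R]
    exact eqvGen_vertexRight (joined_right hp)

theorem joined_partner_concat' (h : ∀ p q, (concat y z).partner p = some q →
      Joined y z (vertexOuter p) (vertexOuter q)) {u v : Vertex n m l}
    (huv : Joined x (concat y z) u v) :
    Relation.EqvGen (Linked₃ x y z) (vertexSkipSecond u) (vertexSkipSecond v) := by
  refine eqvGen_le (equivalence_comap joined₃_equivalence vertexSkipSecond) ?_ huv
  rintro _ _ (⟨p, q, hp, rfl, rfl⟩ | ⟨p, q, hp, rfl, rfl⟩)
  · rw [← vertexLeft_L, ← vertexLeft_L]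
    exact eqvGen_vertexLeft (joined_left hp)
  · rw [← vertexRight_outer, ← vertexRight_outer]
    exact eqvGen_vertexRight (h p q hp)

/-- The first two of three drawings can be concatenated first. -/
noncomputable def contractionLeft (hx : x.IsDiagram) (hy : y.IsDiagram) (hc : Compatible x y) :
    Contraction (Picture.pair x y) (Picture.pair (concat x y) z) (Picture.triple x y z) where
  ι := vertexLeft
  e := vertexSkipFirst
  o := vertexL
  link u v := ∃ p q, z.partner p = some q ∧ u = vertexR p ∧ v = vertexR q
  topPre := []
  topSuf := z.top.map (Option.map vertexR)
  botPre := []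
  botSuf := z.bot.map (Option.map vertexR)
  inner := OuterPartner x y
  outer p := ∃ j, p = Sum.inr j ∧ z.partner (Sum.inl j) ≠ none
  ι_injective := vertexLeft_injective
  e_injective := vertexSkipFirst_injective
  ι_out := vertexLeft_outer
  eq_out := by
    rintro (i | i | i) (j | j | j) h <;> simp [vertexLeft, vertexSkipFirst] at h
    · subst h
      exact ⟨Sum.inl i, rfl, rfl⟩
    · subst h
      exact ⟨Sum.inr i, rfl, rfl⟩
  cover := by
    rintro (i | i | i | i)
    exacts [.inl ⟨Sum.inl i, rfl⟩, .inl ⟨Sum.inr (Sum.inl i), rfl⟩,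
      .inl ⟨Sum.inr (Sum.inr i), rfl⟩, .inr ⟨Sum.inr (Sum.inr i), rfl⟩]
  e_out _ := rfl
  rel_ι _ _ := eqvGen_vertexLeft
  rel_e _ _ := joined_partner_concat fun _ _ h => ((concat_partner hx hy hc).1 h).2
  rel_le s hs h1 h2 v w := eqvGen_le hs (by
    rintro _ _ (⟨a, b, h, rfl, rfl⟩ | ⟨a, b, ⟨p, q, h, rfl, rfl⟩ | ⟨p, q, h, rfl, rfl⟩, rfl, rfl⟩)
    · exact h1 _ _ (.rel _ _ h)
    · rw [← vertexLeft_R, ← vertexLeft_R]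
      exact h1 _ _ (joined_right h)
    · rw [vertexRight_R, vertexRight_R]
      exact h2 _ _ ⟨p, q, h, rfl, rfl⟩)
  rel_link := by
    rintro _ _ ⟨p, q, h, rfl, rfl⟩
    exact joined_right h
  rel_out p q h := by
    by_cases hpq : q = p
    · rw [hpq]
    · exact joined_left ((concat_partner hx hy hc).2 ⟨hpq, h⟩)
  top_eq := by
    simp only [Picture.triple, Picture.pair, List.map_nil, List.nil_append, List.map_map]
    congr 2
    funext p
    cases p <;> simp [vertexRight_R]
  bot_eq := by
    simp only [Picture.triple, Picture.pair, List.map_nil, List.nil_append, List.map_map]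
    congr 2
    funext p
    cases p <;> simp [vertexRight_R]
  top_eq' := by
    rw [Picture.drawing_pair]
    rfl
  bot_eq' := by
    rw [Picture.drawing_pair]
    rfl
  even_topPre := by simp
  even_botPre := by simp
  closed_ι := by
    intro v hv
    rcases vertex_cases v with ⟨p, rfl⟩ | ⟨j, rfl⟩
    · exact absurd rfl (hv p)
    · simp [Picture.triple, Picture.pair, vertexLeft, vertexM]
  closed_e := by
    rintro (i | i | i) hu
    · exact absurd rfl (hu (Sum.inl i))
    · exact absurd rfl (hu (Sum.inr i))
    · simp [Picture.triple, Picture.pair, vertexSkipFirst, vertexM]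
  closed_o := by
    rintro (i | i) <;> simp [Picture.triple, vertexSkipFirst, vertexL, OuterPartner]
  closed_o' := by
    rw [Picture.drawing_pair]
    rintro (i | i) <;> simp [Picture.pair, vertexL, vertexM]
  not_closed_out := by
    rintro p ⟨j, hj, -⟩
    exact vertexOuter_ne_middle hj
  partner_ne_none p := by
    rw [Picture.drawing_pair]
    exact concat_partner_ne_none_iff_forall hx hy hc
  arc_top i j v v' hij hi hj h p := RawEnd.not_joined_outer hx hy hc (.top hi) (.top hj)
    (by simp) (by simp) (by simpa using hij.ne) h p
  arc_bot i j v v' hij hi hj h p := RawEnd.not_joined_outer hx hy hc (.bot hi) (.bot hj)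
    (by simp) (by simp) (by simpa using hij.ne) h p
  arc_cross i j v v' hi hj h p := RawEnd.not_joined_outer hx hy hc (.top hi) (.bot hj)
    (by simp) (by simp) (by simp) h p

/-- The last two of three drawings can be concatenated first. -/
noncomputable def contractionRight (hx : x.IsDiagram) (hy : y.IsDiagram) (hz : z.IsDiagram)
    (hc : Compatible y z) :
    Contraction (Picture.pair y z) (Picture.pair x (concat y z)) (Picture.triple x y z) where
  ι := vertexRight
  e := vertexSkipSecond
  o := vertexR
  link u v := ∃ p q, x.partner p = some q ∧ u = vertexL p ∧ v = vertexL q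
  topPre := x.top.map (Option.map vertexL)
  topSuf := []
  botPre := x.bot.map (Option.map vertexL)
  botSuf := []
  inner := OuterPartner y z
  outer p := ∃ j, p = Sum.inl j ∧ x.partner (Sum.inr j) ≠ none
  ι_injective := Sum.inr_injective
  e_injective := vertexSkipSecond_injective
  ι_out := vertexRight_outer
  eq_out := by
    rintro (i | i | i) (j | j | j) h <;> simp [vertexRight, vertexSkipSecond] at h
    · subst h
      exact ⟨Sum.inl i, rfl, rfl⟩
    · subst h
      exact ⟨Sum.inr i, rfl, rfl⟩
  cover := by
    rintro (i | i)
    exacts [.inr ⟨Sum.inl i, rfl⟩, .inl ⟨i, rfl⟩]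
  e_out p := vertexSkip_outer p
  rel_ι _ _ := eqvGen_vertexRight
  rel_e _ _ := joined_partner_concat' fun _ _ h => ((concat_partner hy hz hc).1 h).2
  rel_le s hs h1 h2 v w := eqvGen_le hs (by
    rintro _ _ (⟨a, b, ⟨p, q, h, rfl, rfl⟩ | ⟨p, q, h, rfl, rfl⟩, rfl, rfl⟩ | ⟨a, b, h, rfl, rfl⟩)
    · rw [vertexLeft_L, vertexLeft_L]
      exact h2 _ _ ⟨p, q, h, rfl, rfl⟩
    · rw [vertexLeft_R, vertexLeft_R]
      exact h1 _ _ (joined_left h)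
    · exact h1 _ _ (.rel _ _ h))
  rel_link := by
    rintro _ _ ⟨p, q, h, rfl, rfl⟩
    exact joined_left h
  rel_out p q h := by
    by_cases hpq : q = p
    · rw [hpq]
    · exact joined_right ((concat_partner hy hz hc).2 ⟨hpq, h⟩)
  top_eq := by
    have e₁ : (vertexLeft ∘ vertexL : Node n m → Vertex₃ n m k l) = vertexSkipSecond ∘ vertexL :=
      funext vertexLeft_L
    have e₂ : (vertexLeft ∘ vertexR : Node m k → Vertex₃ n m k l) = vertexRight ∘ vertexL :=
      funext vertexLeft_R
    simp only [Picture.triple, Picture.pair, concatTop, List.map_nil, List.append_nil,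
      List.map_append, List.map_map, List.append_assoc, Option.map_comp_map, e₁, e₂]
    rfl
  bot_eq := by
    have e₁ : (vertexLeft ∘ vertexL : Node n m → Vertex₃ n m k l) = vertexSkipSecond ∘ vertexL :=
      funext vertexLeft_L
    have e₂ : (vertexLeft ∘ vertexR : Node m k → Vertex₃ n m k l) = vertexRight ∘ vertexL :=
      funext vertexLeft_R
    simp only [Picture.triple, Picture.pair, concatBot, List.map_nil, List.append_nil,
      List.map_append, List.map_map, List.append_assoc, Option.map_comp_map, e₁, e₂]
    rfl
  top_eq' := by
    rw [Picture.drawing_pair]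
    simp [Picture.pair, concatTop]
  bot_eq' := by
    rw [Picture.drawing_pair]
    simp [Picture.pair, concatBot]
  -- The entries of `x` precede those of `y` and `z`. Since they are even in number, the arcs of the
  -- right part keep their parities.
  even_topPre := by simpa using hx.even_top
  even_botPre := by simpa using hx.even_bot
  closed_ι := by
    intro v hv
    rcases vertex_cases v with ⟨p, rfl⟩ | ⟨j, rfl⟩
    · exact absurd rfl (hv p)
    · simp [Picture.triple, Picture.pair, vertexRight, vertexM]
  closed_e := by
    rintro (i | i | i) hu
    · simp [Picture.triple, Picture.pair, vertexSkipSecond, vertexM]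
    · exact absurd rfl (hu (Sum.inl i))
    · exact absurd rfl (hu (Sum.inr i))
  closed_o := by
    rintro (i | i) <;> simp [Picture.triple, vertexSkipSecond, vertexR, OuterPartner, and_comm]
  closed_o' := by
    rw [Picture.drawing_pair]
    rintro (i | i) <;> simp [Picture.pair, vertexR, vertexM, and_comm]
  not_closed_out := by
    rintro p ⟨j, hj, -⟩
    exact vertexOuter_ne_middle hj
  partner_ne_none p := by
    rw [Picture.drawing_pair]
    exact concat_partner_ne_none_iff_forall hy hz hc
  arc_top i j v v' hij hi hj h p := RawEnd.not_joined_outer hy hz hc (.top hi) (.top hj)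
    (by simp) (by simp) (by simpa using hij.ne) h p
  arc_bot i j v v' hij hi hj h p := RawEnd.not_joined_outer hy hz hc (.bot hi) (.bot hj)
    (by simp) (by simp) (by simpa using hij.ne) h p
  arc_cross i j v v' hi hj h p := RawEnd.not_joined_outer hy hz hc (.top hi) (.bot hj)
    (by simp) (by simp) (by simp) h p

/-- Both sides are the drawing of the picture of three rectangles, simplified in a different order.
-/
theorem concat_assoc (hx : x.IsDiagram) (hy : y.IsDiagram) (hz : z.IsDiagram)
    (hxy : Compatible x y) (hyz : Compatible y z) :
    concat (concat x y) z = concat x (concat y z) := by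
  rw [← Picture.drawing_pair (concat x y) z, ← Picture.drawing_pair x (concat y z),
    ← (contractionLeft hx hy hxy).drawing_eq, (contractionRight hx hy hz hyz).drawing_eq]

/-- Both sides are the weight of the picture of three rectangles, in which every loop and arc is
counted at the stage at which it is removed. -/
theorem weight_assoc {R : Type*} [CommRing R] (P : Params R) (hx : x.IsDiagram)
    (hy : y.IsDiagram) (hz : z.IsDiagram) (hxy : Compatible x y) (hyz : Compatible y z) :
    weight P x y * weight P (concat x y) z = weight P y z * weight P x (concat y z) := by
  simp only [← Picture.weight_pair]
  rw [← (contractionLeft hx hy hxy).weight_eq, (contractionRight hx hy hz hyz).weight_eq]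

theorem compatible_concat_left (hx : x.IsDiagram) (hy : y.IsDiagram) (hxy : Compatible x y) :
    Compatible (concat x y) z ↔ Compatible y z :=
  forall_congr' fun _ => iff_congr (concat_occupied hx hy hxy) Iff.rfl

theorem compatible_concat_right (hy : y.IsDiagram) (hz : z.IsDiagram) (hyz : Compatible y z) :
    Compatible x (concat y z) ↔ Compatible x y :=
  forall_congr' fun _ => iff_congr Iff.rfl (concat_occupied hy hz hyz)

end Triple

end GhostAlg

namespace GhostAlg

/-! ## Reflection -/

section Reflect

variable {n m k : ℕ}

theorem getElem?_reverse_eq_some {α : Type*} {l : List α} {i : ℕ} {a : α} :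
    l.reverse[i]? = some a ↔ i < l.length ∧ l[l.length - 1 - i]? = some a := by
  constructor
  · intro h
    have hi : i < l.length := by simpa using (List.getElem?_eq_some_iff.1 h).1
    exact ⟨hi, by rwa [List.getElem?_reverse hi] at h⟩
  · rintro ⟨hi, h⟩
    rwa [List.getElem?_reverse hi]

theorem getElem?_reflect_list {α β : Type*} {φ : α → β} {l : List (Option α)} {i : ℕ} {b : β} :
    (l.reverse.map (Option.map φ))[i]? = some (some b) ↔
      i < l.length ∧ ∃ a, l[l.length - 1 - i]? = some (some a) ∧ φ a = b := by
  simp only [List.getElem?_map, Option.map_eq_some_iff, getElem?_reverse_eq_some]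
  constructor
  · rintro ⟨_, ⟨hi, h⟩, a, rfl, e⟩
    exact ⟨hi, a, h, e⟩
  · rintro ⟨hi, a, h, e⟩
    exact ⟨_, ⟨hi, h⟩, a, rfl, e⟩

namespace Drawing

variable {D : Drawing n m}

theorem reflect_reflect (D : Drawing n m) : D.reflect.reflect = D := by
  ext1
  · funext p
    simp [reflect]
  · simp [reflect]
  · simp [reflect]

theorem reflect_partner {p q : Node m n} :
    D.reflect.partner p = some q ↔ D.partner p.swap = some q.swap := by
  simp only [reflect, Option.map_eq_some_iff]
  constructor
  · rintro ⟨r, h, rfl⟩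
    simpa using h
  · intro h
    exact ⟨_, h, by simp⟩

theorem some_mem_reflect_top {p : Node m n} : some p ∈ D.reflect.top ↔ some p.swap ∈ D.top := by
  simp only [reflect, List.mem_map, List.mem_reverse, Option.map_eq_some_iff]
  constructor
  · rintro ⟨_, h, q, rfl, rfl⟩
    simpa using h
  · intro h
    exact ⟨_, h, _, rfl, by simp⟩

theorem some_mem_reflect_bot {p : Node m n} : some p ∈ D.reflect.bot ↔ some p.swap ∈ D.bot := by
  simp only [reflect, List.mem_map, List.mem_reverse, Option.map_eq_some_iff]
  constructor
  · rintro ⟨_, h, q, rfl, rfl⟩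
    simpa using h
  · intro h
    exact ⟨_, h, _, rfl, by simp⟩

theorem reflect_occupied {p : Node m n} : D.reflect.Occupied p ↔ D.Occupied p.swap := by
  rw [Occupied, Occupied, some_mem_reflect_top, some_mem_reflect_bot]
  simp [reflect]

theorem isChain_reflect {α β : Type*} {φ : α → β} {l : List (Option α)}
    (h : l.IsChain fun a b => a ≠ none ∨ b ≠ none) :
    (l.reverse.map (Option.map φ)).IsChain fun a b => a ≠ none ∨ b ≠ none := by
  rw [List.isChain_map, List.isChain_reverse]
  refine h.imp fun a b h => ?_
  cases a <;> cases b <;> simp_all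

/-- The positions `a` of the reflection and `a'` of the drawing correspond to each other. -/
inductive ReflectPos (D : Drawing n m) : ℕ ×ₗ ℤ → ℕ ×ₗ ℤ → Prop
  | node (p : Node m n) : ReflectPos D (nodePos p) (nodePos p.swap)
  | top {i : ℕ} (h : i < D.top.length) : ReflectPos D (topPos i) (topPos (D.top.length - 1 - i))
  | bot {i : ℕ} (h : i < D.bot.length) : ReflectPos D (botPos i) (botPos (D.bot.length - 1 - i))

/-- Reflection reverses the order along left, top and right, and also along the bottom, but the
bottom still comes last. The perimeter order is thus reversed up to a rotation. -/
theorem ReflectPos.lt_iff {a b a' b' : ℕ ×ₗ ℤ} (ha : D.ReflectPos a a') (hb : D.ReflectPos b b')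
    (hab : a < b) : a' ≠ b' ∧ (a' < b' ↔ (ofLex a).1 ≠ 3 ∧ (ofLex b).1 = 3) := by
  have key : (ofLex a').1 ≠ (ofLex b').1 ∨ (ofLex a').2 ≠ (ofLex b').2 → a' ≠ b' := by
    rintro h rfl
    simp at h
  rw [lex_lt_iff] at hab ⊢
  suffices h : ((ofLex a').1 ≠ (ofLex b').1 ∨ (ofLex a').2 ≠ (ofLex b').2) ∧
      (((ofLex a').1 < (ofLex b').1 ∨ (ofLex a').1 = (ofLex b').1 ∧ (ofLex a').2 < (ofLex b').2) ↔
        (ofLex a).1 ≠ 3 ∧ (ofLex b).1 = 3) from ⟨key h.1, h.2⟩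
  clear key
  cases ha with
  | node p =>
    cases hb with
    | node q =>
      rcases p with i | i <;> rcases q with j | j <;> simp [nodePos] at hab ⊢ <;> omega
    | top hj => rcases p with i | i <;> simp [nodePos, topPos] at hab ⊢
    | bot hj => rcases p with i | i <;> simp [nodePos, botPos] at hab ⊢
  | top hi =>
    cases hb with
    | node q => rcases q with i | i <;> simp [nodePos, topPos] at hab ⊢
    | top hj =>
      simp [topPos] at hab ⊢
      omega
    | bot hj => simp [topPos, botPos] at hab ⊢
  | bot hi =>
    cases hb with
    | node q => rcases q with i | i <;> simp [nodePos, botPos] at hab ⊢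
    | top hj => simp [topPos, botPos] at hab ⊢
    | bot hj =>
      simp [botPos] at hab ⊢
      omega

theorem exists_reflectPos {a b : ℕ ×ₗ ℤ} (h : D.reflect.IsString a b) :
    ∃ a' b', D.ReflectPos a a' ∧ D.ReflectPos b b' ∧ D.IsString a' b' := by
  induction h with
  | @node p q h => exact ⟨_, _, .node p, .node q, .node (reflect_partner.1 h)⟩
  | @top _ i h =>
    obtain ⟨hi, q, h', rfl⟩ := getElem?_reflect_list.1 h
    exact ⟨_, _, .node _, .top hi, .top (by simpa using h')⟩
  | @bot _ i h =>
    obtain ⟨hi, q, h', rfl⟩ := getElem?_reflect_list.1 h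
    exact ⟨_, _, .node _, .bot hi, .bot (by simpa using h')⟩
  | symm _ ih =>
    obtain ⟨a', b', h1, h2, h3⟩ := ih
    exact ⟨b', a', h2, h1, h3.symm⟩

theorem reflect_isDiagram (hD : D.IsDiagram) : D.reflect.IsDiagram where
  partner_ne p h := hD.partner_ne _ (reflect_partner.1 h)
  partner_symm p q h := reflect_partner.2 (hD.partner_symm _ _ (reflect_partner.1 h))
  ends_nodup := by
    rw [List.nodup_append]
    refine ⟨nodup_reduceOption fun i j p hi hj => ?_, nodup_reduceOption fun i j p hi hj => ?_,
      fun p hp q hq e => ?_⟩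
    · obtain ⟨ki, p, hi', rfl⟩ := getElem?_reflect_list.1 hi
      obtain ⟨kj, q, hj', e⟩ := getElem?_reflect_list.1 hj
      rw [Sum.swap_leftInverse.injective e] at hj'
      have := hD.top_unique hi' hj'
      omega
    · obtain ⟨ki, p, hi', rfl⟩ := getElem?_reflect_list.1 hi
      obtain ⟨kj, q, hj', e⟩ := getElem?_reflect_list.1 hj
      rw [Sum.swap_leftInverse.injective e] at hj'
      have := hD.bot_unique hi' hj'
      omega
    · subst e
      rw [List.reduceOption_mem_iff] at hp hq
      exact hD.not_top_and_bot (some_mem_reflect_top.1 hp) (some_mem_reflect_bot.1 hq)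
  partner_eq_none p h := by
    rw [some_mem_reflect_top, some_mem_reflect_bot] at h
    simp [reflect, hD.partner_eq_none _ h]
  even_top := by simpa [reflect] using hD.even_top
  even_bot := by simpa [reflect] using hD.even_bot
  reduced_top := isChain_reflect hD.reduced_top
  reduced_bot := isChain_reflect hD.reduced_bot
  noncrossing := by
    rintro a b c d hab hcd ⟨h1, h2, h3⟩
    obtain ⟨a', b', ha, hb, hab'⟩ := exists_reflectPos hab
    obtain ⟨c', d', hc, hd, hcd'⟩ := exists_reflectPos hcd
    have k1 := ha.lt_iff hc h1
    have k2 := hc.lt_iff hb h2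
    have k3 := hb.lt_iff hd h3
    have k4 := ha.lt_iff hd (h1.trans (h2.trans h3))
    -- Unlike `noncrossing`, the symmetric form of planarity is insensitive to the order in which
    -- the ends of each string are listed, which the reversal changes.
    have k := hD.not_separated hab' hcd' k1.1.symm k2.1 k4.1.symm k3.1.symm
    have k5 : b' < c' ↔ ¬ c' < b' :=
      ⟨fun h => h.not_gt, fun h => lt_of_le_of_ne (not_lt.1 h) k2.1.symm⟩
    rw [k1.2, k5, k2.2, k3.2, k4.2] at k
    have le : ∀ {a a' : ℕ ×ₗ ℤ}, D.ReflectPos a a' → (ofLex a).1 ≤ 3 := by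
      rintro _ _ (p | _ | _)
      · rcases p with i | i <;> simp [nodePos]
      · simp [topPos]
      · simp [botPos]
    have l1 := le hb
    have l2 := le hd
    have l3 := le hc
    rw [lex_lt_iff] at h1 h2 h3
    omega

theorem reflect_ofKind {κ : Kind} (hD : D.OfKind κ) : D.reflect.OfKind κ where
  isDiagram := reflect_isDiagram hD.isDiagram
  occupied h _ := reflect_occupied.2 (hD.occupied h _)
  no_bot h _ hp := hD.no_bot h _ (some_mem_reflect_bot.1 hp)

end Drawing

open Drawing

/-- The reflection of the nodes of two rectangles. -/
def vertexSwap : Vertex n m k → Vertex k m n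
  | Sum.inl i => Sum.inr (Sum.inr i)
  | Sum.inr (Sum.inl i) => Sum.inr (Sum.inl i)
  | Sum.inr (Sum.inr i) => Sum.inl i

@[simp]
theorem vertexSwap_vertexSwap (v : Vertex n m k) : vertexSwap (vertexSwap v) = v := by
  rcases v with i | i | i <;> rfl

theorem vertexSwap_injective : Function.Injective (vertexSwap : Vertex n m k → Vertex k m n) :=
  Function.LeftInverse.injective vertexSwap_vertexSwap

theorem vertexSwap_L (p : Node n m) :
    vertexSwap (vertexL p : Vertex n m k) = vertexR p.swap := by
  rcases p with i | i <;> rfl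

theorem vertexSwap_R (p : Node m k) :
    vertexSwap (vertexR p : Vertex n m k) = vertexL p.swap := by
  rcases p with i | i <;> rfl

theorem vertexSwap_outer (p : Node n k) :
    vertexSwap (vertexOuter p : Vertex n m k) = vertexOuter p.swap := by
  rcases p with i | i <;> rfl

variable {x : Drawing n m} {y : Drawing m k}

theorem compatible_reflect : Compatible y.reflect x.reflect ↔ Compatible x y :=
  forall_congr' fun _ => (iff_congr reflect_occupied reflect_occupied).trans Iff.comm

theorem joined_reflect_of_joined {u v : Vertex n m k} (h : Joined x y u v) :
    Joined y.reflect x.reflect (vertexSwap u) (vertexSwap v) := by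
  refine eqvGen_le (equivalence_comap joined_equivalence vertexSwap) ?_ h
  rintro _ _ (⟨p, q, h, rfl, rfl⟩ | ⟨p, q, h, rfl, rfl⟩)
  · rw [vertexSwap_L, vertexSwap_L]
    exact joined_right (reflect_partner.2 (by simpa using h))
  · rw [vertexSwap_R, vertexSwap_R]
    exact joined_left (reflect_partner.2 (by simpa using h))

theorem joined_reflect {u v : Vertex n m k} :
    Joined y.reflect x.reflect (vertexSwap u) (vertexSwap v) ↔ Joined x y u v :=
  ⟨fun h => by simpa [reflect_reflect] using joined_reflect_of_joined h, joined_reflect_of_joined⟩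

theorem concatTop_reflect : concatTop y.reflect x.reflect =
    (concatTop x y).reverse.map (Option.map vertexSwap) := by
  have e₁ : (vertexSwap ∘ vertexL : Node n m → Vertex k m n) = vertexR ∘ Sum.swap :=
    funext vertexSwap_L
  have e₂ : (vertexSwap ∘ vertexR : Node m k → Vertex k m n) = vertexL ∘ Sum.swap :=
    funext vertexSwap_R
  simp only [concatTop, reflect, List.reverse_append, List.map_append, List.map_map,
    ← List.map_reverse, Option.map_comp_map, e₁, e₂]

theorem concatBot_reflect : concatBot y.reflect x.reflect =
    (concatBot x y).reverse.map (Option.map vertexSwap) := by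
  have e₁ : (vertexSwap ∘ vertexL : Node n m → Vertex k m n) = vertexR ∘ Sum.swap :=
    funext vertexSwap_L
  have e₂ : (vertexSwap ∘ vertexR : Node m k → Vertex k m n) = vertexL ∘ Sum.swap :=
    funext vertexSwap_R
  simp only [concatBot, reflect, List.reverse_append, List.map_append, List.map_map,
    ← List.map_reverse, Option.map_comp_map, e₁, e₂]

/-- The outer node chosen by `remaining` is unique for actual boundary entries, so the choice
commutes with reflection there. -/
theorem remaining_reflect (hx : x.IsDiagram) (hy : y.IsDiagram) (hc : Compatible x y)
    {a : Option (Vertex n m k)} (ha : a ∈ concatTop x y ∨ a ∈ concatBot x y) :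
    remaining y.reflect x.reflect (a.map vertexSwap) = (remaining x y a).map Sum.swap := by
  cases a with
  | none => rfl
  | some v =>
    have hv := entryAt_of_mem ha
    have hv' : EntryAt y.reflect x.reflect (vertexSwap v) := by
      refine entryAt_of_mem ?_
      rw [concatTop_reflect, concatBot_reflect]
      simp only [List.mem_map, List.mem_reverse]
      exact ha.imp (fun h => ⟨_, h, rfl⟩) fun h => ⟨_, h, rfl⟩
    ext p
    rw [Option.map_some, remaining_eq_some (reflect_isDiagram hy) (reflect_isDiagram hx)
      (compatible_reflect.2 hc) hv', Option.map_eq_some_iff]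
    have e : (vertexOuter p : Vertex k m n) = vertexSwap (vertexOuter p.swap) := by
      rw [vertexSwap_outer, Sum.swap_swap]
    rw [e, joined_reflect]
    constructor
    · intro h
      exact ⟨p.swap, (remaining_eq_some hx hy hc hv).2 h, by simp⟩
    · rintro ⟨q, h, rfl⟩
      simpa using (remaining_eq_some hx hy hc hv).1 h

theorem concat_reflect (hx : x.IsDiagram) (hy : y.IsDiagram) (hc : Compatible x y) :
    (concat x y).reflect = concat y.reflect x.reflect := by
  have hr := reflect_isDiagram (concat_isDiagram hx hy hc)
  have list : ∀ l : List (Option (Vertex n m k)),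
      (∀ a ∈ l, remaining y.reflect x.reflect (a.map vertexSwap) =
        (remaining x y a).map Sum.swap) →
      ((cancelGhosts (l.map (remaining x y))).reverse.map (Option.map Sum.swap)).IsChain
        (fun a b => a ≠ none ∨ b ≠ none) →
      (cancelGhosts (l.map (remaining x y))).reverse.map (Option.map Sum.swap) =
        cancelGhosts ((l.reverse.map (Option.map vertexSwap)).map
          (remaining y.reflect x.reflect)) := by
    intro l hl hch
    have e : (l.reverse.map (Option.map vertexSwap)).map (remaining y.reflect x.reflect) =
        (l.map (remaining x y)).reverse.map (Option.map Sum.swap) := by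
      rw [← List.map_reverse, List.map_map, List.map_map]
      exact List.map_congr_left fun a ha => hl a (List.mem_reverse.1 ha)
    rw [e]
    -- The recursion of `cancelGhosts` is not symmetric under reversal, but the reversed list is
    -- reduced and reduced forms are unique.
    exact (((cancels_cancelGhosts _).reverse.map (Option.map Sum.swap) rfl).eq_cancelGhosts
      hch).symm
  ext1
  · funext p
    ext q
    rw [reflect_partner, concat_partner hx hy hc, concat_partner (reflect_isDiagram hy)
      (reflect_isDiagram hx) (compatible_reflect.2 hc), ← joined_reflect, vertexSwap_outer,
      vertexSwap_outer, Sum.swap_swap, Sum.swap_swap]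
    exact and_congr_left fun _ => (Sum.swap_leftInverse.injective.ne_iff)
  · change _ = cancelGhosts ((concatTop y.reflect x.reflect).map (remaining y.reflect x.reflect))
    rw [concatTop_reflect]
    exact list _ (fun a ha => remaining_reflect hx hy hc (.inl ha)) hr.reduced_top
  · change _ = cancelGhosts ((concatBot y.reflect x.reflect).map (remaining y.reflect x.reflect))
    rw [concatBot_reflect]
    exact list _ (fun a ha => remaining_reflect hx hy hc (.inr ha)) hr.reduced_bot

/-- Reflection exchanges the left and the right end of an arc on one boundary, hence `P'` and `Q'`
change places. The reverse inequality comes from reflecting twice. -/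
theorem ncard_arcs_lt_le {V V' : Type} {r : V → V → Prop} {r' : V' → V' → Prop} {φ : V → V'}
    (hr : ∀ u v, r u v → r' (φ v) (φ u)) {W : List (Option V)} {P Q P' Q' : ℕ → Prop}
    (hP : ∀ i < W.length, P (i + 1) → P' (W.length - 1 - i + 1))
    (hQ : ∀ i < W.length, Q (i + 1) → Q' (W.length - 1 - i + 1)) :
    (arcs r (· < ·) W W P Q).ncard ≤ (arcs r' (· < ·) (W.reverse.map (Option.map φ))
      (W.reverse.map (Option.map φ)) Q' P').ncard := by
  refine Set.ncard_le_ncard_of_injOn (fun e => (W.length - 1 - e.2, W.length - 1 - e.1)) ?_ ?_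
    (finite_arcs ..)
  · rintro ⟨i, j⟩ ⟨ht, ⟨u, v, hu, hv, h⟩, hp, hq⟩
    have hi := (List.getElem?_eq_some_iff.1 hu).1
    have hj := (List.getElem?_eq_some_iff.1 hv).1
    dsimp only at ht hu hv hp hq hi hj
    refine ⟨by dsimp only; omega, ⟨φ v, φ u, getElem?_reflect_list.2 ⟨by omega, v, ?_, rfl⟩,
      getElem?_reflect_list.2 ⟨by omega, u, ?_, rfl⟩, hr u v h⟩, hQ j hj hq, hP i hi hp⟩
    · rwa [show W.length - 1 - (W.length - 1 - j) = j by omega]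
    · rwa [show W.length - 1 - (W.length - 1 - i) = i by omega]
  · rintro ⟨i, j⟩ ⟨-, ⟨u, v, hu, hv, -⟩, -⟩ ⟨i', j'⟩ ⟨-, ⟨u', v', hu', hv', -⟩, -⟩ e
    have hi := (List.getElem?_eq_some_iff.1 hu).1
    have hj := (List.getElem?_eq_some_iff.1 hv).1
    have hi' := (List.getElem?_eq_some_iff.1 hu').1
    have hj' := (List.getElem?_eq_some_iff.1 hv').1
    simp only [Prod.mk.injEq] at e hi hj hi' hj' ⊢
    omega

theorem ncard_arcs_cross_le {V V' : Type} {r : V → V → Prop} {r' : V' → V' → Prop} {φ : V → V'}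
    (hr : ∀ u v, r u v → r' (φ u) (φ v)) {W W' : List (Option V)} {P Q P' Q' : ℕ → Prop}
    (hP : ∀ i < W.length, P (i + 1) → P' (W.length - 1 - i + 1))
    (hQ : ∀ i < W'.length, Q (i + 1) → Q' (W'.length - 1 - i + 1)) :
    (arcs r (fun _ _ => True) W W' P Q).ncard ≤
      (arcs r' (fun _ _ => True) (W.reverse.map (Option.map φ))
        (W'.reverse.map (Option.map φ)) P' Q').ncard := by
  refine Set.ncard_le_ncard_of_injOn (fun e => (W.length - 1 - e.1, W'.length - 1 - e.2)) ?_ ?_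
    (finite_arcs ..)
  · rintro ⟨i, j⟩ ⟨-, ⟨u, v, hu, hv, h⟩, hp, hq⟩
    have hi := (List.getElem?_eq_some_iff.1 hu).1
    have hj := (List.getElem?_eq_some_iff.1 hv).1
    dsimp only at hu hv hp hq hi hj
    refine ⟨trivial, ⟨φ u, φ v, getElem?_reflect_list.2 ⟨by omega, u, ?_, rfl⟩,
      getElem?_reflect_list.2 ⟨by omega, v, ?_, rfl⟩, hr u v h⟩, hP i hi hp, hQ j hj hq⟩
    · rwa [show W.length - 1 - (W.length - 1 - i) = i by omega]
    · rwa [show W'.length - 1 - (W'.length - 1 - j) = j by omega]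
  · rintro ⟨i, j⟩ ⟨-, ⟨u, v, hu, hv, -⟩, -⟩ ⟨i', j'⟩ ⟨-, ⟨u', v', hu', hv', -⟩, -⟩ e
    have hi := (List.getElem?_eq_some_iff.1 hu).1
    have hj := (List.getElem?_eq_some_iff.1 hv).1
    have hi' := (List.getElem?_eq_some_iff.1 hu').1
    have hj' := (List.getElem?_eq_some_iff.1 hv').1
    simp only [Prod.mk.injEq] at e hi hj hi' hj' ⊢
    omega

theorem ncard_loops_reflect_le :
    (Picture.pair x y).loops.ncard ≤ (Picture.pair y.reflect x.reflect).loops.ncard := by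
  refine Set.ncard_le_ncard_of_injOn (fun C => vertexSwap '' C) ?_
    (vertexSwap_injective.image_injective.injOn) (Set.toFinite _)
  rintro _ ⟨v, rfl, hv⟩
  refine ⟨vertexSwap v, ?_, ?_⟩
  · ext w
    constructor
    · rintro ⟨u, hu, rfl⟩
      exact joined_reflect_of_joined hu
    · intro hw
      refine ⟨vertexSwap w, ?_, by simp⟩
      exact joined_reflect.1 (by rw [vertexSwap_vertexSwap]; exact hw)
  · rintro _ ⟨u, hu, rfl⟩
    obtain ⟨j, rfl, h1, h2⟩ := hv u hu
    exact ⟨j, rfl, by simpa [reflect] using h2, by simpa [reflect] using h1⟩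

/-- `Q` is the property that a number has if its predecessor has the parity property `P`. -/
def IsFlip (P Q : ℕ → Prop) : Prop := P = Odd ∧ Q = Even ∨ P = Even ∧ Q = Odd

theorem IsFlip.symm {P Q : ℕ → Prop} (h : IsFlip P Q) : IsFlip Q P :=
  Or.symm (h.imp And.symm And.symm)

/-- Reversing a list of even length `L` turns the number `i + 1` into `L - i`, which has the other
parity. -/
theorem IsFlip.imp {P Q : ℕ → Prop} (h : IsFlip P Q) {L : ℕ} (hL : Even L) :
    ∀ i < L, P (i + 1) → Q (L - 1 - i + 1) := by
  rintro i hi hp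
  obtain ⟨s, rfl⟩ := hL
  rcases h with ⟨rfl, rfl⟩ | ⟨rfl, rfl⟩
  · obtain ⟨t, ht⟩ := hp
    exact ⟨s - t, by omega⟩
  · obtain ⟨t, ht⟩ := hp
    exact ⟨s - t, by omega⟩

theorem topCount_reflect_le (hx : x.IsDiagram) (hy : y.IsDiagram) {P Q P' Q' : ℕ → Prop}
    (hP : IsFlip P P') (hQ : IsFlip Q Q') :
    (Picture.pair x y).topCount P Q ≤ (Picture.pair y.reflect x.reflect).topCount Q' P' := by
  have h := ncard_arcs_lt_le (r := (Picture.pair x y).rel)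
    (r' := (Picture.pair y.reflect x.reflect).rel) (φ := vertexSwap)
    (fun u v h => (joined_reflect_of_joined h).symm) (hP.imp (even_length_concatTop hx hy))
    (hQ.imp (even_length_concatTop hx hy))
  rwa [← concatTop_reflect] at h

theorem botCount_reflect_le (hx : x.IsDiagram) (hy : y.IsDiagram) {P Q P' Q' : ℕ → Prop}
    (hP : IsFlip P P') (hQ : IsFlip Q Q') :
    (Picture.pair x y).botCount P Q ≤ (Picture.pair y.reflect x.reflect).botCount Q' P' := by
  have h := ncard_arcs_lt_le (r := (Picture.pair x y).rel)
    (r' := (Picture.pair y.reflect x.reflect).rel) (φ := vertexSwap)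
    (fun u v h => (joined_reflect_of_joined h).symm) (hP.imp (even_length_concatBot hx hy))
    (hQ.imp (even_length_concatBot hx hy))
  rwa [← concatBot_reflect] at h

theorem crossCount_reflect_le (hx : x.IsDiagram) (hy : y.IsDiagram) {P Q P' Q' : ℕ → Prop}
    (hP : IsFlip P P') (hQ : IsFlip Q Q') :
    (Picture.pair x y).crossCount P Q ≤ (Picture.pair y.reflect x.reflect).crossCount P' Q' := by
  have h := ncard_arcs_cross_le (r := (Picture.pair x y).rel)
    (r' := (Picture.pair y.reflect x.reflect).rel) (φ := vertexSwap)
    (fun u v h => joined_reflect_of_joined h) (hP.imp (even_length_concatTop hx hy))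
    (hQ.imp (even_length_concatBot hx hy))
  rwa [← concatTop_reflect, ← concatBot_reflect] at h

/-- For an arc on one boundary the ends are exchanged and both parities flip, so the types odd-even
and even-odd are preserved. The types with equal parities are exchanged, but they share `α₃` or
`δ₃`. For arcs from top to bottom only the parities flip, which exchanges types sharing `γ₁₂` or
`γ₃`. -/
theorem weight_reflect {R : Type*} [CommRing R] (P : Params R) (hx : x.IsDiagram)
    (hy : y.IsDiagram) : weight P y.reflect x.reflect = weight P x y := by
  have hx' := reflect_isDiagram hx
  have hy' := reflect_isDiagram hy
  have h1 : (Picture.pair y.reflect x.reflect).loops.ncard = (Picture.pair x y).loops.ncard := by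
    refine le_antisymm ?_ ncard_loops_reflect_le
    have := ncard_loops_reflect_le (x := y.reflect) (y := x.reflect)
    rwa [reflect_reflect, reflect_reflect] at this
  have h2 : ∀ {P Q P' Q'}, IsFlip P P' → IsFlip Q Q' →
      (Picture.pair y.reflect x.reflect).topCount P Q = (Picture.pair x y).topCount Q' P' := by
    intro P Q P' Q' hP hQ
    refine le_antisymm ?_ (topCount_reflect_le hx hy hQ.symm hP.symm)
    have := topCount_reflect_le hy' hx' hP hQ
    rwa [reflect_reflect, reflect_reflect] at this
  have h3 : ∀ {P Q P' Q'}, IsFlip P P' → IsFlip Q Q' →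
      (Picture.pair y.reflect x.reflect).botCount P Q = (Picture.pair x y).botCount Q' P' := by
    intro P Q P' Q' hP hQ
    refine le_antisymm ?_ (botCount_reflect_le hx hy hQ.symm hP.symm)
    have := botCount_reflect_le hy' hx' hP hQ
    rwa [reflect_reflect, reflect_reflect] at this
  have h4 : ∀ {P Q P' Q'}, IsFlip P P' → IsFlip Q Q' →
      (Picture.pair y.reflect x.reflect).crossCount P Q = (Picture.pair x y).crossCount P' Q' := by
    intro P Q P' Q' hP hQ
    refine le_antisymm ?_ (crossCount_reflect_le hx hy hP.symm hQ.symm)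
    have := crossCount_reflect_le hy' hx' hP hQ
    rwa [reflect_reflect, reflect_reflect] at this
  have oe : IsFlip Odd Even := .inl ⟨rfl, rfl⟩
  have eo : IsFlip Even Odd := .inr ⟨rfl, rfl⟩
  simp only [← Picture.weight_pair, Picture.weight]
  rw [h1, h2 oe eo, h2 eo oe, h2 oe oe, h2 eo eo, h3 oe eo, h3 eo oe, h3 oe oe, h3 eo eo,
    h4 oe eo, h4 eo oe, h4 oe oe, h4 eo eo]
  ring

end Reflect

end GhostAlg

namespace GhostAlg

/-! ## Products without loops and boundary arcs -/

section Open

variable {n m k : ℕ} {x : Drawing n m} {y : Drawing m k}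

/-- Loops and boundary arcs meet no outer node. If every occupied middle node is connected to an
outer node, there is no room for either. -/
theorem weight_eq_one {R : Type*} [CommRing R] (P : Params R) (hx : x.IsDiagram)
    (hy : y.IsDiagram) (hc : Compatible x y)
    (h : ∀ j, x.Occupied (Sum.inr j) → ∃ p : Node n k, Joined x y (vertexM j) (vertexOuter p)) :
    weight P x y = 1 := by
  have hl : (Picture.pair x y).loops = ∅ := by
    refine Set.eq_empty_of_forall_notMem ?_
    rintro C ⟨v, rfl, hC⟩
    obtain ⟨j, rfl, hj, -⟩ := hC v (Joined.refl v)
    obtain ⟨p, hp⟩ := h j (.inl hj)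
    obtain ⟨i, e, -⟩ := hC _ hp
    exact vertexOuter_ne_middle e
  have outer : ∀ v, EntryAt x y v → ∃ p : Node n k, Joined x y v (vertexOuter p) := by
    intro v hv
    obtain ⟨p, rfl⟩ | ⟨j, rfl⟩ := vertex_cases v
    · exact ⟨p, .refl _⟩
    · refine h j ?_
      rcases hv with ⟨p, e, hp⟩ | ⟨p, e, hp⟩
      · rw [eq_comm, vertexL_eq_middle] at e
        exact e ▸ .inr hp
      · rw [eq_comm, vertexR_eq_middle] at e
        exact (hc j).2 (e ▸ .inr hp)
  have ht : ∀ A B, (Picture.pair x y).topCount A B = 0 := by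
    intro A B
    refine (Set.ncard_eq_zero (finite_arcs _ _ _ _ _ _)).2 (Set.eq_empty_of_forall_notMem ?_)
    rintro ⟨i, j⟩ ⟨hij, ⟨u, v, hu, hv, huv⟩, -⟩
    obtain ⟨p, hp⟩ := outer u (entryAt_of_top hu)
    exact RawEnd.not_joined_outer hx hy hc (.top hu) (.top hv) (by simp) (by simp)
      (by simpa using ne_of_lt hij) huv p hp
  have hb : ∀ A B, (Picture.pair x y).botCount A B = 0 := by
    intro A B
    refine (Set.ncard_eq_zero (finite_arcs _ _ _ _ _ _)).2 (Set.eq_empty_of_forall_notMem ?_)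
    rintro ⟨i, j⟩ ⟨hij, ⟨u, v, hu, hv, huv⟩, -⟩
    obtain ⟨p, hp⟩ := outer u (entryAt_of_bot hu)
    exact RawEnd.not_joined_outer hx hy hc (.bot hu) (.bot hv) (by simp) (by simp)
      (by simpa using ne_of_lt hij) huv p hp
  have hcr : ∀ A B, (Picture.pair x y).crossCount A B = 0 := by
    intro A B
    refine (Set.ncard_eq_zero (finite_arcs _ _ _ _ _ _)).2 (Set.eq_empty_of_forall_notMem ?_)
    rintro ⟨i, j⟩ ⟨-, ⟨u, v, hu, hv, huv⟩, -⟩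
    obtain ⟨p, hp⟩ := outer u (entryAt_of_top hu)
    exact RawEnd.not_joined_outer hx hy hc (.top hu) (.bot hv) (by simp) (by simp)
      (by simp) huv p hp
  rw [← Picture.weight_pair, Picture.weight]
  simp [hl, ht, hb, hcr]

/-- A product can be computed by moving each string end to an outer node. -/
theorem concat_eq_of_retract (hx : x.IsDiagram) (hy : y.IsDiagram) (hc : Compatible x y)
    {D : Drawing n k} (hD : D.IsDiagram) (φ : Vertex n m k → Node n k)
    (hφ : ∀ p, φ (vertexOuter p) = p)
    (hlink : ∀ u v, Linked x y u v → φ u = φ v ∨ D.partner (φ u) = some (φ v))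
    (hpartner : ∀ p q, D.partner p = some q → Joined x y (vertexOuter p) (vertexOuter q))
    (hentry : ∀ v, EntryAt x y v → Joined x y v (vertexOuter (φ v)))
    (htop : cancelGhosts ((concatTop x y).map (Option.map φ)) = D.top)
    (hbot : cancelGhosts ((concatBot x y).map (Option.map φ)) = D.bot) : concat x y = D := by
  have hj : ∀ u v, Joined x y u v → φ u = φ v ∨ D.partner (φ u) = some (φ v) := by
    intro u v h
    induction h with
    | rel u v h => exact hlink u v h
    | refl u => exact .inl rfl
    | symm u v _ ih => exact ih.imp Eq.symm (hD.partner_symm _ _)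
    | trans u v w _ _ ih ih' =>
      rcases ih with h | h
      · rwa [h]
      · rcases ih' with h' | h'
        · exact .inr (h' ▸ h)
        · rw [hD.partner_symm _ _ h] at h'
          exact .inl (Option.some.inj h')
  have hrem : ∀ l : List (Option (Vertex n m k)), (∀ v, some v ∈ l → EntryAt x y v) →
      l.map (remaining x y) = l.map (Option.map φ) := by
    intro l hl
    refine List.map_congr_left ?_
    rintro (_ | v) hv
    · rfl
    · exact (remaining_eq_some hx hy hc (hl v hv)).2 (hentry v (hl v hv))
  ext1
  · funext p
    refine Option.ext fun q => ?_
    rw [concat_partner hx hy hc]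
    constructor
    · rintro ⟨hne, h⟩
      have := hj _ _ h
      simp only [hφ] at this
      exact this.resolve_left hne.symm
    · intro h
      refine ⟨?_, hpartner p q h⟩
      rintro rfl
      exact hD.partner_ne _ h
  · rw [concat, hrem _ fun v hv => entryAt_of_mem (.inl hv), htop]
  · rw [concat, hrem _ fun v hv => entryAt_of_mem (.inr hv), hbot]

end Open

/-! ## Horizontal strings -/

section Horizontal

variable {n m : ℕ} {x : Drawing n m} {E : Finset (Fin n)}

namespace Drawing

theorem horizontal_partner {p q : Node n n} : (horizontal E).partner p = some q ↔
    ∃ i ∈ E, p = Sum.inl i ∧ q = Sum.inr i ∨ p = Sum.inr i ∧ q = Sum.inl i := by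
  rcases p with i | i <;> rcases q with j | j <;> simp [horizontal] <;> aesop

theorem horizontal_occupied_inl {i : Fin n} : (horizontal E).Occupied (Sum.inl i) ↔ i ∈ E := by
  simp [Occupied, horizontal]

theorem horizontal_occupied_inr {i : Fin n} : (horizontal E).Occupied (Sum.inr i) ↔ i ∈ E := by
  simp [Occupied, horizontal]

theorem horizontal_isDiagram (E : Finset (Fin n)) : (horizontal E).IsDiagram where
  partner_ne p h := by
    obtain ⟨i, -, ⟨rfl, h⟩ | ⟨rfl, h⟩⟩ := horizontal_partner.1 h <;> simp at h
  partner_symm p q h := by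
    rw [horizontal_partner] at h ⊢
    obtain ⟨i, hi, h⟩ := h
    exact ⟨i, hi, by tauto⟩
  ends_nodup := by simp [horizontal, List.reduceOption]
  partner_eq_none p h := by simp [horizontal] at h
  even_top := by simp [horizontal]
  even_bot := by simp [horizontal]
  reduced_top := by simp [horizontal]
  reduced_bot := by simp [horizontal]
  noncrossing := by
    have key : ∀ a b, (horizontal E).IsString a b → ∃ i : Fin n,
        a = nodePos (Sum.inl i : Node n n) ∧ b = nodePos (Sum.inr i : Node n n) ∨
        b = nodePos (Sum.inl i : Node n n) ∧ a = nodePos (Sum.inr i : Node n n) := by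
      intro a b h
      induction h with
      | node h =>
        obtain ⟨i, -, ⟨rfl, rfl⟩ | ⟨rfl, rfl⟩⟩ := horizontal_partner.1 h
        exacts [⟨i, .inl ⟨rfl, rfl⟩⟩, ⟨i, .inr ⟨rfl, rfl⟩⟩]
      | top h => simp [horizontal] at h
      | bot h => simp [horizontal] at h
      | symm _ ih =>
        obtain ⟨i, h⟩ := ih
        exact ⟨i, h.symm⟩
    intro a b c d hab hcd
    obtain ⟨i, ⟨rfl, rfl⟩ | ⟨rfl, rfl⟩⟩ := key a b hab <;>
      obtain ⟨j, ⟨rfl, rfl⟩ | ⟨rfl, rfl⟩⟩ := key c d hcd <;>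
      simp only [lex_lt_iff, nodePos, ofLex_toLex] <;> omega

theorem horizontal_ofKind {κ : Kind} (h : κ.Dilute ∨ E = Finset.univ) :
    (horizontal E).OfKind κ where
  isDiagram := horizontal_isDiagram E
  occupied hκ p := by
    obtain rfl := h.resolve_left hκ
    rcases p with i | i
    · simp [horizontal_occupied_inl]
    · simp [horizontal_occupied_inr]
  no_bot _ _ := by simp [horizontal]

theorem reflect_horizontal : (horizontal E).reflect = horizontal E := by
  ext1
  · funext p
    rcases p with i | i <;> by_cases h : i ∈ E <;> simp [reflect, horizontal, h]
  · rfl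
  · rfl

end Drawing

variable {E : Finset (Fin m)}

theorem joined_horizontal {i : Fin m} (hi : i ∈ E) :
    Joined x (.horizontal E) (vertexM i) (vertexOuter (Sum.inr i)) :=
  joined_right (p := Sum.inl i) (q := Sum.inr i)
    (Drawing.horizontal_partner.2 ⟨i, hi, .inl ⟨rfl, rfl⟩⟩)

theorem mem_of_compatible_horizontal (hc : Compatible x (.horizontal E)) {i : Fin m}
    (h : x.Occupied (Sum.inr i)) : i ∈ E :=
  Drawing.horizontal_occupied_inl.1 ((hc i).1 h)

theorem weight_horizontal {R : Type*} [CommRing R] (P : Params R) (hx : x.IsDiagram)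
    (hc : Compatible x (.horizontal E)) : weight P x (.horizontal E) = 1 :=
  weight_eq_one P hx (Drawing.horizontal_isDiagram E) hc fun _ hj =>
    ⟨_, joined_horizontal (mem_of_compatible_horizontal hc hj)⟩

theorem concat_horizontal (hx : x.IsDiagram) (hc : Compatible x (.horizontal E)) :
    concat x (.horizontal E) = x := by
  have hφ : ∀ p : Node n m, Sum.elim Sum.inl (Sum.elim Sum.inr Sum.inr)
      (vertexL p : Vertex n m m) = p := by rintro (i | i) <;> rfl
  have hj : ∀ p : Node n m, x.Occupied p →
      Joined x (.horizontal E) (vertexL p) (vertexOuter p) := by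
    rintro (i | i) hi
    · exact .refl _
    · exact joined_horizontal (mem_of_compatible_horizontal hc hi)
  have hcomp : (Sum.elim Sum.inl (Sum.elim Sum.inr Sum.inr) : Vertex n m m → Node n m) ∘ vertexL =
      id := funext hφ
  have hlist : ∀ l : List (Option (Node n m)), l = List.map (Option.map
      (Sum.elim Sum.inl (Sum.elim Sum.inr Sum.inr))) (l.map (Option.map
        (vertexL : Node n m → Vertex n m m))) := by
    intro l
    rw [List.map_map, Option.map_comp_map, hcomp, Option.map_id, List.map_id]
  -- The retraction moves each middle node along its horizontal string to the right side.
  refine concat_eq_of_retract hx (Drawing.horizontal_isDiagram E) hc hx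
    (Sum.elim Sum.inl (Sum.elim Sum.inr Sum.inr)) (by rintro (i | i) <;> rfl) ?_ ?_ ?_ ?_ ?_
  · rintro u v (⟨p, q, h, rfl, rfl⟩ | ⟨p, q, h, rfl, rfl⟩)
    · right
      rwa [hφ, hφ]
    · left
      obtain ⟨i, -, ⟨rfl, rfl⟩ | ⟨rfl, rfl⟩⟩ := Drawing.horizontal_partner.1 h <;> rfl
  · intro p q h
    exact (hj p (.inl (by simp [h]))).symm.trans ((joined_left h).trans
      (hj q (.inl (by simp [hx.partner_symm _ _ h]))))
  · rintro v (⟨p, rfl, h⟩ | ⟨p, rfl, h⟩)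
    · rw [hφ]
      exact hj p (.inr h)
    · simp [Drawing.horizontal] at h
  · rw [concatTop]
    simp only [Drawing.horizontal, List.map_nil, List.append_nil]
    rw [← hlist, cancelGhosts_of_isChain hx.reduced_top]
  · rw [concatBot]
    simp only [Drawing.horizontal, List.map_nil, List.append_nil]
    rw [← hlist, cancelGhosts_of_isChain hx.reduced_bot]

end Horizontal

end GhostAlg

namespace GhostAlg

/-! ## Half-diagrams -/

section Through

variable {n m k d e : ℕ}

/-- Each node on the right is connected to a node on the left. -/
def Drawing.Through (D : Drawing n d) : Prop :=
  ∀ j : Fin d, ∃ i : Fin n, D.partner (Sum.inr j) = some (Sum.inl i)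

namespace Drawing

theorem Through.occupied {D : Drawing n d} (h : D.Through) (j : Fin d) :
    D.Occupied (Sum.inr j) := by
  obtain ⟨i, hi⟩ := h j
  exact .inl (by simp [hi])

theorem Through.exists_injective {D : Drawing n d} (h : D.Through) (hD : D.IsDiagram) :
    ∃ f : Fin d → Fin n, Function.Injective f ∧
      ∀ j, D.partner (Sum.inr j) = some (Sum.inl (f j)) := by
  choose f hf using h
  refine ⟨f, fun i j hij => ?_, hf⟩
  have hi := hD.partner_symm _ _ (hf i)
  rw [hij, hD.partner_symm _ _ (hf j)] at hi
  simpa using hi.symm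

theorem Through.le {D : Drawing n d} (h : D.Through) (hD : D.IsDiagram) : d ≤ n := by
  obtain ⟨f, hf, -⟩ := h.exists_injective hD
  simpa using Fintype.card_le_of_injective f hf

/-- Planarity makes the assignment of left nodes to right nodes strictly increasing, hence the
identity of `Fin d`. All nodes are used up by throughlines, so a boundary carries an even number of
ghosts in a single domain, that is, none. -/
theorem Through.eq_horizontal {D : Drawing d d} (h : D.Through) (hD : D.IsDiagram) :
    D = horizontal Finset.univ := by
  obtain ⟨f, hf, hp⟩ := h.exists_injective hD
  have hmono : StrictMono f := by
    intro i j hij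
    by_contra hlt
    have hlt := lt_of_le_of_ne (not_lt.1 hlt) (hf.ne hij.ne')
    refine hD.noncrossing _ _ _ _ (.symm (.node (hp i))) (.symm (.node (hp j))) ?_
    simp only [lex_lt_iff, nodePos, ofLex_toLex]
    simp only [Fin.lt_def] at hij hlt
    exact ⟨.inr ⟨trivial, by omega⟩, .inl (by norm_num), .inr ⟨trivial, by omega⟩⟩
  have hid : f = id := StrictMono.eq_id hmono
  subst hid
  have hpartner : ∀ p, D.partner p ≠ none := by
    rintro (i | i)
    · rw [hD.partner_symm (Sum.inr i) (Sum.inl i) (hp i)]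
      simp
    · simp [hp i]
  ext1
  · funext p
    rcases p with i | i
    · rw [hD.partner_symm (Sum.inr i) (Sum.inl i) (hp i)]
      simp [horizontal]
    · simp [horizontal, hp i]
  · refine eq_nil_of_forall_eq_none ?_ hD.even_top hD.reduced_top
    rintro (_ | p) hm
    · rfl
    · exact absurd (hD.partner_eq_none p (.inl hm)) (hpartner p)
  · refine eq_nil_of_forall_eq_none ?_ hD.even_bot hD.reduced_bot
    rintro (_ | p) hm
    · rfl
    · exact absurd (hD.partner_eq_none p (.inr hm)) (hpartner p)

end Drawing

open Drawing

variable {x : Drawing n m} {T : Drawing k m}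

theorem compatible_reflect_self (T : Drawing k m) : Compatible T.reflect T :=
  fun _ => reflect_occupied

theorem compatible_of_through {S : Drawing n d} {T : Drawing k d} (hS : S.Through)
    (hT : T.Through) : Compatible S T.reflect :=
  fun j => iff_of_true (hS.occupied j) (reflect_occupied.2 (hT.occupied j))

/-- Each defect of `T` is continued by its own mirror image. There may be loops and arcs, but only
the resulting drawing matters here. -/
theorem concat_reflect_self (hT : T.IsDiagram) (h : T.Through) :
    concat T.reflect T = horizontal Finset.univ := by
  have hc := compatible_reflect_self T
  refine Through.eq_horizontal (fun j => ⟨j, ?_⟩) (concat_isDiagram (reflect_isDiagram hT) hT hc)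
  obtain ⟨i, hi⟩ := h j
  rw [concat_partner (reflect_isDiagram hT) hT hc]
  exact ⟨by simp, (joined_right hi).trans (joined_left (p := Sum.inr i) (q := Sum.inl j)
    (reflect_partner.2 (hT.partner_symm _ _ hi)))⟩

/-- Each middle node lies on a defect of `T`, which leads to an outer node. -/
theorem weight_reflect_of_through {R : Type*} [CommRing R] (P : Params R) (hx : x.IsDiagram)
    (hT : T.IsDiagram) (h : T.Through) (hc : Compatible x T.reflect) :
    weight P x T.reflect = 1 := by
  refine weight_eq_one P hx (reflect_isDiagram hT) hc fun j _ => ?_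
  obtain ⟨i, hi⟩ := h j
  exact ⟨Sum.inr i, joined_right (p := Sum.inl j) (q := Sum.inr i) (reflect_partner.2 hi)⟩

/-- Right cancellation: `x` is recovered from `x T*` by multiplying with `T`. -/
theorem concat_concat_reflect (hx : x.IsDiagram) (hT : T.IsDiagram) (h : T.Through)
    (hc : Compatible x T.reflect) : concat (concat x T.reflect) T = x := by
  have hocc : ∀ j, x.Occupied (Sum.inr j) := fun j =>
    (hc j).2 (reflect_occupied.2 (h.occupied j))
  rw [concat_assoc hx (reflect_isDiagram hT) hT hc (compatible_reflect_self T),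
    concat_reflect_self hT h]
  exact concat_horizontal hx fun j =>
    iff_of_true (hocc j) (horizontal_occupied_inl.2 (Finset.mem_univ j))

/-- A string from the right side to the left side has to cross `y`. If it returned to the right side
within `y`, its component would contain three outer nodes. -/
theorem Drawing.Through.of_concat {y : Drawing m k} (hx : x.IsDiagram) (hy : y.IsDiagram)
    (hc : Compatible x y) (h : (concat x y).Through) : y.Through := by
  intro j
  obtain ⟨i, hi⟩ := h j
  obtain ⟨-, hi⟩ := (concat_partner hx hy hc).1 hi
  have hne : y.partner (Sum.inr j) ≠ none :=
    outerPartner_of_joined (p := Sum.inr j) hx hy hi (by simp [vertexOuter])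
  obtain ⟨q, hq⟩ := Option.ne_none_iff_exists'.1 hne
  rcases q with i' | j'
  · exact ⟨i', hq⟩
  · have hj : Joined x y (vertexOuter (Sum.inr j)) (vertexOuter (Sum.inr j')) := joined_right hq
    rcases joined_outer_unique hx hy hc hi hj with e | e | e
    · simp at e
    · cases e
      exact absurd hq (hy.partner_ne _)
    · simp at e

/-- If the products of two drawings with reflected half-diagrams agree, then the first factors
differ by a product with a drawing in which the connections of the defects can be seen. -/
theorem exists_through_of_concat_eq {S : Drawing n d} {x : Drawing n e} {T : Drawing k d}
    {T' : Drawing k e} (hS : S.IsDiagram) (hT : T.IsDiagram) (hx : x.IsDiagram)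
    (hT' : T'.IsDiagram) (hSt : S.Through) (hTt : T.Through) (hc : Compatible x T'.reflect)
    (h : concat S T.reflect = concat x T'.reflect) :
    ∃ Z : Drawing e d, Z.IsDiagram ∧ Z.Through ∧ Compatible x Z ∧ concat x Z = S := by
  have hST := compatible_of_through hSt hTt
  -- The witness is `T'* T`: indeed `S = S T* T = x T'* T`.
  have hrec := concat_concat_reflect hS hT hTt hST
  have hc1 : Compatible (concat S T.reflect) T :=
    (compatible_concat_left hS (reflect_isDiagram hT) hST).2 (compatible_reflect_self T)
  rw [h] at hc1 hrec
  have hc2 := (compatible_concat_left hx (reflect_isDiagram hT') hc).1 hc1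
  rw [concat_assoc hx (reflect_isDiagram hT') hT hc hc2] at hrec
  have hZ := concat_isDiagram (reflect_isDiagram hT') hT hc2
  have hc3 := (compatible_concat_right (x := x) (reflect_isDiagram hT') hT hc2).2 hc
  exact ⟨_, hZ, Through.of_concat hx hZ hc3 (hrec.symm ▸ hSt), hc3, hrec⟩

theorem le_of_concat_eq {S : Drawing n d} {x : Drawing n e} {T : Drawing k d}
    {T' : Drawing k e} (hS : S.IsDiagram) (hT : T.IsDiagram) (hx : x.IsDiagram)
    (hT' : T'.IsDiagram) (hSt : S.Through) (hTt : T.Through) (hc : Compatible x T'.reflect)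
    (h : concat S T.reflect = concat x T'.reflect) : d ≤ e := by
  obtain ⟨Z, hZ, hZt, -⟩ := exists_through_of_concat_eq hS hT hx hT' hSt hTt hc h
  exact hZt.le hZ

/-- For equal numbers of defects the connecting drawing goes through on both sides with `d` nodes
each, so it is the identity. -/
theorem eq_of_concat_eq {S x : Drawing n d} {T T' : Drawing k d} (hS : S.IsDiagram)
    (hT : T.IsDiagram) (hx : x.IsDiagram) (hT' : T'.IsDiagram) (hSt : S.Through) (hTt : T.Through)
    (hc : Compatible x T'.reflect) (h : concat S T.reflect = concat x T'.reflect) : S = x := by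
  obtain ⟨Z, hZ, hZt, hxZ, rfl⟩ := exists_through_of_concat_eq hS hT hx hT' hSt hTt hc h
  rw [hZt.eq_horizontal hZ] at hxZ ⊢
  exact concat_horizontal hx hxZ

end Through

end GhostAlg

namespace GhostAlg

/-! ## Cutting the throughlines -/

section Cut

variable {n k d : ℕ}

/-- The throughlines of `D` connect the left nodes `e t` to the right nodes `f t`, in this order. -/
structure Throughlines (D : Drawing n k) (e : Fin d → Fin n) (f : Fin d → Fin k) : Prop where
  mono_left : StrictMono e
  mono_right : StrictMono f
  partner_left : ∀ t, D.partner (Sum.inl (e t)) = some (Sum.inr (f t))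
  exhaust : ∀ i j, D.partner (Sum.inl i) = some (Sum.inr j) → ∃ t, e t = i

open Drawing

/-- The left ends are listed in increasing order; the right ends are then increasing as well, since
throughlines do not cross. -/
theorem exists_throughlines {D : Drawing n k} (hD : D.IsDiagram) :
    ∃ (d : ℕ) (e : Fin d → Fin n) (f : Fin d → Fin k), Throughlines D e f := by
  classical
  set s : Finset (Fin n) := Finset.univ.filter fun i => ∃ j, D.partner (Sum.inl i) = some (Sum.inr j)
    with hs
  have hmem : ∀ t, ∃ j, D.partner (Sum.inl (s.orderEmbOfFin rfl t)) = some (Sum.inr j) :=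
    fun t => (Finset.mem_filter.1 (s.orderEmbOfFin_mem rfl t)).2
  choose f hf using hmem
  refine ⟨s.card, s.orderEmbOfFin rfl, f, (s.orderEmbOfFin rfl).strictMono, ?_, hf, ?_⟩
  · intro t u htu
    have hlt := (s.orderEmbOfFin rfl).strictMono htu
    by_contra hle
    rcases lt_or_eq_of_le (not_lt.1 hle) with h | h
    · refine hD.noncrossing _ _ _ _ (.node (hf u)) (.node (hf t)) ?_
      simp only [lex_lt_iff, nodePos, ofLex_toLex]
      simp only [Fin.lt_def] at h hlt
      exact ⟨.inr ⟨trivial, by omega⟩, .inl (by norm_num), .inr ⟨trivial, by omega⟩⟩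
    · have h1 := hD.partner_symm _ _ (hf t)
      have h2 := hD.partner_symm _ _ (hf u)
      rw [h, h1] at h2
      simp only [Option.some.injEq, Sum.inl.injEq] at h2
      exact hlt.ne h2
  · intro i j hij
    have : i ∈ Set.range (s.orderEmbOfFin rfl) := by
      rw [Finset.range_orderEmbOfFin]
      simpa [hs] using ⟨j, hij⟩
    exact this

theorem Throughlines.reflect {D : Drawing n k} (hD : D.IsDiagram) {e : Fin d → Fin n}
    {f : Fin d → Fin k} (h : Throughlines D e f) : Throughlines D.reflect f e where
  mono_left := h.mono_right
  mono_right := h.mono_left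
  partner_left t := reflect_partner.2 (hD.partner_symm _ _ (h.partner_left t))
  exhaust j i hij := by
    have hij' := hD.partner_symm _ _ (reflect_partner.1 hij)
    obtain ⟨t, rfl⟩ := h.exhaust i j hij'
    rw [Sum.swap_inl, Sum.swap_inr, h.partner_left] at hij'
    exact ⟨t, by simpa using hij'⟩

/-- String ends attached to left nodes are kept, and those attached to right nodes are replaced by
ghosts. -/
def leftEnd {n k d : ℕ} : Option (Node n k) → Option (Node n d)
  | some (Sum.inl i) => some (Sum.inl i)
  | _ => none

open Classical in
/-- The half-diagram that is left when the throughlines, attached to the nodes `e t`, are cut and the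
right part of the drawing is discarded. -/
noncomputable def leftCut (D : Drawing n k) (e : Fin d → Fin n) : Drawing n d where
  partner
    | Sum.inl i =>
      match D.partner (Sum.inl i) with
      | some (Sum.inl j) => some (Sum.inl j)
      | some (Sum.inr _) => if h : ∃ t, e t = i then some (Sum.inr h.choose) else none
      | none => none
    | Sum.inr t => some (Sum.inl (e t))
  -- Ends attached to right nodes become ghosts, so the number of entries before cancellation is
  -- that of `D`. This is the parity adjustment: in a diagram these ends lie to the right of all
  -- ends that are kept.
  top := cancelGhosts (D.top.map leftEnd)
  bot := cancelGhosts (D.bot.map leftEnd)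

variable {D : Drawing n k} {e : Fin d → Fin n} {f : Fin d → Fin k}

theorem leftEnd_eq_some {a : Option (Node n k)} {p : Node n d} :
    leftEnd a = some p ↔ ∃ i, a = some (Sum.inl i) ∧ p = Sum.inl i := by
  rcases a with _ | i | j <;> simp [leftEnd, eq_comm]

theorem leftCut_through : (leftCut D e).Through := fun t => ⟨e t, rfl⟩

theorem leftCut_partner_inl_inl {i j : Fin n} :
    (leftCut D e).partner (Sum.inl i) = some (Sum.inl j) ↔
      D.partner (Sum.inl i) = some (Sum.inl j) := by
  rw [leftCut]
  rcases h : D.partner (Sum.inl i) with _ | i | j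
  · simp [h]
  · simp [h]
  · simp only [h]
    split_ifs <;> simp

theorem leftCut_partner_inl_inr (h : Throughlines D e f) {i : Fin n} {t : Fin d} :
    (leftCut D e).partner (Sum.inl i) = some (Sum.inr t) ↔ e t = i := by
  rw [leftCut]
  constructor
  · intro h'
    rcases hi : D.partner (Sum.inl i) with _ | i | j
    · simp [hi] at h'
    · simp [hi] at h'
    · simp only [hi] at h'
      split_ifs at h' with hex
      simp only [Option.some.injEq, Sum.inr.injEq] at h'
      exact h' ▸ hex.choose_spec
  · rintro rfl
    have hex : ∃ u, e u = e t := ⟨t, rfl⟩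
    simp only [h.partner_left, dif_pos hex]
    exact congrArg (fun u => some (Sum.inr u)) (h.mono_left.injective hex.choose_spec)

theorem leftCut_partner_inr {t : Fin d} {p : Node n d} :
    (leftCut D e).partner (Sum.inr t) = some p ↔ p = Sum.inl (e t) := by
  simp [leftCut, eq_comm]

theorem some_mem_cut {l : List (Option (Node n k))} {p : Node n d} :
    some p ∈ cancelGhosts (l.map leftEnd) ↔ ∃ i, p = Sum.inl i ∧ some (Sum.inl i) ∈ l := by
  rw [some_mem_cancelGhosts, List.mem_map]
  simp only [leftEnd_eq_some]
  constructor
  · rintro ⟨a, h, i, rfl, rfl⟩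
    exact ⟨i, rfl, h⟩
  · rintro ⟨i, rfl, h⟩
    exact ⟨_, h, i, rfl, rfl⟩

theorem leftCut_occupied (h : Throughlines D e f) {i : Fin n} :
    (leftCut D e).Occupied (Sum.inl i) ↔ D.Occupied (Sum.inl i) := by
  have hp : (leftCut D e).partner (Sum.inl i) ≠ none ↔ D.partner (Sum.inl i) ≠ none := by
    simp only [Option.ne_none_iff_exists', Sum.exists, leftCut_partner_inl_inl,
      leftCut_partner_inl_inr h]
    refine or_congr_right ⟨?_, fun ⟨j, hj⟩ => h.exhaust i j hj⟩
    rintro ⟨t, rfl⟩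
    exact ⟨_, h.partner_left t⟩
  have ht : ∀ l : List (Option (Node n k)),
      some (Sum.inl i : Node n d) ∈ cancelGhosts (l.map leftEnd) ↔ some (Sum.inl i) ∈ l := by
    intro l
    simp [some_mem_cut]
  exact or_congr hp (or_congr (ht _) (ht _))

theorem exists_index_cut (l : List (Option (Node n k))) : ∃ g : ℕ ↪o ℕ,
    ∀ i (p : Node n d), (cancelGhosts (l.map leftEnd))[i]? = some (some p) →
      ∃ a, p = Sum.inl a ∧ l[g i]? = some (some (Sum.inl a)) := by
  obtain ⟨g, hg, -⟩ := (cancels_cancelGhosts (l.map (leftEnd (d := d)))).exists_orderEmbedding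
  refine ⟨g, fun i p h => ?_⟩
  rw [hg, List.getElem?_map, Option.map_eq_some_iff] at h
  obtain ⟨b, hb, h⟩ := h
  obtain ⟨a, rfl, rfl⟩ := leftEnd_eq_some.1 h
  exact ⟨a, rfl, hb⟩

theorem leftCut_isDiagram (hD : D.IsDiagram) (h : Throughlines D e f) :
    (leftCut D e).IsDiagram where
  partner_ne p hp := by
    rcases p with i | t
    · exact hD.partner_ne _ (leftCut_partner_inl_inl.1 hp)
    · simp [leftCut_partner_inr] at hp
  partner_symm p q hp := by
    rcases p with i | t
    · rcases q with j | u
      · exact leftCut_partner_inl_inl.2 (hD.partner_symm _ _ (leftCut_partner_inl_inl.1 hp))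
      · rw [leftCut_partner_inr, (leftCut_partner_inl_inr h).1 hp]
    · rw [leftCut_partner_inr] at hp
      subst hp
      exact (leftCut_partner_inl_inr h).2 rfl
  ends_nodup := by
    obtain ⟨g, hg⟩ := exists_index_cut (d := d) D.top
    obtain ⟨g', hg'⟩ := exists_index_cut (d := d) D.bot
    refine List.nodup_append.2 ⟨nodup_reduceOption fun i j p hi hj => ?_,
      nodup_reduceOption fun i j p hi hj => ?_, ?_⟩
    · obtain ⟨a, rfl, ha⟩ := hg i p hi
      obtain ⟨b, e, hb⟩ := hg j _ hj
      cases e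
      exact g.injective (hD.top_unique ha hb)
    · obtain ⟨a, rfl, ha⟩ := hg' i p hi
      obtain ⟨b, e, hb⟩ := hg' j _ hj
      cases e
      exact g'.injective (hD.bot_unique ha hb)
    · rintro p hp _ hq rfl
      obtain ⟨i, rfl, hi⟩ := some_mem_cut.1 (List.reduceOption_mem_iff.1 hp)
      obtain ⟨j, e, hj⟩ := some_mem_cut.1 (List.reduceOption_mem_iff.1 hq)
      cases e
      exact hD.not_top_and_bot hi hj
  partner_eq_none p hp := by
    have : ∃ i, p = Sum.inl i ∧ (some (Sum.inl i) ∈ D.top ∨ some (Sum.inl i) ∈ D.bot) := by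
      rcases hp with hp | hp <;> obtain ⟨i, rfl, hi⟩ := some_mem_cut.1 hp
      exacts [⟨i, rfl, .inl hi⟩, ⟨i, rfl, .inr hi⟩]
    obtain ⟨i, rfl, hi⟩ := this
    simp [leftCut, hD.partner_eq_none _ hi]
  even_top := by
    rw [leftCut, (cancels_cancelGhosts _).even_length, List.length_map]
    exact hD.even_top
  even_bot := by
    rw [leftCut, (cancels_cancelGhosts _).even_length, List.length_map]
    exact hD.even_bot
  reduced_top := isChain_cancelGhosts _
  reduced_bot := isChain_cancelGhosts _
  noncrossing := by
    obtain ⟨g, hg⟩ := exists_index_cut (d := d) D.top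
    obtain ⟨g', hg'⟩ := exists_index_cut (d := d) D.bot
    -- Placing the free end of the defect `t` at the right node `f t` turns every string of the
    -- half-diagram into a string of `D`.
    refine noncrossing_of_map (S := D.IsString) (ν := fun p => nodePos (p.map id f)) (f := g)
      (g := g') ?_ ?_ (fun _ _ => .symm) ?_ ?_ ?_ hD.noncrossing
    · rintro (i | i) <;> rfl
    · rintro (i | i) (j | j) hij <;> simp only [lex_lt_iff, nodePos, ofLex_toLex, Sum.map] at hij ⊢
      · simpa using hij
      · simp
      · simp at hij
      · simpa [h.mono_right.lt_iff_lt] using hij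
    · rintro (i | i) (j | j) hij
      · exact .node (leftCut_partner_inl_inl.1 hij)
      · obtain rfl := (leftCut_partner_inl_inr h).1 hij
        exact .node (h.partner_left j)
      · rw [leftCut_partner_inr] at hij
        cases hij
        exact .symm (.node (h.partner_left i))
      · simp [leftCut_partner_inr] at hij
    · intro p i hp
      obtain ⟨a, rfl, ha⟩ := hg i p hp
      exact .top ha
    · intro p i hp
      obtain ⟨a, rfl, ha⟩ := hg' i p hp
      exact .bot ha

theorem leftCut_ofKind {κ : Kind} (hD : D.OfKind κ) (h : Throughlines D e f) :
    (leftCut D e).OfKind κ where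
  isDiagram := leftCut_isDiagram hD.isDiagram h
  occupied hκ p := by
    rcases p with i | t
    · exact (leftCut_occupied h).2 (hD.occupied hκ _)
    · exact leftCut_through.occupied t
  no_bot hκ p hp := by
    obtain ⟨i, rfl, hi⟩ := some_mem_cut.1 hp
    exact hD.no_bot hκ _ hi

theorem exists_append_of_pairwise {α β : Type*} {l : List (Option (α ⊕ β))}
    (h : l.Pairwise fun u v => ∀ a b, u = some (Sum.inr b) → v ≠ some (Sum.inl a)) :
    ∃ A B, l = A ++ B ∧ (∀ b, some (Sum.inr b) ∉ A) ∧ ∀ a, some (Sum.inl a) ∉ B := by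
  induction l with
  | nil => exact ⟨[], [], by simp⟩
  | cons c l ih =>
    obtain ⟨hc, hl⟩ := List.pairwise_cons.1 h
    by_cases hb : ∃ b, c = some (Sum.inr b)
    · obtain ⟨b, rfl⟩ := hb
      refine ⟨[], _, rfl, by simp, fun a ha => ?_⟩
      rcases List.mem_cons.1 ha with e | ha
      · simp at e
      · exact hc _ ha a b rfl rfl
    · obtain ⟨A, B, rfl, hA, hB⟩ := ih hl
      refine ⟨c :: A, B, rfl, fun b hm => ?_, hB⟩
      rcases List.mem_cons.1 hm with e | hm
      · exact hb ⟨b, e.symm⟩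
      · exact hA b hm

/-- A string from a right node that met the boundary to the left of a string from a left node would
cross it. -/
theorem pairwise_top (hD : D.IsDiagram) :
    D.top.Pairwise fun u v => ∀ a b, u = some (Sum.inr b) → v ≠ some (Sum.inl a) := by
  refine List.pairwise_iff_getElem.2 fun i j hi hj hij a b h1 h2 => ?_
  refine hD.noncrossing _ _ _ _ (.top (List.getElem?_eq_some_iff.2 ⟨hj, h2⟩))
    (.symm (.top (List.getElem?_eq_some_iff.2 ⟨hi, h1⟩))) ?_
  simp only [lex_lt_iff, nodePos, topPos, ofLex_toLex]
  exact ⟨.inl (by norm_num), .inr ⟨trivial, by exact_mod_cast hij⟩, .inl (by norm_num)⟩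

theorem pairwise_bot (hD : D.IsDiagram) :
    D.bot.Pairwise fun u v => ∀ a b, u = some (Sum.inr b) → v ≠ some (Sum.inl a) := by
  refine List.pairwise_iff_getElem.2 fun i j hi hj hij a b h1 h2 => ?_
  refine hD.noncrossing _ _ _ _ (.bot (List.getElem?_eq_some_iff.2 ⟨hj, h2⟩))
    (.bot (List.getElem?_eq_some_iff.2 ⟨hi, h1⟩)) ?_
  simp only [lex_lt_iff, nodePos, botPos, ofLex_toLex]
  exact ⟨.inl (by norm_num), .inl (by norm_num), .inr ⟨trivial, by omega⟩⟩

/-- Moves the middle nodes to the left nodes to which the defects are connected. -/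
def defectRetract (e : Fin d → Fin n) : Vertex n d k → Node n k :=
  Sum.elim Sum.inl (Sum.elim (fun t => Sum.inl (e t)) Sum.inr)

/-- The boundary splits as `A ++ B`, with ends of left nodes only in `A` and ends of right nodes
only in `B`. The left half contributes `A` and then a ghost for each entry of `B`; the right half
contributes a ghost for each entry of `A` and then `B`. The ghosts between `A` and `B` are even in
number and cancel. -/
theorem cancelGhosts_cut {l : List (Option (Node n k))}
    (hp : l.Pairwise fun u v => ∀ a b, u = some (Sum.inr b) → v ≠ some (Sum.inl a))
    (hc : l.IsChain fun a b => a ≠ none ∨ b ≠ none) (he : Even l.length) (e : Fin d → Fin n) :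
    cancelGhosts (((cancelGhosts (l.map (leftEnd (d := d)))).map (Option.map vertexL) ++
      ((cancelGhosts ((l.reverse.map (Option.map Sum.swap)).map (leftEnd (d := d)))).reverse.map
        (Option.map Sum.swap)).map (Option.map vertexR)).map
          (Option.map (defectRetract (k := k) e))) = l := by
  have h1 := ((cancels_cancelGhosts (l.map (leftEnd (d := d)))).map (Option.map vertexL) rfl).map
    (Option.map (defectRetract (k := k) e)) rfl
  have h2 := (((cancels_cancelGhosts ((l.reverse.map (Option.map Sum.swap)).map
    (leftEnd (d := d)))).reverse.map (Option.map Sum.swap) rfl).map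
      (Option.map (vertexR (n := n))) rfl).map (Option.map (defectRetract e)) rfl
  rw [List.map_append, ← (h1.append h2).cancelGhosts_eq]
  refine Cancels.cancelGhosts_eq (l' := l) ?_ |>.trans (cancelGhosts_of_isChain hc)
  obtain ⟨A, B, rfl, hA, hB⟩ := exists_append_of_pairwise hp
  simp only [List.map_append, List.map_reverse, List.reverse_append, List.reverse_reverse,
    List.map_map]
  have hA1 : A.map (Option.map (defectRetract (k := k) e) ∘ Option.map vertexL ∘ leftEnd) = A := by
    refine (List.map_congr_left ?_).trans (List.map_id A)
    rintro (_ | a | b) hm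
    exacts [rfl, rfl, absurd hm (hA b)]
  have hB1 : B.map (Option.map (defectRetract (k := k) e) ∘ Option.map vertexL ∘ leftEnd) =
      List.replicate B.length none := by
    refine (List.map_congr_left ?_).trans List.map_const'
    rintro (_ | a | b) hm
    exacts [rfl, absurd hm (hB a), rfl]
  have hA2 : A.map (Option.map (defectRetract (k := k) e) ∘ Option.map vertexR ∘
      Option.map Sum.swap ∘ leftEnd (d := d) ∘ Option.map Sum.swap) =
        List.replicate A.length none := by
    refine (List.map_congr_left ?_).trans List.map_const'
    rintro (_ | a | b) hm
    exacts [rfl, rfl, absurd hm (hA b)]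
  have hB2 : B.map (Option.map (defectRetract (k := k) e) ∘ Option.map vertexR ∘
      Option.map Sum.swap ∘ leftEnd (d := d) ∘ Option.map Sum.swap) = B := by
    refine (List.map_congr_left ?_).trans (List.map_id B)
    rintro (_ | a | b) hm
    exacts [rfl, absurd hm (hB a), rfl]
  rw [hA1, hB1, hA2, hB2, List.append_assoc, ← List.append_assoc _ _ B, ← List.replicate_add,
    ← List.append_assoc]
  refine cancels_replicate A B ?_
  rw [add_comm, ← List.length_append]
  exact he

/-- The middle nodes retract along the defects to the left nodes. Each throughline is reassembled
from its two halves, and all other strings lie in one of the halves. -/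
theorem concat_leftCut (hD : D.IsDiagram) (h : Throughlines D e f) :
    concat (leftCut D e) (leftCut D.reflect f).reflect = D := by
  have h' := h.reflect hD
  have hT := leftCut_isDiagram (reflect_isDiagram hD) h'
  refine concat_eq_of_retract (leftCut_isDiagram hD h) (reflect_isDiagram hT)
    (compatible_of_through leftCut_through leftCut_through) hD (defectRetract e)
    (by rintro (i | i) <;> rfl) ?_ ?_ ?_ (cancelGhosts_cut (pairwise_top hD) hD.reduced_top
      hD.even_top e) (cancelGhosts_cut (pairwise_bot hD) hD.reduced_bot hD.even_bot e)
  · rintro u v (⟨p, q, hp, rfl, rfl⟩ | ⟨p, q, hp, rfl, rfl⟩)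
    · rcases p with i | t
      · rcases q with j | u
        · exact .inr (leftCut_partner_inl_inl.1 hp)
        · obtain rfl := (leftCut_partner_inl_inr h).1 hp
          exact .inl rfl
      · obtain rfl := leftCut_partner_inr.1 hp
        exact .inl rfl
    · have hp := reflect_partner.1 hp
      rcases p with t | i
      · obtain hq := leftCut_partner_inr.1 hp
        obtain rfl : q = Sum.inr (f t) := by simpa using congrArg Sum.swap hq
        exact .inr (h.partner_left t)
      · rcases q with t | j
        · obtain rfl := (leftCut_partner_inl_inr h').1 hp
          exact .inr (hD.partner_symm _ _ (h.partner_left t))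
        · exact .inr (reflect_partner.1 (leftCut_partner_inl_inl.1 hp))
  · have hline : ∀ i j, D.partner (Sum.inl i) = some (Sum.inr j) →
        Joined (leftCut D e) (leftCut D.reflect f).reflect (vertexOuter (Sum.inl i))
          (vertexOuter (Sum.inr j)) := by
      intro i j hij
      obtain ⟨t, rfl⟩ := h.exhaust i j hij
      obtain rfl : f t = j := by simpa [h.partner_left] using hij
      exact (joined_left (p := Sum.inl (e t)) (q := Sum.inr t)
        ((leftCut_partner_inl_inr h).2 rfl)).trans (joined_right (p := Sum.inl t)
          (q := Sum.inr (f t)) (reflect_partner.2 (leftCut_partner_inr.2 rfl)))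
    rintro (i | i) (j | j) hp
    · exact joined_left (leftCut_partner_inl_inl.2 hp)
    · exact hline i j hp
    · exact (hline j i (hD.partner_symm _ _ hp)).symm
    · exact joined_right (reflect_partner.2 (leftCut_partner_inl_inl.2 (reflect_partner.2 hp)))
  · intro v _
    rcases v with i | t | j
    · exact .refl _
    · exact joined_left (p := Sum.inr t) (q := Sum.inl (e t)) rfl
    · exact .refl _

theorem exists_half_diagrams {κ : Kind} (hD : D.OfKind κ) :
    ∃ (d : ℕ) (S : Drawing n d) (T : Drawing k d), S.OfKind κ ∧ S.Through ∧ T.OfKind κ ∧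
      T.Through ∧ concat S T.reflect = D := by
  obtain ⟨d, e, f, h⟩ := exists_throughlines hD.isDiagram
  exact ⟨d, _, _, leftCut_ofKind hD h, leftCut_through,
    leftCut_ofKind (reflect_ofKind hD) (h.reflect hD.isDiagram), leftCut_through,
    concat_leftCut hD.isDiagram h⟩

end Cut

end GhostAlg

namespace GhostAlg

/-! ## Finiteness -/

section Finite

variable {n m : ℕ}

/-- Of any two neighbouring entries at least one is a string end. As the nodes bound the number of
string ends, only finitely many boundaries are possible. -/
theorem length_le_reduceOption {α : Type*} : ∀ {l : List (Option α)},
    l.IsChain (fun a b => a ≠ none ∨ b ≠ none) → l.length ≤ 2 * l.reduceOption.length + 1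
  | [], _ => by simp
  | [a], _ => by simp
  | a :: b :: l, h => by
    rw [List.isChain_cons_cons] at h
    have ih := length_le_reduceOption (l := l) h.2.tail
    rcases a with _ | a <;> rcases b with _ | b <;> simp at h ⊢ <;> omega

theorem Drawing.IsDiagram.length_le {D : Drawing n m} (hD : D.IsDiagram) :
    D.top.length ≤ 2 * (n + m) + 1 ∧ D.bot.length ≤ 2 * (n + m) + 1 := by
  have ht := length_le_reduceOption hD.reduced_top
  have hb := length_le_reduceOption hD.reduced_bot
  have hn := List.nodup_append.1 hD.ends_nodup
  have h1 := hn.1.length_le_card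
  have h2 := hn.2.1.length_le_card
  simp only [Fintype.card_sum, Fintype.card_fin] at h1 h2
  omega

theorem finite_isDiagram (n m : ℕ) : Finite {D : Drawing n m // D.IsDiagram} := by
  have : Finite {l : List (Option (Node n m)) // l.length ≤ 2 * (n + m) + 1} :=
    (List.finite_length_le _ _).to_subtype
  refine Finite.of_injective (β := (Node n m → Option (Node n m)) ×
    {l : List (Option (Node n m)) // l.length ≤ 2 * (n + m) + 1} ×
    {l : List (Option (Node n m)) // l.length ≤ 2 * (n + m) + 1})
    (fun D => (D.1.partner, ⟨_, D.2.length_le.1⟩, ⟨_, D.2.length_le.2⟩)) ?_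
  rintro ⟨D, hD⟩ ⟨D', hD'⟩ h
  simp only [Prod.mk.injEq, Subtype.mk.injEq] at h
  exact Subtype.ext (Drawing.ext h.1 h.2.1 h.2.2)

instance {κ : Kind} {d : ℕ} : Finite (HalfDiagram κ n d) := by
  have := finite_isDiagram n d
  exact Finite.of_injective (fun S => (⟨S.1, S.2.1.isDiagram⟩ : {D : Drawing n d // D.IsDiagram}))
    fun S T h => Subtype.ext (Subtype.mk.inj h)

end Finite

/-! ## The algebra of diagrams -/

namespace GhostAlgebra

open Drawing

variable {κ : Kind} {n : ℕ} {R : Type*} [CommRing R] {P : Params R}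

theorem ofDrawing_eq {D : Drawing n n} (h : D.OfKind κ) :
    (ofDrawing D : GhostAlgebra κ n P) = basis ⟨D, h⟩ :=
  dif_pos h

theorem basis_mul_basis (x y : Diagram κ n) :
    (basis x * basis y : GhostAlgebra κ n P) = diagramMul x y := by
  change mulHom (basis x) (basis y) = _
  simp [mulHom]

theorem basis_mul_of_compatible {x y : Diagram κ n} (h : Compatible x.1 y.1) :
    (basis x * basis y : GhostAlgebra κ n P) =
      weight P x.1 y.1 • basis ⟨concat x.1 y.1, concat_ofKind x.2 y.2 h⟩ := by
  rw [basis_mul_basis, diagramMul, if_pos h, ofDrawing_eq]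

theorem basis_mul_of_not_compatible {x y : Diagram κ n} (h : ¬ Compatible x.1 y.1) :
    (basis x * basis y : GhostAlgebra κ n P) = 0 := by
  rw [basis_mul_basis, diagramMul, if_neg h]

theorem basis_induction {p : GhostAlgebra κ n P → Prop} (a : GhostAlgebra κ n P)
    (basis : ∀ x, p (basis x)) (zero : p 0) (add : ∀ a b, p a → p b → p (a + b))
    (smul : ∀ (r : R) a, p a → p (r • a)) : p a := by
  have h : a ∈ Submodule.span R (Set.range (GhostAlgebra.basis (κ := κ) (n := n) (P := P))) := by
    rw [Module.Basis.span_eq]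
    trivial
  induction h using Submodule.span_induction with
  | mem a h =>
    obtain ⟨x, rfl⟩ := h
    exact basis x
  | zero => exact zero
  | add a b _ _ ha hb => exact add a b ha hb
  | smul r a _ ha => exact smul r a ha

theorem basis_mul_assoc (x y z : Diagram κ n) :
    (basis x * basis y * basis z : GhostAlgebra κ n P) = basis x * (basis y * basis z) := by
  have hx := x.2.isDiagram
  have hy := y.2.isDiagram
  have hz := z.2.isDiagram
  by_cases hxy : Compatible x.1 y.1
  · by_cases hyz : Compatible y.1 z.1
    · rw [basis_mul_of_compatible hxy, basis_mul_of_compatible hyz, smul_mul_assoc, mul_smul_comm,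
        basis_mul_of_compatible ((compatible_concat_left hx hy hxy).2 hyz),
        basis_mul_of_compatible ((compatible_concat_right hy hz hyz).2 hxy), smul_smul, smul_smul,
        weight_assoc P hx hy hz hxy hyz]
      congr 3
      exact concat_assoc hx hy hz hxy hyz
    · rw [basis_mul_of_compatible hxy, basis_mul_of_not_compatible hyz, smul_mul_assoc, mul_zero,
        basis_mul_of_not_compatible (mt (compatible_concat_left hx hy hxy).1 hyz), smul_zero]
  · by_cases hyz : Compatible y.1 z.1
    · rw [basis_mul_of_compatible hyz, basis_mul_of_not_compatible hxy, mul_smul_comm, zero_mul,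
        basis_mul_of_not_compatible (mt (compatible_concat_right hy hz hyz).1 hxy), smul_zero]
    · rw [basis_mul_of_not_compatible hxy, basis_mul_of_not_compatible hyz, zero_mul, mul_zero]

protected theorem mul_assoc (a b c : GhostAlgebra κ n P) : a * b * c = a * (b * c) := by
  induction a using basis_induction with
  | zero => simp
  | add a a' h h' => simp only [add_mul, h, h']
  | smul r a h => simp only [smul_mul_assoc, h]
  | basis x =>
    induction b using basis_induction with
    | zero => simp
    | add a a' h h' => simp only [add_mul, mul_add, h, h']
    | smul r a h => simp only [smul_mul_assoc, mul_smul_comm, h]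
    | basis y =>
      induction c using basis_induction with
      | zero => simp
      | add a a' h h' => simp only [mul_add, h, h']
      | smul r a h => simp only [mul_smul_comm, h]
      | basis z => exact basis_mul_assoc x y z

theorem basis_mul_horizontal {x : Diagram κ n} {E : Finset (Fin n)}
    (hE : κ.Dilute ∨ E = Finset.univ) (h : Compatible x.1 (horizontal E)) :
    (basis x * ofDrawing (horizontal E) : GhostAlgebra κ n P) = basis x := by
  rw [ofDrawing_eq (horizontal_ofKind hE), basis_mul_of_compatible h,
    weight_horizontal P x.2.isDiagram h, one_smul]
  exact congrArg _ (Subtype.ext (concat_horizontal x.2.isDiagram h))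

theorem one_eq_of_dilute (h : κ.Dilute) : (1 : GhostAlgebra κ n P) =
    ∑ E : Finset (Fin n), ofDrawing (horizontal E) :=
  if_pos h

theorem one_eq_of_not_dilute (h : ¬ κ.Dilute) : (1 : GhostAlgebra κ n P) =
    ofDrawing (horizontal Finset.univ) :=
  if_neg h

theorem basis_mul_one (x : Diagram κ n) : (basis x * 1 : GhostAlgebra κ n P) = basis x := by
  classical
  by_cases hκ : κ.Dilute
  -- Exactly one summand is compatible with `x`: the one with strings at the levels of the occupied
  -- right nodes of `x`.
  · rw [one_eq_of_dilute hκ, Finset.mul_sum, Finset.sum_eq_single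
      (Finset.univ.filter fun j => x.1.Occupied (Sum.inr j))]
    · refine basis_mul_horizontal (.inl hκ) fun j => ?_
      simp [horizontal_occupied_inl]
    · intro E _ hE
      rw [ofDrawing_eq (horizontal_ofKind (.inl hκ)), basis_mul_of_not_compatible]
      intro hc
      refine hE (Finset.ext fun j => ?_)
      rw [Finset.mem_filter, hc j, horizontal_occupied_inl]
      simp
    · simp
  · rw [one_eq_of_not_dilute hκ]
    exact basis_mul_horizontal (.inr rfl) fun j =>
      iff_of_true (x.2.occupied hκ _) (horizontal_occupied_inl.2 (Finset.mem_univ j))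

protected theorem mul_one (a : GhostAlgebra κ n P) : a * 1 = a := by
  induction a using basis_induction with
  | zero => simp
  | add a a' h h' => simp only [add_mul, h, h']
  | smul r a h => simp only [smul_mul_assoc, h]
  | basis x => exact basis_mul_one x

theorem reflection_ofDrawing {D : Drawing n n} (h : D.OfKind κ) :
    reflection κ n P (ofDrawing D) = ofDrawing D.reflect := by
  rw [ofDrawing_eq h, reflection, Module.Basis.constr_basis]

theorem reflection_basis (x : Diagram κ n) :
    reflection κ n P (basis x) = basis ⟨x.1.reflect, reflect_ofKind x.2⟩ := by
  rw [reflection, Module.Basis.constr_basis, ofDrawing_eq]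

theorem reflection_reflection (a : GhostAlgebra κ n P) :
    reflection κ n P (reflection κ n P a) = a := by
  induction a using basis_induction with
  | zero => simp
  | add a a' h h' => simp only [map_add, h, h']
  | smul r a h => simp only [map_smul, h]
  | basis x =>
    rw [reflection_basis, reflection_basis]
    exact congrArg _ (Subtype.ext (reflect_reflect x.1))

theorem reflection_basis_mul (x y : Diagram κ n) : reflection κ n P (basis x * basis y) =
    reflection κ n P (basis y) * reflection κ n P (basis x) := by
  rw [reflection_basis, reflection_basis]
  by_cases h : Compatible x.1 y.1
  · rw [basis_mul_of_compatible h, map_smul, reflection_basis,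
      basis_mul_of_compatible (compatible_reflect.2 h), weight_reflect P x.2.isDiagram y.2.isDiagram]
    exact congrArg _ (congrArg _ (Subtype.ext (concat_reflect x.2.isDiagram y.2.isDiagram h)))
  · rw [basis_mul_of_not_compatible h, basis_mul_of_not_compatible (mt compatible_reflect.1 h),
      map_zero]

theorem reflection_mul (a b : GhostAlgebra κ n P) :
    reflection κ n P (a * b) = reflection κ n P b * reflection κ n P a := by
  induction a using basis_induction with
  | zero => simp
  | add a a' h h' => simp only [add_mul, mul_add, map_add, h, h']
  | smul r a h => simp only [smul_mul_assoc, mul_smul_comm, map_smul, h]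
  | basis x =>
    induction b using basis_induction with
    | zero => simp
    | add a a' h h' => simp only [add_mul, mul_add, map_add, h, h']
    | smul r a h => simp only [smul_mul_assoc, mul_smul_comm, map_smul, h]
    | basis y => exact reflection_basis_mul x y

theorem reflection_one : reflection κ n P 1 = 1 := by
  by_cases hκ : κ.Dilute
  · rw [one_eq_of_dilute hκ, map_sum]
    refine Finset.sum_congr rfl fun E _ => ?_
    rw [reflection_ofDrawing (horizontal_ofKind (.inl hκ)), reflect_horizontal]
  · rw [one_eq_of_not_dilute hκ, reflection_ofDrawing (horizontal_ofKind (.inr rfl)),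
      reflect_horizontal]

protected theorem one_mul (a : GhostAlgebra κ n P) : 1 * a = a := by
  -- The left unit law is the mirror image of the right one.
  rw [← reflection_reflection (1 * a), reflection_mul, reflection_one, GhostAlgebra.mul_one,
    reflection_reflection]

/-! ## The cell datum -/

theorem compatible_half {d e : ℕ} (S : HalfDiagram κ n d) (T : HalfDiagram κ e d) :
    Compatible S.1 T.1.reflect :=
  compatible_of_through S.2.2 T.2.2

/-- The diagram with the given left and right halves. -/
noncomputable def glueDiagram {d : ℕ} (S T : HalfDiagram κ n d) : Diagram κ n :=
  ⟨concat S.1 T.1.reflect, concat_ofKind S.2.1 (reflect_ofKind T.2.1) (compatible_half S T)⟩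

/-- The default value zero of `ofDrawing` does not occur: half-diagrams with equally many defects
are compatible. -/
theorem glue_eq_basis (d : Fin (n + 1)) (S T : HalfDiagram κ n d) :
    glue κ n P d S T = basis (glueDiagram S T) :=
  ofDrawing_eq _

theorem reflect_glueDiagram {d : ℕ} (S T : HalfDiagram κ n d) :
    (glueDiagram S T).1.reflect = (glueDiagram T S).1 := by
  rw [glueDiagram, concat_reflect S.2.1.isDiagram (reflect_isDiagram T.2.1.isDiagram)
    (compatible_half S T), reflect_reflect]
  rfl

theorem le_of_glueDiagram_eq {d e : ℕ} {S T : HalfDiagram κ n d} {S' T' : HalfDiagram κ n e}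
    (h : glueDiagram S T = glueDiagram S' T') : d ≤ e :=
  le_of_concat_eq S.2.1.isDiagram T.2.1.isDiagram S'.2.1.isDiagram T'.2.1.isDiagram S.2.2 T.2.2
    (compatible_half S' T') (congrArg Subtype.val h)

theorem left_eq_of_glueDiagram_eq {d : ℕ} {S T S' T' : HalfDiagram κ n d}
    (h : glueDiagram S T = glueDiagram S' T') : S = S' :=
  Subtype.ext (eq_of_concat_eq S.2.1.isDiagram T.2.1.isDiagram S'.2.1.isDiagram T'.2.1.isDiagram
    S.2.2 T.2.2 (compatible_half S' T') (congrArg Subtype.val h))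

theorem right_eq_of_glueDiagram_eq {d : ℕ} {S T S' T' : HalfDiagram κ n d}
    (h : glueDiagram S T = glueDiagram S' T') : T = T' := by
  refine left_eq_of_glueDiagram_eq (T := S) (T' := S') (Subtype.ext ?_)
  rw [← reflect_glueDiagram S T, ← reflect_glueDiagram S' T', h]

variable (κ n) in
-- Surjectivity is cutting of throughlines. For injectivity the number of defects is found by
-- comparing in both directions, the left half by cancellation, and the right half by reflection.
theorem glueDiagram_bijective : Function.Bijective
    fun s : Σ d : Fin (n + 1), HalfDiagram κ n d × HalfDiagram κ n d =>
      glueDiagram s.2.1 s.2.2 := by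
  constructor
  · rintro ⟨d, S, T⟩ ⟨e, S', T'⟩ h
    obtain rfl : d = e := Fin.ext (le_antisymm (le_of_glueDiagram_eq h)
      (le_of_glueDiagram_eq h.symm))
    obtain rfl : S = S' := left_eq_of_glueDiagram_eq h
    obtain rfl : T = T' := right_eq_of_glueDiagram_eq h
    rfl
  · rintro ⟨D, hD⟩
    obtain ⟨d, S, T, hS, hSt, hT, hTt, h⟩ := exists_half_diagrams hD
    exact ⟨⟨⟨d, Nat.lt_succ_of_le (hSt.le hS.isDiagram)⟩, ⟨S, hS, hSt⟩, ⟨T, hT, hTt⟩⟩,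
      Subtype.ext h⟩

theorem glue_eq_comp : (fun s : Σ d : Fin (n + 1), HalfDiagram κ n d × HalfDiagram κ n d =>
    glue κ n P s.1 s.2.1 s.2.2) = basis ∘ fun s => glueDiagram s.2.1 s.2.2 :=
  funext fun s => glue_eq_basis s.1 s.2.1 s.2.2

variable (P) in
/-- The span of the basis elements with fewer than `d` throughlines. -/
noncomputable def lowerSpan (d : Fin (n + 1)) : Submodule R (GhostAlgebra κ n P) :=
  Submodule.span R {b | ∃ μ, μ < d ∧ ∃ U V : HalfDiagram κ n μ, b = glue κ n P μ U V}

/-- Attaching `T*` along its defects has weight 1, both to `S` and to the product of `x` and `S`.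
Associativity of the weights then leaves a factor in which `T` does not occur. -/
theorem basis_mul_glue {x : Diagram κ n} {d : Fin (n + 1)} {S T : HalfDiagram κ n d}
    (h : Compatible x.1 S.1) : (basis x * glue κ n P d S T : GhostAlgebra κ n P) =
      weight P x.1 S.1 • ofDrawing (concat (concat x.1 S.1) T.1.reflect) := by
  have hx := x.2.isDiagram
  have hS := S.2.1.isDiagram
  have hT := T.2.1.isDiagram
  have hST := compatible_half S T
  have hc := (compatible_concat_right (x := x.1) hS (reflect_isDiagram hT) hST).2 h
  have hw := weight_assoc P hx hS (reflect_isDiagram hT) h hST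
  rw [weight_reflect_of_through P hS hT T.2.2 hST, weight_reflect_of_through P
    (concat_isDiagram hx hS h) hT T.2.2 ((compatible_concat_left hx hS h).2 hST), mul_one,
    one_mul] at hw
  rw [glue_eq_basis, basis_mul_basis, diagramMul, hw,
    concat_assoc hx hS (reflect_isDiagram hT) h hST]
  exact if_pos hc

theorem basis_mul_glue_eq_zero {x : Diagram κ n} {d : Fin (n + 1)} {S T : HalfDiagram κ n d}
    (h : ¬ Compatible x.1 S.1) : (basis x * glue κ n P d S T : GhostAlgebra κ n P) = 0 := by
  rw [glue_eq_basis]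
  exact basis_mul_of_not_compatible fun hc => h ((compatible_concat_right S.2.1.isDiagram
    (reflect_isDiagram T.2.1.isDiagram) (compatible_half S T)).1 hc)

/-- Cutting the product gives `U V*` with `e` defects, and cancellation yields `e ≤ d`. If `e = d`,
cancellation would identify `U` with `x`, which is not through. -/
theorem ofDrawing_mem_lowerSpan {d : Fin (n + 1)} {x : Drawing n d} (hx : x.OfKind κ)
    (hxt : ¬ x.Through) (T : HalfDiagram κ n d) (hc : Compatible x T.1.reflect) :
    ofDrawing (concat x T.1.reflect) ∈ lowerSpan (κ := κ) P d := by
  obtain ⟨e, U, V, hU, hUt, hV, hVt, h⟩ :=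
    exists_half_diagrams (concat_ofKind hx (reflect_ofKind T.2.1) hc)
  have hle : e ≤ d := le_of_concat_eq hU.isDiagram hV.isDiagram hx.isDiagram T.2.1.isDiagram hUt hVt
    hc h
  have hne : e ≠ d := by
    rintro rfl
    exact hxt (eq_of_concat_eq hU.isDiagram hV.isDiagram hx.isDiagram T.2.1.isDiagram hUt hVt hc h ▸
      hUt)
  exact Submodule.subset_span ⟨⟨e, hle.trans_lt d.2⟩, Fin.lt_def.2 (lt_of_le_of_ne hle hne), ⟨U, hU, hUt⟩,
    ⟨V, hV, hVt⟩, congrArg _ h.symm⟩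

open Classical in
/-- The coefficients of the action of a diagram on half-diagrams. -/
noncomputable def actionCoeff (P : Params R) {d : Fin (n + 1)} (x : Diagram κ n)
    (S' S : HalfDiagram κ n d) : R :=
  if Compatible x.1 S.1 ∧ S'.1 = concat x.1 S.1 then weight P x.1 S.1 else 0

/-- If the product of `x` and `S` is through, it is the only half-diagram with a coefficient that
can be nonzero and the congruence is an equality; otherwise all coefficients vanish and the product
lies in the lower span. -/
theorem basis_mul_glue_sub_mem (x : Diagram κ n) {d : Fin (n + 1)} (S T : HalfDiagram κ n d) :
    basis x * glue κ n P d S T - ∑ᶠ S', actionCoeff P x S' S • glue κ n P d S' T ∈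
      lowerSpan P d := by
  by_cases h : Compatible x.1 S.1
  · have hxS := concat_ofKind x.2 S.2.1 h
    by_cases ht : (concat x.1 S.1).Through
    · rw [finsum_eq_single _ ⟨concat x.1 S.1, hxS, ht⟩, basis_mul_glue h, actionCoeff,
        if_pos ⟨h, rfl⟩]
      · rw [glue, sub_self]
        exact zero_mem _
      · intro S' hS'
        rw [actionCoeff, if_neg fun e => hS' (Subtype.ext e.2), zero_smul]
    · have h0 : ∀ S' : HalfDiagram κ n d, actionCoeff P x S' S = 0 := by
        intro S'
        rw [actionCoeff, if_neg]
        rintro ⟨-, e⟩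
        exact ht (e ▸ S'.2.2)
      simp only [h0, zero_smul, finsum_zero, sub_zero]
      rw [basis_mul_glue h]
      exact Submodule.smul_mem _ _ (ofDrawing_mem_lowerSpan hxS ht T ((compatible_concat_left
        x.2.isDiagram S.2.1.isDiagram h).2 (compatible_half S T)))
  · have h0 : ∀ S' : HalfDiagram κ n d, actionCoeff P x S' S = 0 := fun S' => if_neg fun e => h e.1
    simp only [h0, zero_smul, finsum_zero, sub_zero]
    rw [basis_mul_glue_eq_zero h]
    exact zero_mem _

/-- The condition is linear in the pair of `a` and its coefficients, so the case of a single diagram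
suffices. Finiteness of the set of half-diagrams makes the sums additive. -/
theorem exists_action_coeff (d : Fin (n + 1)) (a : GhostAlgebra κ n P) :
    ∃ r : HalfDiagram κ n d → HalfDiagram κ n d → R, ∀ S T : HalfDiagram κ n d,
      a * glue κ n P d S T - ∑ᶠ S', r S' S • glue κ n P d S' T ∈ lowerSpan P d := by
  have := Fintype.ofFinite (HalfDiagram κ n d)
  induction a using basis_induction with
  | basis x => exact ⟨actionCoeff P x, basis_mul_glue_sub_mem x⟩
  | zero => exact ⟨0, fun S T => by simp⟩
  | add a b ha hb =>
    obtain ⟨r, hr⟩ := ha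
    obtain ⟨s, hs⟩ := hb
    refine ⟨r + s, fun S T => ?_⟩
    have := add_mem (hr S T) (hs S T)
    simp only [finsum_eq_sum_of_fintype, Pi.add_apply, add_smul, Finset.sum_add_distrib,
      add_mul] at this ⊢
    rwa [add_sub_add_comm]
  | smul c a ha =>
    obtain ⟨r, hr⟩ := ha
    refine ⟨c • r, fun S T => ?_⟩
    have := Submodule.smul_mem _ c (hr S T)
    simpa only [finsum_eq_sum_of_fintype, Pi.smul_apply, smul_assoc, ← Finset.smul_sum,
      smul_mul_assoc, ← smul_sub] using this

end GhostAlgebra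

end GhostAlg

/-! ### The cell datum of the four families -/

theorem theorem5 {R : Type*} [CommRing R] [Nontrivial R] (P : GhostAlg.Params R)
    (κ : GhostAlg.Kind) (n : ℕ) :
    (∀ x y : GhostAlg.Diagram κ n, GhostAlg.Compatible x.1 y.1 →
      (GhostAlg.concat x.1 y.1).OfKind κ) ∧
    GhostAlg.IsCellDatum R (GhostAlg.GhostAlgebra κ n P)
      (fun d : Fin (n + 1) => GhostAlg.HalfDiagram κ n d)
      (GhostAlg.GhostAlgebra.glue κ n P) (GhostAlg.GhostAlgebra.reflection κ n P) := by
  open GhostAlg GhostAlgebra in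
  refine ⟨fun x y h => concat_ofKind x.2 y.2 h, ?_⟩
  exact {
    mul_assoc := GhostAlgebra.mul_assoc
    one_mul := GhostAlgebra.one_mul
    mul_one := GhostAlgebra.mul_one
    finite := fun d => inferInstance
    injective := by
      rw [glue_eq_comp]
      exact basis.injective.comp (glueDiagram_bijective κ n).1
    linearIndependent := by
      rw [glue_eq_comp]
      exact basis.linearIndependent.comp _ (glueDiagram_bijective κ n).1
    span_eq_top := by
      rw [glue_eq_comp, (glueDiagram_bijective κ n).2.range_comp]
      exact basis.span_eq
    star_star := reflection_reflection
    star_mul := reflection_mul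
    star_apply := fun d S T => by
      rw [glue_eq_basis, glue_eq_basis, reflection_basis]
      exact congrArg _ (Subtype.ext (reflect_glueDiagram S T))
    mul_apply := exists_action_coeff }
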